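/- Let $V$ be a rational vector space of dimension $p+1$ with a symmetric bilinear form $(\,,)$ of signature $(p,1)$, let $L\subset V$ be an integral $\mathbb Z$-lattice of full rank with dual lattice $L^{\#}\supseteq L$, and let $B\subset V(\mathbb R)$ be one sheet of the hyperboloid $\{Z:(Z,Z)=-1\}$, so that $T_ZB=Z^\perp$. Let $\Gamma$ be a neat subgroup of finite index in the group of those $g\in SO(V)$ that stabilize $L$ and lie in the identity component of $SO(V(\mathbb R))$ (equivalently, map $B$ to itself), and assume that $\Gamma$ acts trivially on $L^{\#}/L$. Let $0\le n\le p$, let $h\in (L^{\#})^n$, and let $U\subset V$ be a rational positive definite subspace of dimension $p-n$. Put $B_U=\{Z\in B: Z\perp U\}$, let $\Gamma_U$ be the pointwise stabilizer of $U$ in $\Gamma$, and let $C_U=\Gamma_U\backslash B_U$, a hyperbolic $n$-manifold, oriented by an orientation of $B_U$. Write $L_U=L\cap U$ and $L_{U^\perp}=L\cap U^\perp$. For a real quadratic space $E$ of dimension $m$ and signature $(m-1,1)$, a point $Z\in E$ with $(Z,Z)=-1$, $X=(x_1,\dots,x_n)\in E^n$ and $W=(w_1,\dots,w_n)\in (Z^\perp)^n$,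 let $(\,,)_Z$ be the majorant equal to $(\,,)$ on $Z^\perp$ and to $-(\,,)$ on $\mathbb RZ$, and put $$\varphi_{n,E}(X,Z)(W)=2^{n/2}\det\big((x_s,w_j)\big)_{s,j}\,e^{-\pi\, \mathrm{tr}(X,X)_Z},$$ where $(X,X)=((x_i,x_j))_{i,j}$ and $(X,X)_Z=((x_i,x_j)_Z)_{i,j}$. For $\tau=u+iv$ in the Siegel upper half space $\mathbb H_n$ put $\varphi_{n,E}(\tau,X,Z)=\det(v)^{-m/4}\,\omega(g'_\tau)\varphi_{n,E}(X,Z)$, where $\omega$ is the Weil representation and $g'_\tau=\begin{pmatrix}1&u\\0&1\end{pmatrix}\begin{pmatrix}v^{1/2}&0\\0&v^{-1/2}\end{pmatrix}$; explicitly, $$\varphi_{n,E}(\tau,X,Z)=\det(v)^{-m/4}\,e^{\pi i\,\mathrm{tr}(u(X,X))}\,\det(v^{1/2})^{m/2}\,\varphi_{n,E}(Xv^{1/2},Z).$$ Let $\theta(\tau,Z)=\sum_{X\in L^n+h}\varphi_{n,V}(\tau,X,Z)$, an $n$-form on $B$, and $\Lambda(\tau,C_U)=\int_{C_U}\theta(\tau,Z)$.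 1. Let $i_U:B_U\to B$ be the inclusion. For $X'\in U(\mathbb R)^n$ and $X''\in U^\perp(\mathbb R)^n$, one has $i_U^*\,\varphi_{n,V}(X'+X'',\cdot)=e^{-\pi\,\mathrm{tr}(X',X')}\,\varphi_{n,U^\perp}(X'',\cdot)$ on $B_U$, that is, $i_U^*\varphi_{n,V}=\varphi_{0,U}\otimes\varphi_{n,U^\perp}$ with $\varphi_{0,U}$ the standard Gaussian of $U$. 2. There is a finite decomposition into disjoint pieces $$L^n+h=\coprod_{i=1}^{s}\Big(\big(L_U^n+h'_i\big)+\big(L_{U^\perp}^n+h''_i\big)\Big),\qquad h'_i\in (L_U^{\#})^n,\quad h''_i\in (L_{U^\perp}^{\#})^n .$$ 3. For every such decomposition and every $\tau\in\mathbb H_n$, $$\Lambda(\tau,C_U)=\sum_{i=1}^{s}\vartheta(\tau,L_U+h'_i)\;\theta_{C_U}(\tau,L_{U^\perp}+h''_i),$$ where $\vartheta(\tau,L_U+h'_i)=\sum_{X\in L_U^n+h'_i}e^{\pi i\,\mathrm{tr}((X,X)\tau)}$ is the standard theta series of degree $n$ of the positive definite space $U$, and $\theta_{C_U}(\tau,L_{U^\perp}+h''_i)=\int_{C_U}\sum_{X\in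 L_{U^\perp}^n+h''_i}\varphi_{n,U^\perp}(\tau,X,Z)$ is the top-degree theta integral for the hyperbolic space $C_U$ attached to the space $U^\perp$ of signature $(n,1)$. All these series and integrals converge absolutely. -/

import Mathlib

open scoped TensorProduct MatrixOrder

namespace SpecialCycleTheta

/-! ### Real quadratic spaces, hyperbolic space and the Schwartz forms -/

section RealSpace

variable {E : Type*} [AddCommGroup E] [Module ℝ E]

/-- The sheet of the two-sheeted hyperboloid `{Z | (Z,Z) = -1}` that contains `Z₀`
(`b` has signature `(p,1)` and `(Z₀,Z₀) = -1`): the hyperbolic space `B`. -/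
def sheet (b : LinearMap.BilinForm ℝ E) (Z₀ : E) : Set E :=
  {Z | b Z Z = -1 ∧ b Z Z₀ < 0}

/-- The minimal majorant `(x,y)_Z` attached to `Z` with `(Z,Z) = -1`: it is `(x,y)` on `Z^⊥`,
it is `-(x,y)` on the line `ℝ Z`, and the two subspaces are orthogonal for it. -/
def majorant (b : LinearMap.BilinForm ℝ E) (Z x y : E) : ℝ :=
  b x y + 2 * b x Z * b y Z

/-- The Gram matrix `(X,X)` of an `n`-tuple. -/
def gram {n : ℕ} (b : LinearMap.BilinForm ℝ E) (X : Fin n → E) : Matrix (Fin n) (Fin n) ℝ :=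
  Matrix.of fun i j => b (X i) (X j)

/-- The Gaussian `φ_0(X,Z) = exp(-π tr (X,X)_Z)`. -/
noncomputable def gaussianAt {n : ℕ} (b : LinearMap.BilinForm ℝ E) (X : Fin n → E) (Z : E) : ℝ :=
  Real.exp (-Real.pi * ∑ s, majorant b Z (X s) (X s))

/-- The standard Gaussian `exp(-π tr (X,X))` of a positive definite space. -/
noncomputable def gaussianPos {n : ℕ} (b : LinearMap.BilinForm ℝ E) (X : Fin n → E) : ℝ :=
  Real.exp (-Real.pi * (gram b X).trace)

/-- The Schwartz form `φ_n(X,Z) = 2^{n/2} (ω(1,X) ∧ ⋯ ∧ ω(n,X)) φ_0(X,Z)`, where `ω(s,X)` is the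
covector `w ↦ (x_s, w)` on `T_Z B = Z^⊥`. It is given through its values on `n`-tuples `W`
of tangent vectors; the wedge of `n` covectors takes the value `det ((x_s, w_j))` there. -/
noncomputable def phi {n : ℕ} (b : LinearMap.BilinForm ℝ E) (X : Fin n → E) (Z : E)
    (W : Fin n → E) : ℝ :=
  (2 : ℝ) ^ ((n : ℝ) / 2) * (Matrix.of fun s j => b (X s) (W j)).det * gaussianAt b X Z

/-- Weil representation, Levi part: `diag(a, ᵗa⁻¹)` with `det a > 0` acts by
`ψ(X) ↦ (det a)^{m/2} ψ(X a)`, where `m = dim E`. -/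
noncomputable def weilLevi {n : ℕ} (a : Matrix (Fin n) (Fin n) ℝ) (ψ : (Fin n → E) → ℂ) :
    (Fin n → E) → ℂ :=
  fun X => (((a.det) ^ ((Module.finrank ℝ E : ℝ) / 2) : ℝ) : ℂ) * ψ (fun j => ∑ i, a i j • X i)

/-- Weil representation, unipotent part: `(1 u; 0 1)` acts by
`ψ(X) ↦ e^{π i tr(u (X,X))} ψ(X)`. -/
noncomputable def weilUnip {n : ℕ} (b : LinearMap.BilinForm ℝ E) (u : Matrix (Fin n) (Fin n) ℝ)
    (ψ : (Fin n → E) → ℂ) : (Fin n → E) → ℂ :=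
  fun X => Complex.exp (Real.pi * Complex.I * ((u * gram b X).trace : ℝ)) * ψ X

/-- The Siegel upper half space: symmetric complex matrices with positive definite imaginary
part. -/
def SiegelUpperHalf (n : ℕ) : Set (Matrix (Fin n) (Fin n) ℂ) :=
  {τ | τ.IsSymm ∧ (τ.map Complex.im).PosDef}

/-- `φ_n(τ,X,Z) = det(v)^{-m/4} ω(g'_τ) φ_n(X,Z)` for `τ = u + i v`, where
`g'_τ = (1 u; 0 1) diag(v^{1/2}, v^{-1/2})` and `m = dim E`; value on tangent vectors `W`. -/
noncomputable def phiTau {n : ℕ} (b : LinearMap.BilinForm ℝ E) (τ : Matrix (Fin n) (Fin n) ℂ)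
    (X : Fin n → E) (Z : E) (W : Fin n → E) : ℂ :=
  (((τ.map Complex.im).det ^ (-(Module.finrank ℝ E : ℝ) / 4) : ℝ) : ℂ) *
    weilUnip b (τ.map Complex.re)
      (weilLevi (CFC.sqrt (τ.map Complex.im)) (fun Y => ((phi b Y Z W : ℝ) : ℂ))) X

end RealSpace

/-! ### Integration of forms of top degree over arithmetic quotients of hyperbolic `n`-space -/

section Integration

/-- The hyperboloid chart `y ↦ (y, √(1 + |y|²))` of hyperbolic `n`-space in `ℝ^{n,1}`. -/
noncomputable def chart (n : ℕ) (y : Fin n → ℝ) : Fin (n + 1) → ℝ :=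
  Fin.snoc (α := fun _ => ℝ) y (Real.sqrt (1 + ∑ i, y i ^ 2))

variable {E : Type*} [AddCommGroup E] [Module ℝ E]

/-- `f` is orthonormal of type `(+,…,+,-)`: `(f_i,f_i) = 1` for `i < n`, `(f_n,f_n) = -1` and
`(f_i,f_j) = 0` for `i ≠ j`. -/
def IsLorentzFrame {n : ℕ} (b : LinearMap.BilinForm ℝ E) (f : Fin (n + 1) → E) : Prop :=
  ∀ i j, b (f i) (f j) = if i = j then (if i = Fin.last n then -1 else 1) else 0

/-- The global chart of the hyperbolic space of `E` given by a Lorentz frame `f`; it covers the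
sheet of `f_n`. -/
noncomputable def hypPoint {n : ℕ} (f : Fin (n + 1) → E) (y : Fin n → ℝ) : E :=
  ∑ k, chart n y k • f k

/-- The coordinate tangent vectors `∂/∂y_1, …, ∂/∂y_n` of the chart `hypPoint f`. -/
noncomputable def hypTangent {n : ℕ} (f : Fin (n + 1) → E) (y : Fin n → ℝ) (j : Fin n) : E :=
  ∑ k, (fderiv ℝ (chart n) y (Pi.single j 1)) k • f k

/-- The coefficient of `dy_1 ∧ ⋯ ∧ dy_n` in the pullback of the `n`-form `ω` by the chart.
A form is a function of the point and of `n` tangent vectors. -/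
noncomputable def coefficient {n : ℕ} (f : Fin (n + 1) → E) (ω : E → (Fin n → E) → ℂ)
    (y : Fin n → ℝ) : ℂ :=
  ω (hypPoint f y) (hypTangent f y)

/-- The integral of the `n`-form `ω` over the part of hyperbolic `n`-space with chart image `F`,
oriented by `dy_1 ∧ ⋯ ∧ dy_n`. -/
noncomputable def integralForm {n : ℕ} (f : Fin (n + 1) → E) (F : Set (Fin n → ℝ))
    (ω : E → (Fin n → E) → ℂ) : ℂ :=
  ∫ y in F, coefficient f ω y

/-- Absolute convergence of `integralForm f F ω`. -/
def IntegrableForm {n : ℕ} (f : Fin (n + 1) → E) (F : Set (Fin n → ℝ))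
    (ω : E → (Fin n → E) → ℂ) : Prop :=
  MeasureTheory.IntegrableOn (coefficient f ω) F

/-- Pullback of a form by the restriction of a linear map. -/
def pullback {E' : Type*} [AddCommGroup E'] [Module ℝ E'] {n : ℕ} (ι : E' →ₗ[ℝ] E)
    (ω : E → (Fin n → E) → ℂ) : E' → (Fin n → E') → ℂ :=
  fun Z W => ω (ι Z) (fun j => ι (W j))

end Integration

/-! ### Rational quadratic spaces, lattices and arithmetic groups -/

section RationalSpace

variable {V : Type*} [AddCommGroup V] [Module ℚ V]

/-- The real bilinear form on `V(ℝ) = ℝ ⊗ V`. -/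
noncomputable abbrev realForm (B : LinearMap.BilinForm ℚ V) : LinearMap.BilinForm ℝ (ℝ ⊗[ℚ] V) :=
  LinearMap.BilinForm.baseChange ℝ B

/-- The `n`-tuple in `V(ℝ)` given by an `n`-tuple in `V`. -/
noncomputable def toReal {n : ℕ} (X : Fin n → V) : Fin n → ℝ ⊗[ℚ] V := fun s => 1 ⊗ₜ[ℚ] X s

/-- `V` is a quadratic space of signature `(p,1)`. -/
structure IsLorentzian (B : LinearMap.BilinForm ℚ V) (p : ℕ) : Prop where
  symm : ∀ x y, B x y = B y x
  dim : Module.finrank ℚ V = p + 1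
  pos : sigPos (LinearMap.BilinMap.toQuadraticMap (realForm B)) = p
  neg : sigNeg (LinearMap.BilinMap.toQuadraticMap (realForm B)) = 1

/-- `L` is an integral `ℤ`-lattice of full rank: `L ⊆ L^#`. -/
structure IsIntegralLattice (B : LinearMap.BilinForm ℚ V) (L : Submodule ℤ V) : Prop where
  fg : L.FG
  span : Submodule.span ℚ (L : Set V) = ⊤
  integral : L ≤ LinearMap.BilinForm.dualSubmodule B L

/-- The coset `L^n + h` in `V^n`. -/
def coset {n : ℕ} (L : Submodule ℤ V) (h : Fin n → V) : Set (Fin n → V) :=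
  {X | ∀ s, X s - h s ∈ L}

/-- `L_W = L ∩ W`, as a `ℤ`-submodule of `W`. -/
def latticeIn (L : Submodule ℤ V) (W : Submodule ℚ V) : Submodule ℤ W :=
  L.comap (W.subtype.restrictScalars ℤ)

/-- The inclusion `W(ℝ) → V(ℝ)` of a rational subspace `W`. -/
noncomputable def inclReal (W : Submodule ℚ V) : (ℝ ⊗[ℚ] W) →ₗ[ℝ] (ℝ ⊗[ℚ] V) :=
  W.subtype.baseChange ℝ

/-- The real action of a rational linear automorphism. -/
noncomputable def actReal (g : V ≃ₗ[ℚ] V) : (ℝ ⊗[ℚ] V) →ₗ[ℝ] (ℝ ⊗[ℚ] V) :=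
  (g : V →ₗ[ℚ] V).baseChange ℝ

/-- `γ` belongs to `Γ(L) ∩ G_0(ℝ)`: it lies in `SO(V)`, stabilizes the lattice `L`, and lies in the
identity component of `SO(V(ℝ))`, which is the subgroup that maps the sheet of `Z₀` to itself. -/
structure IsArithmetic (B : LinearMap.BilinForm ℚ V) (L : Submodule ℤ V) (Z₀ : ℝ ⊗[ℚ] V)
    (γ : V ≃ₗ[ℚ] V) : Prop where
  isometry : ∀ x y, B (γ x) (γ y) = B x y
  det : LinearEquiv.det γ = 1
  stable : ∀ x, γ x ∈ L ↔ x ∈ L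
  preservesSheet : ∀ Z, actReal γ Z ∈ sheet (realForm B) Z₀ ↔ Z ∈ sheet (realForm B) Z₀

/-- The group `Γ(L) ∩ G_0(ℝ)`. -/
def arithmeticGroup (B : LinearMap.BilinForm ℚ V) (L : Submodule ℤ V) (Z₀ : ℝ ⊗[ℚ] V) :
    Subgroup (V ≃ₗ[ℚ] V) where
  carrier := {γ | IsArithmetic B L Z₀ γ}
  one_mem' := by
    refine ⟨fun _ _ => rfl, map_one _, fun _ => Iff.rfl, fun Z => ?_⟩
    have : actReal (1 : V ≃ₗ[ℚ] V) = LinearMap.id := by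
      ext x; simp [actReal]
    rw [this]; rfl
  mul_mem' := by
    intro g k hg hk
    refine ⟨fun x y => ?_, ?_, fun x => ?_, fun Z => ?_⟩
    · rw [LinearEquiv.mul_apply, LinearEquiv.mul_apply, hg.isometry, hk.isometry]
    · rw [map_mul, hg.det, hk.det, one_mul]
    · rw [LinearEquiv.mul_apply, hg.stable, hk.stable]
    · have : actReal (g * k) Z = actReal g (actReal k Z) := by
        have h2 : actReal (g * k) = actReal g ∘ₗ actReal k := by
          ext x; simp [actReal]
        rw [h2]; rfl
      rw [this, hg.preservesSheet, hk.preservesSheet]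
  inv_mem' := by
    intro g hg
    have e1 : ∀ x, g (g⁻¹ x) = x := fun x => by
      rw [← LinearEquiv.mul_apply, mul_inv_cancel]; rfl
    refine ⟨fun x y => ?_, ?_, fun x => ?_, fun Z => ?_⟩
    · rw [← hg.isometry, e1, e1]
    · rw [map_inv, hg.det, inv_one]
    · rw [← hg.stable, e1]
    · have : actReal g (actReal g⁻¹ Z) = Z := by
        have h2 : actReal g ∘ₗ actReal g⁻¹ = LinearMap.id := by
          ext x; simp [actReal]
        exact LinearMap.congr_fun h2 Z
      rw [← hg.preservesSheet, this]

/-- `γ` is neat: its complex eigenvalues generate a torsion-free subgroup of `ℂˣ`. -/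
def IsNeat (γ : V ≃ₗ[ℚ] V) [FiniteDimensional ℚ V] : Prop :=
  ∀ z ∈ Subgroup.closure {z : ℂˣ |
      ((LinearMap.charpoly (γ : V →ₗ[ℚ] V)).map (algebraMap ℚ ℂ)).IsRoot (z : ℂ)},
    ∀ k : ℕ, k ≠ 0 → z ^ k = 1 → z = 1

/-- `Γ` is a neat subgroup of finite index in `Γ(L) ∩ G_0(ℝ)` acting trivially on `L^# / L`. -/
structure IsLevelGroup [FiniteDimensional ℚ V] (B : LinearMap.BilinForm ℚ V) (L : Submodule ℤ V)
    (Z₀ : ℝ ⊗[ℚ] V) (Γ : Subgroup (V ≃ₗ[ℚ] V)) : Prop where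
  le : Γ ≤ arithmeticGroup B L Z₀
  finiteIndex : Γ.relIndex (arithmeticGroup B L Z₀) ≠ 0
  neat : ∀ γ ∈ Γ, IsNeat γ
  trivial : ∀ γ ∈ Γ, ∀ x ∈ LinearMap.BilinForm.dualSubmodule B L, γ x - x ∈ L

/-- `Γ_U`, the pointwise stabilizer of `U` in `Γ`. -/
def stabilizer (Γ : Subgroup (V ≃ₗ[ℚ] V)) (U : Submodule ℚ V) : Subgroup (V ≃ₗ[ℚ] V) where
  carrier := {γ | γ ∈ Γ ∧ ∀ x ∈ U, γ x = x}
  one_mem' := ⟨Γ.one_mem, fun _ _ => rfl⟩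
  mul_mem' := by
    intro g k hg hk
    refine ⟨Γ.mul_mem hg.1 hk.1, fun x hx => ?_⟩
    rw [LinearEquiv.mul_apply, hk.2 x hx, hg.2 x hx]
  inv_mem' := by
    intro g hg
    refine ⟨Γ.inv_mem hg.1, fun x hx => ?_⟩
    conv_lhs => rw [← hg.2 x hx]
    rw [← LinearEquiv.mul_apply, inv_mul_cancel]; rfl

/-- `U^⊥`, the rational orthogonal complement of `U`. -/
abbrev perp (B : LinearMap.BilinForm ℚ V) (U : Submodule ℚ V) : Submodule ℚ V :=
  LinearMap.BilinForm.orthogonal B U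

/-- An oriented global chart of `B_U = {Z ∈ B | Z ⊥ U}`, given by a Lorentz frame
of `U^⊥(ℝ)` whose last vector lies on the sheet `B`. The orientation of `C_U` is the one for which
`(f_1, …, f_n)` is a positive basis of the tangent space at `f_{n+1}`; both orientations
occur among such frames when `n ≥ 1`. -/
def IsChartFrame {n : ℕ} (B : LinearMap.BilinForm ℚ V) (Z₀ : ℝ ⊗[ℚ] V) (U : Submodule ℚ V)
    (f : Fin (n + 1) → ℝ ⊗[ℚ] (perp B U)) : Prop :=
  IsLorentzFrame (realForm (B.restrict (perp B U))) f ∧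
    inclReal (perp B U) (f (Fin.last n)) ∈ sheet (realForm B) Z₀

/-- `F` is (in the chart of `f`) a measurable fundamental domain for the action of `Γ_U` on `B_U`:
its translates cover `B_U` up to a null set, and distinct translates overlap in a null set.
Integrals of `Γ_U`-invariant forms over `C_U = Γ_U \ B_U` are integrals over `F`. -/
structure IsFundDomain {n : ℕ} (B : LinearMap.BilinForm ℚ V) (Γ : Subgroup (V ≃ₗ[ℚ] V))
    (U : Submodule ℚ V) (f : Fin (n + 1) → ℝ ⊗[ℚ] (perp B U)) (F : Set (Fin n → ℝ)) : Prop where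
  measurable : MeasurableSet F
  covers : ∀ᵐ y : Fin n → ℝ, ∃ γ ∈ stabilizer Γ U, ∃ y' ∈ F,
    actReal γ (inclReal (perp B U) (hypPoint f y')) = inclReal (perp B U) (hypPoint f y)
  disjoint : ∀ γ ∈ stabilizer Γ U, γ ≠ 1 →
    MeasureTheory.volume {y | y ∈ F ∧ ∃ y' ∈ F,
      actReal γ (inclReal (perp B U) (hypPoint f y')) = inclReal (perp B U) (hypPoint f y)} = 0

/-- The decomposition `L^n + h = ⨆_i (L_U^n + h'_i) + (L_{U^⊥}^n + h''_i)` into disjoint pieces,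
with `h'_i ∈ (L_U^#)^n` and `h''_i ∈ (L_{U^⊥}^#)^n`. -/
structure IsDecomposition {n r : ℕ} (B : LinearMap.BilinForm ℚ V) (L : Submodule ℤ V)
    (U : Submodule ℚ V) (h : Fin n → V) (h₁ : Fin r → Fin n → U)
    (h₂ : Fin r → Fin n → perp B U) : Prop where
  dual₁ : ∀ i s, h₁ i s ∈ LinearMap.BilinForm.dualSubmodule (B.restrict U) (latticeIn L U)
  dual₂ : ∀ i s, h₂ i s ∈
    LinearMap.BilinForm.dualSubmodule (B.restrict (perp B U)) (latticeIn L (perp B U))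
  union : ∀ X : Fin n → V, X ∈ coset L h ↔ ∃ i, ∃ X₁ ∈ coset (latticeIn L U) (h₁ i),
    ∃ X₂ ∈ coset (latticeIn L (perp B U)) (h₂ i), ∀ s, X s = X₁ s + X₂ s
  disjoint : ∀ i j, i ≠ j → ∀ X₁ ∈ coset (latticeIn L U) (h₁ i),
    ∀ X₂ ∈ coset (latticeIn L (perp B U)) (h₂ i), ∀ Y₁ ∈ coset (latticeIn L U) (h₁ j),
    ∀ Y₂ ∈ coset (latticeIn L (perp B U)) (h₂ j), ¬ ∀ s, (X₁ s : V) + X₂ s = Y₁ s + Y₂ s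

/-! ### Theta series and theta integrals -/

/-- The theta series `∑_{X ∈ L^n + h} φ_n(τ,X,Z)` with values in the `n`-forms on the hyperbolic
space of `V`. -/
noncomputable def thetaForm {n : ℕ} (B : LinearMap.BilinForm ℚ V) (L : Submodule ℤ V)
    (h : Fin n → V) (τ : Matrix (Fin n) (Fin n) ℂ) (Z : ℝ ⊗[ℚ] V) (W : Fin n → ℝ ⊗[ℚ] V) : ℂ :=
  ∑' X : coset L h, phiTau (realForm B) τ (toReal X.1) Z W

/-- The summand `e^{π i tr((X,X) τ)}` of the theta series of a positive definite space. -/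
noncomputable def thetaTerm {n : ℕ} (B : LinearMap.BilinForm ℚ V) (τ : Matrix (Fin n) (Fin n) ℂ)
    (X : Fin n → V) : ℂ :=
  Complex.exp (Real.pi * Complex.I *
    (((gram (realForm B) (toReal X)).map (algebraMap ℝ ℂ)) * τ).trace)

/-- The standard theta series `ϑ(τ, L + h) = ∑_{X ∈ L^n + h} e^{π i tr((X,X) τ)}` of degree `n` of a
positive definite space. -/
noncomputable def thetaSeries {n : ℕ} (B : LinearMap.BilinForm ℚ V) (L : Submodule ℤ V)
    (h : Fin n → V) (τ : Matrix (Fin n) (Fin n) ℂ) : ℂ :=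
  ∑' X : coset L h, thetaTerm B τ X.1

/-- `Λ(τ, C_U) = ∫_{C_U} θ_{φ_n}(τ,Z)`, the integral over `C_U` of the pullback to `B_U` of the
theta form of `V`. -/
noncomputable def liftOfCycle {n : ℕ} (B : LinearMap.BilinForm ℚ V) (L : Submodule ℤ V)
    (h : Fin n → V) (U : Submodule ℚ V) (f : Fin (n + 1) → ℝ ⊗[ℚ] (perp B U))
    (F : Set (Fin n → ℝ)) (τ : Matrix (Fin n) (Fin n) ℂ) : ℂ :=
  integralForm f F (pullback (inclReal (perp B U)) (thetaForm B L h τ))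

/-- `θ_{C_U}(τ, L_{U^⊥} + h'')`, the top degree theta integral over `C_U`, formed with the
quadratic space `U^⊥` of signature `(n,1)`. -/
noncomputable def topThetaIntegral {n : ℕ} (B : LinearMap.BilinForm ℚ V) (L : Submodule ℤ V)
    (U : Submodule ℚ V) (h₂ : Fin n → perp B U) (f : Fin (n + 1) → ℝ ⊗[ℚ] (perp B U))
    (F : Set (Fin n → ℝ)) (τ : Matrix (Fin n) (Fin n) ℂ) : ℂ :=
  integralForm f F (thetaForm (B.restrict (perp B U)) (latticeIn L (perp B U)) h₂ τ)

end RationalSpace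

end SpecialCycleTheta

open SpecialCycleTheta

/-!
The pullback identity is a computation: on `B_U` the majorant of `V` is the orthogonal sum of the
form on `U` and the majorant on `U^⊥`, and a tangent vector of `B_U` is orthogonal to `U`
(`phi_add_inclReal`). The decomposition exists because `L_U ⊕ L_{U^⊥}` has finite index in `L`
(`exists_isDecomposition`). Together with the absolute convergence of all theta series, which are
dominated by Gaussian sums (`summable_phiTau`), these two facts split the theta form on `B_U` as
the finite sum `∑_i ϑ(τ, L_U + h'_i) θ(τ, L_{U^⊥} + h''_i)` (`thetaForm_inclReal`).

What remains is to show that the top degree theta forms of `U^⊥`, of signature `(n,1)`, are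
integrable over a fundamental domain `F` of the discrete group `Γ_U`, although `C_U` may have
cusps and nothing is known about the shape of `F` (`integrableForm_thetaForm`). The form is, up to
a constant, the invariant measure times the theta kernel `Ψ(Z) = ∑_X det(Z, X) e^{π i tr(u (X,X))
- π tr(v (X,X)_Z)}`, in which the value on tangent vectors has become the volume of `(Z, X)`
(`frameDet_hypPoint`). Let `Γ'` be the subgroup of `Γ_U` fixing the class of `h''`; the modulus of
`Ψ` is `Γ'`-invariant (`norm_thetaKernel_isometry`).

* Reduction theory (`exists_reduced`): for every `Z` the lattice contains a rational basis with
  bounded Gram matrix that either is bounded at `Z`, or is adapted to an isotropic lattice vector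
  `e` with `|(e,Z)| ≤ 1`. There are finitely many `Γ'`-orbits of such data
  (`exists_finite_orbits`), since two bases with equal Gram matrices that are congruent modulo a
  multiple of `L` differ by an isometry of `L`. Hence finitely many compact regions and cusp
  regions have translates that cover hyperbolic space.
* Unfolding (`lintegral_chart_lt_top`): the translates of `F` are disjoint, so an invariant
  function has finite integral over `F` when its integrals over these regions are finite. The
  invariant measure is realized as Lebesgue measure on the truncated light cone `cone n`, on which
  isometries act linearly and with determinant `±1`; no transformation formula for the chart is
  needed.
* At a cusp (`exists_norm_kernel_cusp_le`) one has `|Ψ(Z)| = O(|(e,Z)|)`. The tuples with some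
  `(x_s, e) ≠ 0` contribute `e^{-c/(e,Z)²}`. If all `x_s` are orthogonal to `e`, then `det(Z, X)`
  is a combination of the `(x_s, Z)` with coefficients invariant under `x_s ↦ x_s + e`, so that
  the sum over the `e`-direction is an odd Gaussian series with a small parameter, which Poisson
  summation shows to be tiny. A boost moves the layers `2^{-(j+1)} < |(e,Z)| ≤ 2^{-j}` of a cusp
  region into a bounded set, so each has bounded volume, and the geometric series `∑ 2^{-j}`
  bounds the integral (`lintegral_cusp_region_lt_top`).
-/

namespace SpecialCycleTheta

/-! ### Lorentzian forms and their majorants -/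

section Hyperbolic

variable {E : Type*} [AddCommGroup E] [Module ℝ E]

/-- A symmetric real bilinear form for which the orthogonal complement of every vector of norm
`-1` is positive definite. Forms of signature `(p,1)` have this property, and it passes to
subspaces; it is all that is used of the signature. -/
structure IsHyperbolic (b : LinearMap.BilinForm ℝ E) : Prop where
  symm : ∀ x y, b x y = b y x
  pos : ∀ Z w, b Z Z = -1 → b w Z = 0 → w ≠ 0 → 0 < b w w

/-- The majorant as a bilinear form. -/
noncomputable def majorantForm (b : LinearMap.BilinForm ℝ E) (Z : E) : LinearMap.BilinForm ℝ E :=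
  b + (2 : ℝ) • LinearMap.BilinForm.linMulLin (b.flip Z) (b.flip Z)

lemma majorantForm_apply (b : LinearMap.BilinForm ℝ E) (Z x y : E) :
    majorantForm b Z x y = majorant b Z x y := by
  simp [majorantForm, majorant, LinearMap.BilinForm.linMulLin_apply, mul_assoc]

namespace IsHyperbolic

variable {b : LinearMap.BilinForm ℝ E} (hb : IsHyperbolic b) {Z : E} (hZ : b Z Z = -1)
include hb hZ

/-- The orthogonal projection to `Z^⊥` decomposes the majorant as a sum of squares. -/
lemma majorant_self_eq (x : E) :
    majorant b Z x x = b (x + b x Z • Z) (x + b x Z • Z) + (b x Z) ^ 2 := by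
  simp only [majorant, map_add, map_smul, LinearMap.add_apply, LinearMap.smul_apply, smul_eq_mul,
    hZ, hb.symm Z x]
  ring

omit hb in
lemma proj_orthogonal (x : E) : b (x + b x Z • Z) Z = 0 := by
  simp [hZ]

lemma nonneg_of_orthogonal {w : E} (hw : b w Z = 0) : 0 ≤ b w w := by
  rcases eq_or_ne w 0 with rfl | h
  · simp
  · exact (hb.pos Z w hZ hw h).le

lemma majorant_pos {x : E} (hx : x ≠ 0) : 0 < majorant b Z x x := by
  rw [hb.majorant_self_eq hZ]
  by_cases h : x + b x Z • Z = 0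
  · have h2 : b x Z ≠ 0 := by
      intro h3; rw [h3] at h; simp at h; exact hx h
    rw [h]; simp; positivity
  · have := hb.pos Z _ hZ (proj_orthogonal hZ x) h
    positivity

lemma majorant_nonneg (x : E) : 0 ≤ majorant b Z x x := by
  rcases eq_or_ne x 0 with rfl | h
  · simp [majorant]
  · exact (hb.majorant_pos hZ h).le

omit hZ in
lemma majorant_symm (x y : E) : majorant b Z x y = majorant b Z y x := by
  simp only [majorant, hb.symm x y]; ring

lemma majorant_sq_le (x y : E) :
    (majorant b Z x y) ^ 2 ≤ majorant b Z x x * majorant b Z y y := by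
  simp only [← majorantForm_apply]
  refine LinearMap.BilinForm.apply_sq_le_of_symm _ (fun v => ?_) ⟨fun v w => ?_⟩ x y
  · rw [majorantForm_apply]; exact hb.majorant_nonneg hZ v
  · simp only [majorantForm_apply]; exact hb.majorant_symm v w

/-- The form is bounded by the majorant: it arises from it by reflecting one argument in `Z`. -/
lemma sq_le_majorant (x y : E) : (b x y) ^ 2 ≤ majorant b Z x x * majorant b Z y y := by
  have h1 := hb.majorant_sq_le hZ x (y + (2 * b y Z) • Z)
  have h2 : majorant b Z x (y + (2 * b y Z) • Z) = b x y := by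
    simp only [majorant, map_add, map_smul, LinearMap.add_apply, LinearMap.smul_apply, smul_eq_mul,
      hZ]
    ring
  have h3 : majorant b Z (y + (2 * b y Z) • Z) (y + (2 * b y Z) • Z) = majorant b Z y y := by
    simp only [majorant, map_add, map_smul, LinearMap.add_apply, LinearMap.smul_apply, smul_eq_mul,
      hZ, hb.symm Z y]
    ring
  rwa [h2, h3] at h1

lemma abs_self_le_majorant (x : E) : |b x x| ≤ majorant b Z x x := by
  have h := hb.sq_le_majorant hZ x x
  exact abs_le_of_sq_le_sq (by rw [sq (majorant b Z x x)]; exact h) (hb.majorant_nonneg hZ x)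

lemma sq_apply_le_majorant (x : E) : (b x Z) ^ 2 ≤ majorant b Z x x := by
  rw [hb.majorant_self_eq hZ]
  have := hb.nonneg_of_orthogonal hZ (proj_orthogonal hZ x)
  linarith

/-- Two majorants are comparable, with a constant that only depends on `(Z₁,Z)`. -/
lemma majorant_le {Z₁ : E} (hZ₁ : b Z₁ Z₁ = -1) (x : E) :
    majorant b Z₁ x x ≤ 4 * (b Z₁ Z) ^ 2 * majorant b Z x x := by
  have h1 := hb.sq_le_majorant hZ x Z₁
  have h2 : majorant b Z Z₁ Z₁ = 2 * (b Z₁ Z) ^ 2 - 1 := by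
    simp only [majorant, hZ₁]; ring
  have h3 := le_trans (le_abs_self _) (hb.abs_self_le_majorant hZ x)
  have h4 : majorant b Z₁ x x = b x x + 2 * (b x Z₁) ^ 2 := by simp only [majorant]; ring
  rw [h2] at h1
  rw [h4]
  nlinarith [hb.majorant_nonneg hZ x]

lemma one_le_four_sq {Z₁ : E} (hZ₁ : b Z₁ Z₁ = -1) : 1 ≤ 4 * (b Z₁ Z) ^ 2 := by
  have h2 : majorant b Z Z₁ Z₁ = 2 * (b Z₁ Z) ^ 2 - 1 := by
    simp only [majorant, hZ₁]; ring
  have := hb.majorant_nonneg hZ Z₁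
  nlinarith

/-- Two timelike vectors on the same side of a third are on the same side of each other. -/
lemma neg_of_neg_of_neg {Z₁ Z₂ : E} (hZ₁ : b Z₁ Z₁ = -1) (hZ₂ : b Z₂ Z₂ = -1)
    (h1 : b Z₁ Z < 0) (h2 : b Z₂ Z < 0) : b Z₁ Z₂ < 0 := by
  -- write `Z₁ = a₁ Z + w₁`, `Z₂ = a₂ Z + w₂` and apply Cauchy-Schwarz to `w₁, w₂ ∈ Z^⊥`
  have hcs := hb.majorant_sq_le hZ (Z₁ + b Z₁ Z • Z) (Z₂ + b Z₂ Z • Z)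
  simp only [majorant, proj_orthogonal hZ] at hcs
  simp only [map_add, map_smul, LinearMap.add_apply, LinearMap.smul_apply, smul_eq_mul,
      hZ, hZ₁, hZ₂, hb.symm Z Z₁, hb.symm Z Z₂] at hcs
  by_contra hcon
  push Not at hcon
  have hp : 0 < b Z₁ Z * b Z₂ Z := mul_pos_of_neg_of_neg h1 h2
  have w1 := hb.nonneg_of_orthogonal hZ (proj_orthogonal hZ Z₁)
  have w2 := hb.nonneg_of_orthogonal hZ (proj_orthogonal hZ Z₂)
  simp only [map_add, map_smul, LinearMap.add_apply, LinearMap.smul_apply, smul_eq_mul,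
      hZ, hZ₁, hZ₂, hb.symm Z Z₁, hb.symm Z Z₂] at w1 w2
  nlinarith [sq_nonneg (b Z₁ Z₂), mul_nonneg hcon hp.le]

lemma apply_ne_zero_of_timelike {Z₁ : E} (hZ₁ : b Z₁ Z₁ = -1) : b Z₁ Z ≠ 0 := by
  intro h
  have := hb.one_le_four_sq hZ hZ₁
  rw [h] at this; norm_num at this

lemma apply_ne_zero_of_isotropic {e : E} (he : b e e = 0) (he0 : e ≠ 0) : b e Z ≠ 0 := fun h =>
  (hb.pos Z e hZ h he0).ne' he

/-- Orthogonal isotropic vectors are proportional. -/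
lemma eq_smul_of_isotropic {e x : E} (he : b e e = 0) (he0 : e ≠ 0) (hx : b x x = 0)
    (hxe : b x e = 0) : x = (b x Z / b e Z) • e := by
  have h0 := hb.apply_ne_zero_of_isotropic hZ he he0
  by_contra hne
  have hne' : x - (b x Z / b e Z) • e ≠ 0 := sub_ne_zero.mpr hne
  have := hb.pos Z (x - (b x Z / b e Z) • e) hZ (by simp [h0]) hne'
  simp [hx, he, hxe, hb.symm e x] at this

end IsHyperbolic

end Hyperbolic

/-! ### The Lorentzian space `V(ℝ)` and the subspaces `U(ℝ)`, `U^⊥(ℝ)` -/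

section Rational

variable {V : Type*} [AddCommGroup V] [Module ℚ V]

lemma realForm_tmul (B : LinearMap.BilinForm ℚ V) (a c : ℝ) (x y : V) :
    realForm B (a ⊗ₜ x) (c ⊗ₜ y) = a * c * (B x y : ℝ) := by
  simp [realForm, LinearMap.BilinForm.baseChange_tmul, Algebra.smul_def]
  ring

lemma realForm_symm {B : LinearMap.BilinForm ℚ V} (hB : ∀ x y, B x y = B y x)
    (x y : ℝ ⊗[ℚ] V) : realForm B x y = realForm B y x := by
  induction x with
  | zero => simp
  | add x₁ x₂ h1 h2 => simp [h1, h2]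
  | tmul a x =>
    induction y with
    | zero => simp
    | add y₁ y₂ h1 h2 => rw [map_add, h1, h2, map_add, LinearMap.add_apply]
    | tmul c y => rw [realForm_tmul, realForm_tmul, hB]; ring

lemma realForm_inclReal (B : LinearMap.BilinForm ℚ V) (W : Submodule ℚ V) (x y : ℝ ⊗[ℚ] W) :
    realForm B (inclReal W x) (inclReal W y) = realForm (B.restrict W) x y := by
  induction x with
  | zero => simp
  | add x₁ x₂ h1 h2 => simp [h1, h2]
  | tmul a x =>
    induction y with
    | zero => simp
    | add y₁ y₂ h1 h2 => rw [map_add, map_add, h1, h2, map_add]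
    | tmul c y =>
      simp only [inclReal, LinearMap.baseChange_tmul]
      rw [realForm_tmul, realForm_tmul]; simp

lemma inclReal_injective (W : Submodule ℚ V) : Function.Injective (inclReal W) :=
  Module.Flat.lTensor_preserves_injective_linearMap (M := ℝ) W.subtype W.injective_subtype

lemma realForm_inclReal_perp {B : LinearMap.BilinForm ℚ V}
    (U : Submodule ℚ V) (x : ℝ ⊗[ℚ] U) (y : ℝ ⊗[ℚ] (perp B U)) :
    realForm B (inclReal U x) (inclReal (perp B U) y) = 0 := by
  induction x with
  | zero => simp
  | add x₁ x₂ h1 h2 => simp [h1, h2]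
  | tmul a x =>
    induction y with
    | zero => simp
    | add y₁ y₂ h1 h2 => rw [map_add, map_add, h1, h2, add_zero]
    | tmul c y =>
      simp only [inclReal, LinearMap.baseChange_tmul]
      have h := LinearMap.BilinForm.mem_orthogonal_iff.mp y.2 x x.2
      rw [realForm_tmul]
      simp only [Submodule.subtype_apply]
      rw [h]; simp

lemma IsLorentzian.isHyperbolic [FiniteDimensional ℚ V] {B : LinearMap.BilinForm ℚ V} {p : ℕ}
    (hB : IsLorentzian B p) : IsHyperbolic (realForm B) := by
  have hs := realForm_symm hB.symm
  refine ⟨hs, fun Z w hZ hw hw0 => ?_⟩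
  by_contra hcon
  push Not at hcon
  -- otherwise `Z` and `w` span a plane on which the form is negative semidefinite
  have hli : LinearIndependent ℝ ![Z, w] := by
    rw [LinearIndependent.pair_iff]
    intro s t hst
    have h1 : realForm B (s • Z + t • w) Z = 0 := by rw [hst]; simp
    simp only [map_add, map_smul, LinearMap.add_apply, LinearMap.smul_apply, smul_eq_mul, hZ, hw]
      at h1
    have hs0 : s = 0 := by linarith
    subst hs0
    simpa [hw0] using hst
  have hrank : Module.finrank ℝ (Submodule.span ℝ (Set.range ![Z, w])) = 2 := by
    rw [finrank_span_eq_card hli]; simp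
  have hle := QuadraticForm.sigPos_add_finrank_le_of_nonpos
    (Q := LinearMap.BilinMap.toQuadraticMap (realForm B))
    (V := Submodule.span ℝ (Set.range ![Z, w])) (by
      intro x hx
      simp only [Matrix.range_cons, Matrix.range_empty, Set.union_empty, Set.singleton_union]
        at hx
      obtain ⟨s, t, rfl⟩ := Submodule.mem_span_pair.mp hx
      simp only [LinearMap.BilinMap.toQuadraticMap_apply, map_add, map_smul, LinearMap.add_apply,
        LinearMap.smul_apply, smul_eq_mul, hZ, hw, hs Z w]
      nlinarith [mul_self_nonneg s, mul_nonneg (mul_self_nonneg t) (neg_nonneg.mpr hcon)])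
  rw [hB.pos, hrank, Module.finrank_baseChange, hB.dim] at hle
  omega

lemma IsHyperbolic.restrict {B : LinearMap.BilinForm ℚ V} (hB : IsHyperbolic (realForm B))
    (W : Submodule ℚ V) : IsHyperbolic (realForm (B.restrict W)) := by
  refine ⟨fun x y => ?_, fun Z w hZ hw hw0 => ?_⟩
  · rw [← realForm_inclReal, ← realForm_inclReal, hB.symm]
  · rw [← realForm_inclReal] at hZ hw ⊢
    exact hB.pos _ _ hZ hw (by rwa [Ne, map_eq_zero_iff _ (inclReal_injective W)])

/-- A rational positive definite form stays positive definite over `ℝ`. -/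
lemma realForm_pos_of_pos [FiniteDimensional ℚ V] {B : LinearMap.BilinForm ℚ V}
    (hB : ∀ x y, B x y = B y x) (hpos : ∀ x, x ≠ 0 → 0 < B x x) (x : ℝ ⊗[ℚ] V) (hx : x ≠ 0) :
    0 < realForm B x x := by
  obtain ⟨v, hv⟩ := LinearMap.BilinForm.exists_orthogonal_basis (B := B) ⟨hB⟩
  set w := v.baseChange ℝ with hw
  rw [← w.sum_repr x] at *
  set c := w.repr x
  have hc : c ≠ 0 := by
    rintro h
    apply hx
    simp [h]
  have hww : ∀ i j, realForm B (w i) (w j) = if i = j then ((B (v i) (v i) : ℚ) : ℝ) else 0 := by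
    intro i j
    rw [hw, Module.Basis.baseChange_apply, Module.Basis.baseChange_apply, realForm_tmul]
    split_ifs with h
    · subst h; simp
    · have : B (v i) (v j) = 0 := hv h
      simp [this]
  have : realForm B (∑ i, c i • w i) (∑ i, c i • w i) =
      ∑ i, c i ^ 2 * ((B (v i) (v i) : ℚ) : ℝ) := by
    simp only [map_sum, LinearMap.sum_apply, map_smul, LinearMap.smul_apply, smul_eq_mul, hww]
    refine Finset.sum_congr rfl fun i _ => ?_
    simp; ring
  rw [this]
  have hp : ∀ i, (0 : ℝ) < ((B (v i) (v i) : ℚ) : ℝ) := fun i => by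
    exact_mod_cast hpos _ (v.ne_zero i)
  obtain ⟨i, hi⟩ := Finsupp.ne_iff.mp hc
  refine Finset.sum_pos' (fun j _ => mul_nonneg (sq_nonneg _) (hp j).le) ⟨i, Finset.mem_univ _, ?_⟩
  have : c i ≠ 0 := by simpa using hi
  have := hp i
  positivity

end Rational

/-! ### Explicit form of the Schwartz forms -/

section SquareRoot

variable {n : ℕ} {v : Matrix (Fin n) (Fin n) ℝ}

lemma sqrt_mul_transpose_sqrt (hv : v.PosDef) : CFC.sqrt v * (CFC.sqrt v).transpose = v := by
  have h1 : (CFC.sqrt v).PosSemidef := Matrix.nonneg_iff_posSemidef.mp (CFC.sqrt_nonneg v)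
  have h2 : (CFC.sqrt v).transpose = CFC.sqrt v := by
    have := h1.isHermitian.eq
    rwa [Matrix.conjTranspose_eq_transpose_of_trivial] at this
  rw [h2]
  exact CFC.sqrt_mul_sqrt_self v (Matrix.nonneg_iff_posSemidef.mpr hv.posSemidef)

lemma det_sqrt_pos (hv : v.PosDef) : 0 < (CFC.sqrt v).det := by
  have h1 : (CFC.sqrt v).PosSemidef := Matrix.nonneg_iff_posSemidef.mp (CFC.sqrt_nonneg v)
  have h2 := congrArg Matrix.det (sqrt_mul_transpose_sqrt hv)
  rw [Matrix.det_mul, Matrix.det_transpose] at h2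
  refine lt_of_le_of_ne h1.det_nonneg fun h => ?_
  rw [← h, mul_zero] at h2
  exact hv.det_pos.ne h2

lemma det_sqrt_sq (hv : v.PosDef) : (CFC.sqrt v).det ^ 2 = v.det := by
  have h2 := congrArg Matrix.det (sqrt_mul_transpose_sqrt hv)
  rw [Matrix.det_mul, Matrix.det_transpose] at h2
  rw [sq, h2]

end SquareRoot

section BilinearSums

variable {E : Type*} [AddCommGroup E] [Module ℝ E] {n : ℕ}

lemma sum_bilin_combination (Q : LinearMap.BilinForm ℝ E) (S : Matrix (Fin n) (Fin n) ℝ)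
    (X : Fin n → E) :
    ∑ s, Q (∑ i, S i s • X i) (∑ j, S j s • X j) =
      ∑ i, ∑ j, (S * S.transpose) i j * Q (X i) (X j) := by
  have h1 : ∀ s, Q (∑ i, S i s • X i) (∑ j, S j s • X j) =
      ∑ i, ∑ j, S i s * S j s * Q (X i) (X j) := fun s => by
    rw [LinearMap.map_sum₂]
    refine Finset.sum_congr rfl fun i _ => ?_
    rw [map_sum]
    refine Finset.sum_congr rfl fun j _ => ?_
    simp only [map_smul, LinearMap.smul_apply, smul_eq_mul]
    ring
  simp only [h1]
  rw [Finset.sum_comm]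
  refine Finset.sum_congr rfl fun i _ => ?_
  rw [Finset.sum_comm]
  refine Finset.sum_congr rfl fun j _ => ?_
  rw [Matrix.mul_apply, Finset.sum_mul]
  rfl

lemma bilin_sum_le {Q : LinearMap.BilinForm ℝ E} (hs : ∀ x y, Q x y = Q y x)
    (hQ : ∀ x, 0 ≤ Q x x) {ι : Type*} [Fintype ι] (z : ι → E) :
    Q (∑ i, z i) (∑ i, z i) ≤ Fintype.card ι * ∑ i, Q (z i) (z i) := by
  have h1 : Q (∑ i, z i) (∑ i, z i) = ∑ i, ∑ j, Q (z i) (z j) := by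
    simp only [map_sum, LinearMap.sum_apply]
    exact Finset.sum_comm
  have h2 : ∀ i j, Q (z i) (z j) ≤ (Q (z i) (z i) + Q (z j) (z j)) / 2 := fun i j => by
    have := hQ (z i - z j)
    simp only [map_sub, LinearMap.sub_apply, hs (z j) (z i)] at this
    linarith
  rw [h1]
  refine (Finset.sum_le_sum fun i _ => Finset.sum_le_sum fun j _ => h2 i j).trans (le_of_eq ?_)
  simp only [add_div, Finset.sum_add_distrib, Finset.sum_const, Finset.card_univ, nsmul_eq_mul,
    ← Finset.mul_sum]
  rw [← Finset.sum_div]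
  ring

/-- A positive definite matrix `v` bounds `tr (v (X,X)_Q)` from below, uniformly in the positive
semidefinite form `Q`. -/
lemma exists_sum_le_of_posDef {v : Matrix (Fin n) (Fin n) ℝ} (hv : v.PosDef) :
    ∃ c : ℝ, 0 < c ∧ ∀ (E : Type*) [AddCommGroup E] [Module ℝ E] (Q : LinearMap.BilinForm ℝ E),
      (∀ x y, Q x y = Q y x) → (∀ x, 0 ≤ Q x x) → ∀ X : Fin n → E,
      c * ∑ s, Q (X s) (X s) ≤ ∑ i, ∑ j, v i j * Q (X i) (X j) := by
  set S := CFC.sqrt v with hS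
  set T := S⁻¹
  have hST : S * T = 1 := Matrix.mul_nonsing_inv _ (det_sqrt_pos hv).ne'.isUnit
  set t : ℝ := ∑ i, ∑ j, T j i ^ 2
  have ht : 0 ≤ t := by positivity
  refine ⟨(1 + n * t)⁻¹, by positivity, fun E _ _ Q hs hQ X => ?_⟩
  set Y : Fin n → E := fun s => ∑ i, S i s • X i with hY
  have hX : ∀ i, X i = ∑ j, T j i • Y j := fun i => by
    simp only [hY, Finset.smul_sum, smul_smul]
    rw [Finset.sum_comm]
    simp only [← Finset.sum_smul]
    have : ∀ k, ∑ j, T j i * S k j = (1 : Matrix (Fin n) (Fin n) ℝ) k i := fun k => by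
      rw [← hST, Matrix.mul_apply]
      exact Finset.sum_congr rfl fun j _ => mul_comm _ _
    simp [this, Matrix.one_apply]
  have h0 : ∑ s, Q (Y s) (Y s) = ∑ i, ∑ j, v i j * Q (X i) (X j) := by
    rw [sum_bilin_combination, sqrt_mul_transpose_sqrt hv]
  rw [← h0, inv_mul_le_iff₀ (by positivity)]
  have hle : ∀ i, Q (X i) (X i) ≤ n * ∑ j, T j i ^ 2 * Q (Y j) (Y j) := fun i => by
    conv_lhs => rw [hX i]
    refine (bilin_sum_le hs hQ _).trans (le_of_eq ?_)
    simp only [Fintype.card_fin, map_smul, LinearMap.smul_apply, smul_eq_mul]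
    congr 1
    exact Finset.sum_congr rfl fun j _ => by ring
  have hT : ∀ j, ∑ i, T j i ^ 2 ≤ t := fun j => by
    have : t = ∑ j, ∑ i, T j i ^ 2 := Finset.sum_comm
    rw [this]
    exact Finset.single_le_sum (f := fun j => ∑ i, T j i ^ 2) (fun _ _ => by positivity)
      (Finset.mem_univ j)
  calc ∑ s, Q (X s) (X s) ≤ ∑ i, n * ∑ j, T j i ^ 2 * Q (Y j) (Y j) :=
        Finset.sum_le_sum fun i _ => hle i
    _ = n * ∑ j, (∑ i, T j i ^ 2) * Q (Y j) (Y j) := by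
        rw [← Finset.mul_sum, Finset.sum_comm]
        simp only [Finset.sum_mul]
    _ ≤ n * ∑ j, t * Q (Y j) (Y j) := by
        gcongr with j
        · exact hQ _
        · exact hT j
    _ ≤ (1 + n * t) * ∑ s, Q (Y s) (Y s) := by
        rw [← Finset.mul_sum]
        have : 0 ≤ ∑ s, Q (Y s) (Y s) := Finset.sum_nonneg fun s _ => hQ _
        nlinarith

end BilinearSums

section NormalForm

variable {E : Type*} [AddCommGroup E] [Module ℝ E] {n : ℕ}

/-- The modulus of `φ_n(τ,X,Z)(W)`, up to sign: the factors `det(v)^{-m/4}` and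
`det(v^{1/2})^{m/2}` cancel, and `det (X v^{1/2}, W) = det(v^{1/2}) det (X,W)`. -/
noncomputable def amplitude (b : LinearMap.BilinForm ℝ E) (v : Matrix (Fin n) (Fin n) ℝ)
    (X : Fin n → E) (Z : E) (W : Fin n → E) : ℝ :=
  (2 : ℝ) ^ ((n : ℝ) / 2) * (CFC.sqrt v).det * (Matrix.of fun s j => b (X s) (W j)).det *
    Real.exp (-Real.pi * ∑ i, ∑ j, v i j * majorant b Z (X i) (X j))

lemma phiTau_eq (b : LinearMap.BilinForm ℝ E) {τ : Matrix (Fin n) (Fin n) ℂ}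
    (hτ : τ ∈ SiegelUpperHalf n) (X : Fin n → E) (Z : E) (W : Fin n → E) :
    phiTau b τ X Z W =
      Complex.exp (Real.pi * Complex.I * (((τ.map Complex.re) * gram b X).trace : ℝ)) *
        (amplitude b (τ.map Complex.im) X Z W : ℝ) := by
  have hv := hτ.2
  set v := τ.map Complex.im
  have hd := det_sqrt_pos hv
  have h1 : v.det ^ (-(Module.finrank ℝ E : ℝ) / 4) *
      (CFC.sqrt v).det ^ ((Module.finrank ℝ E : ℝ) / 2) = 1 := by
    rw [← det_sqrt_sq hv, ← Real.rpow_natCast, ← Real.rpow_mul hd.le, ← Real.rpow_add hd]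
    convert Real.rpow_zero _ using 2
    push_cast; ring
  have h2 : phi b (fun j => ∑ i, (CFC.sqrt v) i j • X i) Z W = amplitude b v X Z W := by
    have hdet : (Matrix.of fun s j => b (∑ i, (CFC.sqrt v) i s • X i) (W j)) =
        (CFC.sqrt v).transpose * (Matrix.of fun s j => b (X s) (W j)) := by
      ext s j
      simp [Matrix.mul_apply]
    have hg : ∑ s, majorant b Z (∑ i, (CFC.sqrt v) i s • X i) (∑ i, (CFC.sqrt v) i s • X i) =
        ∑ i, ∑ j, v i j * majorant b Z (X i) (X j) := by
      simp only [← majorantForm_apply]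
      rw [sum_bilin_combination, sqrt_mul_transpose_sqrt hv]
    rw [phi, amplitude, gaussianAt, hdet, hg, Matrix.det_mul, Matrix.det_transpose]
    ring
  rw [phiTau, weilUnip, weilLevi, h2]
  have h1' := congrArg (fun x : ℝ => (x : ℂ)) h1
  simp only [Complex.ofReal_mul, Complex.ofReal_one] at h1'
  linear_combination (Complex.exp (Real.pi * Complex.I *
    (((τ.map Complex.re) * gram b X).trace : ℝ)) * (amplitude b v X Z W : ℝ)) * h1'

lemma norm_phiTau (b : LinearMap.BilinForm ℝ E) {τ : Matrix (Fin n) (Fin n) ℂ}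
    (hτ : τ ∈ SiegelUpperHalf n) (X : Fin n → E) (Z : E) (W : Fin n → E) :
    ‖phiTau b τ X Z W‖ = |amplitude b (τ.map Complex.im) X Z W| := by
  rw [phiTau_eq b hτ, norm_mul, Complex.norm_real, Real.norm_eq_abs]
  have : ‖Complex.exp (Real.pi * Complex.I * (((τ.map Complex.re) * gram b X).trace : ℝ))‖ = 1 := by
    rw [show (Real.pi * Complex.I * (((τ.map Complex.re) * gram b X).trace : ℝ) : ℂ) =
      ((Real.pi * ((τ.map Complex.re) * gram b X).trace : ℝ) : ℂ) * Complex.I by push_cast; ring]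
    exact Complex.norm_exp_ofReal_mul_I _
  rw [this, one_mul]

end NormalForm

section ThetaTerm

variable {V : Type*} [AddCommGroup V] [Module ℚ V] {n : ℕ}

lemma thetaTerm_eq (B : LinearMap.BilinForm ℚ V) (τ : Matrix (Fin n) (Fin n) ℂ)
    (hτ : τ.IsSymm) (X : Fin n → V) :
    thetaTerm B τ X = Complex.exp (Real.pi * Complex.I *
        (((τ.map Complex.re) * gram (realForm B) (toReal X)).trace : ℝ)) *
      (Real.exp (-Real.pi * ∑ i, ∑ j, (τ.map Complex.im) i j *
        realForm B (toReal X i) (toReal X j)) : ℝ) := by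
  rw [thetaTerm, Complex.ofReal_exp, ← Complex.exp_add]
  congr 1
  have h1 : (((gram (realForm B) (toReal X)).map (algebraMap ℝ ℂ)) * τ).trace =
      ∑ i, ∑ j, ((realForm B (toReal X i) (toReal X j) : ℝ) : ℂ) * τ i j := by
    simp only [Matrix.trace, Matrix.diag, Matrix.mul_apply, Matrix.map_apply, gram, Matrix.of_apply]
    refine Finset.sum_congr rfl fun i _ => Finset.sum_congr rfl fun j _ => ?_
    rw [← hτ.apply i j]; rfl
  have h2 : ((τ.map Complex.re) * gram (realForm B) (toReal X)).trace =
      ∑ i, ∑ j, realForm B (toReal X i) (toReal X j) * (τ i j).re := by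
    simp only [Matrix.trace, Matrix.diag, Matrix.mul_apply, Matrix.map_apply, gram, Matrix.of_apply]
    rw [Finset.sum_comm]
    refine Finset.sum_congr rfl fun i _ => Finset.sum_congr rfl fun j _ => ?_
    rw [hτ.apply i j, mul_comm]
  rw [h1, h2]
  push_cast
  simp only [Finset.mul_sum, ← Finset.sum_add_distrib]
  refine Finset.sum_congr rfl fun i _ => Finset.sum_congr rfl fun j _ => ?_
  conv_lhs => rw [← Complex.re_add_im (τ i j)]
  simp only [Matrix.map_apply]
  linear_combination (-(Real.pi : ℂ) * (realForm B (toReal X i) (toReal X j) : ℝ) *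
    ((τ i j).im : ℂ)) * (-Complex.I_mul_I)

end ThetaTerm

/-! ### Restriction of the Schwartz forms to `B_U` -/

section Pullback

variable {V : Type*} [AddCommGroup V] [Module ℚ V] {n : ℕ} {B : LinearMap.BilinForm ℚ V}
  (hB : ∀ x y, B x y = B y x) (U : Submodule ℚ V)
include hB

lemma realForm_perp_inclReal (x : ℝ ⊗[ℚ] U) (y : ℝ ⊗[ℚ] (perp B U)) :
    realForm B (inclReal (perp B U) y) (inclReal U x) = 0 := by
  rw [realForm_symm hB, realForm_inclReal_perp]

lemma realForm_add_add (x x' : ℝ ⊗[ℚ] U) (y y' : ℝ ⊗[ℚ] (perp B U)) :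
    realForm B (inclReal U x + inclReal (perp B U) y) (inclReal U x' + inclReal (perp B U) y') =
      realForm (B.restrict U) x x' + realForm (B.restrict (perp B U)) y y' := by
  simp only [map_add, LinearMap.add_apply, realForm_inclReal_perp, realForm_perp_inclReal hB,
    realForm_inclReal]
  ring

omit hB in
lemma realForm_add_inclReal (x : ℝ ⊗[ℚ] U) (y y' : ℝ ⊗[ℚ] (perp B U)) :
    realForm B (inclReal U x + inclReal (perp B U) y) (inclReal (perp B U) y') =
      realForm (B.restrict (perp B U)) y y' := by
  simp only [map_add, LinearMap.add_apply, realForm_inclReal_perp, realForm_inclReal, zero_add]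

lemma majorant_add_inclReal (x x' : ℝ ⊗[ℚ] U) (y y' Z : ℝ ⊗[ℚ] (perp B U)) :
    majorant (realForm B) (inclReal (perp B U) Z) (inclReal U x + inclReal (perp B U) y)
        (inclReal U x' + inclReal (perp B U) y') =
      realForm (B.restrict U) x x' + majorant (realForm (B.restrict (perp B U))) Z y y' := by
  simp only [majorant, realForm_add_add hB, realForm_add_inclReal]
  ring

lemma phi_add_inclReal (X₁ : Fin n → ℝ ⊗[ℚ] U) (X₂ W : Fin n → ℝ ⊗[ℚ] (perp B U))
    (Z : ℝ ⊗[ℚ] (perp B U)) :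
    phi (realForm B) (fun s => inclReal U (X₁ s) + inclReal (perp B U) (X₂ s))
        (inclReal (perp B U) Z) (fun j => inclReal (perp B U) (W j)) =
      gaussianPos (realForm (B.restrict U)) X₁ *
        phi (realForm (B.restrict (perp B U))) X₂ Z W := by
  simp only [phi, gaussianAt, gaussianPos, majorant_add_inclReal hB, realForm_add_inclReal,
    Finset.sum_add_distrib, mul_add, Real.exp_add, Matrix.trace, Matrix.diag, gram, Matrix.of_apply]
  ring

lemma phiTau_add {τ : Matrix (Fin n) (Fin n) ℂ} (hτ : τ ∈ SiegelUpperHalf n)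
    (X₁ : Fin n → U) (X₂ : Fin n → perp B U) (Z : ℝ ⊗[ℚ] (perp B U))
    (W : Fin n → ℝ ⊗[ℚ] (perp B U)) :
    phiTau (realForm B) τ (toReal fun s => (X₁ s : V) + X₂ s) (inclReal (perp B U) Z)
        (fun j => inclReal (perp B U) (W j)) =
      thetaTerm (B.restrict U) τ X₁ *
        phiTau (realForm (B.restrict (perp B U))) τ (toReal X₂) Z W := by
  have hX : ∀ s, toReal (fun s => (X₁ s : V) + X₂ s) s =
      inclReal U (toReal X₁ s) + inclReal (perp B U) (toReal X₂ s) := fun s => by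
    simp [toReal, inclReal, TensorProduct.tmul_add]
  have hg : gram (realForm B) (toReal fun s => (X₁ s : V) + X₂ s) =
      gram (realForm (B.restrict U)) (toReal X₁) +
        gram (realForm (B.restrict (perp B U))) (toReal X₂) := by
    ext i j
    simp only [gram, Matrix.of_apply, Matrix.add_apply, hX, realForm_add_add hB]
  rw [phiTau_eq _ hτ, phiTau_eq _ hτ, thetaTerm_eq _ _ hτ.1, hg]
  simp only [amplitude, hX, majorant_add_inclReal hB, realForm_add_inclReal, mul_add,
    Finset.sum_add_distrib, Real.exp_add, Matrix.trace_add, Complex.ofReal_add, Complex.exp_add]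
  push_cast
  ring

end Pullback

/-! ### Gaussian sums over shifted lattices -/

section GaussianSums

lemma sq_shift_sum_le (h : ℝ) (s : Finset ℤ) :
    ∑ k ∈ s, (1 + ((k : ℝ) + h) ^ 2)⁻¹ ≤ 3 * ∑' k : ℤ, (1 + (k : ℝ) ^ 2)⁻¹ := by
  have hsum : Summable fun k : ℤ => (1 + (k : ℝ) ^ 2)⁻¹ := by
    have h2 : Summable fun k : ℤ => 1 / |(k : ℝ)| ^ (2 : ℝ) :=
      Real.summable_one_div_int_pow.mpr one_lt_two |>.congr fun k => by simp
    refine Summable.of_norm_bounded_eventually h2 ?_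
    filter_upwards [(Set.finite_singleton (0 : ℤ)).compl_mem_cofinite] with k hk
    have hk0 : (k : ℝ) ≠ 0 := by exact_mod_cast hk
    rw [Real.norm_of_nonneg (by positivity), inv_eq_one_div]
    refine one_div_le_one_div_of_le (by positivity) ?_
    rw [Real.rpow_two, sq_abs]; linarith
  -- shifting the summation index reduces to `0 ≤ h < 1`
  have key : ∀ k : ℤ, (1 + ((k : ℝ) + h) ^ 2)⁻¹ ≤ 3 * (1 + ((k + ⌊h⌋ : ℤ) : ℝ) ^ 2)⁻¹ := fun k => by
    have h0 := Int.fract_nonneg h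
    have h1 := (Int.fract_lt_one h).le
    have h2 : (k : ℝ) + h = ((k + ⌊h⌋ : ℤ) : ℝ) + Int.fract h := by
      push_cast; rw [add_assoc, Int.floor_add_fract]
    rw [h2]
    set x : ℝ := ((k + ⌊h⌋ : ℤ) : ℝ)
    set f := Int.fract h
    rw [← div_eq_mul_inv, inv_eq_one_div, div_le_div_iff₀ (by positivity) (by positivity)]
    nlinarith [sq_nonneg (x + 2 * f), sq_nonneg (x + f), mul_nonneg h0 (sub_nonneg.mpr h1)]
  calc ∑ k ∈ s, (1 + ((k : ℝ) + h) ^ 2)⁻¹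
      ≤ ∑ k ∈ s, 3 * (1 + ((k + ⌊h⌋ : ℤ) : ℝ) ^ 2)⁻¹ := Finset.sum_le_sum fun k _ => key k
    _ = 3 * ∑ k ∈ s.map (Equiv.addRight ⌊h⌋).toEmbedding, (1 + (k : ℝ) ^ 2)⁻¹ := by
        rw [Finset.sum_map, Finset.mul_sum]; rfl
    _ ≤ _ := by
        gcongr
        exact hsum.sum_le_tsum _ fun _ _ => by positivity

/-- The squared distance from the origin of the point `k + h`. -/
noncomputable def shiftSq {J : Type*} [Fintype J] (h : J → ℝ) (k : J → ℤ) : ℝ :=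
  ∑ j, ((k j : ℝ) + h j) ^ 2

lemma shiftSq_nonneg {J : Type*} [Fintype J] (h : J → ℝ) (k : J → ℤ) : 0 ≤ shiftSq h k :=
  Finset.sum_nonneg fun _ _ => sq_nonneg _

lemma exists_sum_exp_le (J : Type*) [Fintype J] : ∃ C : ℝ, 0 < C ∧ ∀ ε : ℝ, 0 < ε → ε ≤ 1 →
    ∀ (h : J → ℝ) (s : Finset (J → ℤ)),
      ∑ k ∈ s, Real.exp (-ε * shiftSq h k) ≤ C * ε⁻¹ ^ Fintype.card J := by
  classical
  set A : ℝ := 3 * ∑' k : ℤ, (1 + (k : ℝ) ^ 2)⁻¹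
  have hA : 0 ≤ A := mul_nonneg (by norm_num) (tsum_nonneg fun k => by positivity)
  refine ⟨A ^ Fintype.card J + 1, by positivity, fun ε hε hε1 h s => ?_⟩
  have h1 : ∀ x : ℝ, Real.exp (-ε * x ^ 2) ≤ ε⁻¹ * (1 + x ^ 2)⁻¹ := fun x => by
    rw [neg_mul, Real.exp_neg, ← mul_inv]
    refine inv_anti₀ (by positivity) ?_
    have := Real.add_one_le_exp (ε * x ^ 2)
    nlinarith [sq_nonneg x]
  have hone : ∀ (j : J) (t : Finset ℤ), ∑ k ∈ t, Real.exp (-ε * ((k : ℝ) + h j) ^ 2) ≤ ε⁻¹ * A :=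
    fun j t => by
      refine (Finset.sum_le_sum fun k _ => h1 _).trans ?_
      rw [← Finset.mul_sum]
      exact mul_le_mul_of_nonneg_left (sq_shift_sum_le _ _) (by positivity)
  calc ∑ k ∈ s, Real.exp (-ε * shiftSq h k)
      = ∑ k ∈ s, ∏ j, Real.exp (-ε * ((k j : ℝ) + h j) ^ 2) := by
        refine Finset.sum_congr rfl fun k _ => ?_
        rw [← Real.exp_sum, shiftSq, Finset.mul_sum]
    _ ≤ ∑ k ∈ Fintype.piFinset fun j => s.image fun k : J → ℤ => k j,
          ∏ j, Real.exp (-ε * ((k j : ℝ) + h j) ^ 2) := by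
        refine Finset.sum_le_sum_of_subset_of_nonneg (fun k hk => ?_) fun _ _ _ => by positivity
        exact Fintype.mem_piFinset.mpr fun j => Finset.mem_image_of_mem (fun k : J → ℤ => k j) hk
    _ = ∏ j, ∑ k ∈ s.image fun k : J → ℤ => k j, Real.exp (-ε * ((k : ℝ) + h j) ^ 2) := by
        rw [Finset.prod_univ_sum]
    _ ≤ ∏ _j : J, ε⁻¹ * A := Finset.prod_le_prod (fun _ _ => by positivity) fun j _ => hone j _
    _ = A ^ Fintype.card J * ε⁻¹ ^ Fintype.card J := by
        rw [Finset.prod_const, Finset.card_univ, mul_pow, mul_comm]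
    _ ≤ _ := by gcongr; linarith

lemma exists_pow_mul_exp_le (N : ℕ) : ∃ C : ℝ, 0 < C ∧ ∀ ε : ℝ, 0 < ε → ε ≤ 1 → ∀ q : ℝ, 0 ≤ q →
    (1 + q) ^ N * Real.exp (-ε * q) ≤ C * ε⁻¹ ^ N * Real.exp (-(ε / 2) * q) := by
  refine ⟨N.factorial * 2 ^ N * Real.exp (1 / 2), by positivity, fun ε hε hε1 q hq => ?_⟩
  have h1 : (1 + q) ≤ ε⁻¹ * (1 + ε * q) := by
    rw [mul_add, ← mul_assoc, inv_mul_cancel₀ hε.ne', one_mul, mul_one]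
    have := (one_le_inv₀ hε).mpr hε1
    linarith
  have h2 := Real.pow_div_factorial_le_exp ((1 + ε * q) / 2) (by positivity) N
  rw [div_le_iff₀ (by positivity), div_pow, div_le_iff₀ (by positivity)] at h2
  have h3 : Real.exp ((1 + ε * q) / 2) * Real.exp (-ε * q) =
      Real.exp (1 / 2) * Real.exp (-(ε / 2) * q) := by
    rw [← Real.exp_add, ← Real.exp_add]; congr 1; ring
  calc (1 + q) ^ N * Real.exp (-ε * q) ≤ (ε⁻¹ * (1 + ε * q)) ^ N * Real.exp (-ε * q) := by
        gcongr
    _ = ε⁻¹ ^ N * ((1 + ε * q) ^ N * Real.exp (-ε * q)) := by rw [mul_pow]; ring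
    _ ≤ ε⁻¹ ^ N * ((Real.exp ((1 + ε * q) / 2) * N.factorial * 2 ^ N) * Real.exp (-ε * q)) := by
        gcongr
    _ = ε⁻¹ ^ N * N.factorial * 2 ^ N * (Real.exp ((1 + ε * q) / 2) * Real.exp (-ε * q)) := by ring
    _ = _ := by rw [h3]; ring

/-- Sums of a polynomial times a wide Gaussian over a shifted lattice grow at most polynomially in
the width, uniformly in the shift. -/
lemma exists_sum_pow_mul_exp_le (J : Type*) [Fintype J] (N : ℕ) : ∃ C : ℝ, 0 < C ∧ ∃ K : ℕ,
    ∀ ε : ℝ, 0 < ε → ε ≤ 1 → ∀ (h : J → ℝ) (s : Finset (J → ℤ)),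
      ∑ k ∈ s, (1 + shiftSq h k) ^ N * Real.exp (-ε * shiftSq h k) ≤ C * ε⁻¹ ^ K := by
  obtain ⟨C₁, hC₁, H₁⟩ := exists_sum_exp_le J
  obtain ⟨C₂, hC₂, H₂⟩ := exists_pow_mul_exp_le N
  refine ⟨C₂ * C₁ * 2 ^ Fintype.card J, by positivity, N + Fintype.card J, fun ε hε hε1 h s => ?_⟩
  calc _ ≤ ∑ k ∈ s, C₂ * ε⁻¹ ^ N * Real.exp (-(ε / 2) * shiftSq h k) :=
        Finset.sum_le_sum fun k _ => H₂ ε hε hε1 _ (shiftSq_nonneg h k)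
    _ = C₂ * ε⁻¹ ^ N * ∑ k ∈ s, Real.exp (-(ε / 2) * shiftSq h k) := by rw [Finset.mul_sum]
    _ ≤ C₂ * ε⁻¹ ^ N * (C₁ * (ε / 2)⁻¹ ^ Fintype.card J) := by
        gcongr
        exact H₁ (ε / 2) (by positivity) (by linarith) h s
    _ = _ := by rw [inv_div, div_eq_mul_inv, mul_pow, pow_add]; ring

lemma summable_pow_mul_exp {J : Type*} [Fintype J] (N : ℕ) {ε : ℝ} (hε : 0 < ε) (h : J → ℝ) :
    Summable fun k : J → ℤ => (1 + shiftSq h k) ^ N * Real.exp (-ε * shiftSq h k) := by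
  obtain ⟨C, hC, K, H⟩ := exists_sum_pow_mul_exp_le J N
  have hnn : ∀ k : J → ℤ, 0 ≤ 1 + shiftSq h k := fun k => by linarith [shiftSq_nonneg h k]
  have h1 : Summable fun k : J → ℤ =>
      (1 + shiftSq h k) ^ N * Real.exp (-(min ε 1) * shiftSq h k) :=
    summable_of_sum_le (fun k => mul_nonneg (pow_nonneg (hnn k) N) (Real.exp_pos _).le)
      (H (min ε 1) (lt_min hε one_pos) (min_le_right _ _) h)
  refine Summable.of_nonneg_of_le
    (fun k => mul_nonneg (pow_nonneg (hnn k) N) (Real.exp_pos _).le) (fun k => ?_) h1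
  have := shiftSq_nonneg h k
  have := hnn k
  gcongr
  exact min_le_left _ _

end GaussianSums

section LatticeTuples

variable {E : Type*} [AddCommGroup E] [Module ℝ E] {n : ℕ} {ι : Type*} [Fintype ι]

/-- The `n`-tuple of vectors whose coordinates in the basis `β` are `k + h`. -/
noncomputable def latticeTuple (β : ι → E) (h : Fin n × ι → ℝ) (k : Fin n × ι → ℤ) : Fin n → E :=
  fun s => ∑ i, ((k (s, i) : ℝ) + h (s, i)) • β i

lemma bilin_combination_self (Q : LinearMap.BilinForm ℝ E) {r : ℕ} (β : Fin r → E)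
    (a : Fin r → ℝ) : Q (∑ i, a i • β i) (∑ i, a i • β i) =
      ∑ i, ∑ j, (Matrix.of fun i j => Q (β i) (β j)) i j * (a i * a j) := by
  rw [LinearMap.map_sum₂]
  refine Finset.sum_congr rfl fun i _ => ?_
  rw [map_sum]
  refine Finset.sum_congr rfl fun j _ => ?_
  simp only [map_smul, LinearMap.smul_apply, smul_eq_mul, Matrix.of_apply]
  ring

lemma posDef_gram {Q : LinearMap.BilinForm ℝ E} (hs : ∀ x y, Q x y = Q y x)
    (hQ : ∀ x, x ≠ 0 → 0 < Q x x) {r : ℕ} (β : Module.Basis (Fin r) ℝ E) :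
    (Matrix.of fun i j => Q (β i) (β j)).PosDef := by
  refine Matrix.PosDef.of_dotProduct_mulVec_pos ?_ fun a ha => ?_
  · ext i j; simp [hs (β j)]
  · have h1 : (∑ i, a i • β i) ≠ 0 := fun h0 => by
      apply ha
      funext i
      exact Fintype.linearIndependent_iff.mp β.linearIndependent a h0 i
    have h2 := hQ _ h1
    rw [bilin_combination_self] at h2
    refine lt_of_lt_of_eq h2 ?_
    simp only [dotProduct, Matrix.mulVec, Finset.mul_sum, star_trivial]
    exact Finset.sum_congr rfl fun i _ => Finset.sum_congr rfl fun j _ => by ring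

lemma exists_sq_repr_le (Q : LinearMap.BilinForm ℝ E) (hs : ∀ x y, Q x y = Q y x)
    (hQ : ∀ x, x ≠ 0 → 0 < Q x x) {r : ℕ} (β : Module.Basis (Fin r) ℝ E) :
    ∃ c : ℝ, 0 < c ∧ ∀ a : Fin r → ℝ,
      c * ∑ i, a i ^ 2 ≤ Q (∑ i, a i • β i) (∑ i, a i • β i) := by
  obtain ⟨c, hc, H⟩ := exists_sum_le_of_posDef (posDef_gram hs hQ β)
  refine ⟨c, hc, fun a => ?_⟩
  rw [bilin_combination_self]
  have := H ℝ (LinearMap.mul ℝ ℝ) (fun x y => mul_comm _ _) (fun x => mul_self_nonneg x) a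
  simpa [sq] using this

lemma sum_bilin_latticeTuple_ge {Q : LinearMap.BilinForm ℝ E} {r : ℕ} {β : Fin r → E}
    {c : ℝ} (H : ∀ a : Fin r → ℝ, c * ∑ i, a i ^ 2 ≤ Q (∑ i, a i • β i) (∑ i, a i • β i))
    (h : Fin n × Fin r → ℝ) (k : Fin n × Fin r → ℤ) :
    c * shiftSq h k ≤ ∑ s, Q (latticeTuple β h k s) (latticeTuple β h k s) := by
  rw [shiftSq, Fintype.sum_prod_type, Finset.mul_sum]
  exact Finset.sum_le_sum fun s _ => H fun i => (k (s, i) : ℝ) + h (s, i)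

lemma abs_le_one_add_sum_sq {J : Type*} [Fintype J] (x : J → ℝ) (j : J) :
    |x j| ≤ 1 + ∑ j, x j ^ 2 := by
  have h1 : x j ^ 2 ≤ ∑ j, x j ^ 2 :=
    Finset.single_le_sum (f := fun j => x j ^ 2) (fun _ _ => sq_nonneg _) (Finset.mem_univ j)
  have h2 : |x j| ≤ 1 + x j ^ 2 := by
    rw [← sq_abs]; nlinarith [sq_nonneg (|x j| - 1), abs_nonneg (x j)]
  linarith

lemma abs_apply_latticeTuple_le (ℓ : E →ₗ[ℝ] ℝ) (β : ι → E) (h : Fin n × ι → ℝ)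
    (k : Fin n × ι → ℤ) (s : Fin n) :
    |ℓ (latticeTuple β h k s)| ≤ (∑ i, |ℓ (β i)|) * (1 + shiftSq h k) := by
  rw [latticeTuple, map_sum, Finset.sum_mul]
  refine (Finset.abs_sum_le_sum_abs _ _).trans (Finset.sum_le_sum fun i _ => ?_)
  rw [map_smul, smul_eq_mul, abs_mul, mul_comm]
  exact mul_le_mul_of_nonneg_left
    (abs_le_one_add_sum_sq (fun j => (k j : ℝ) + h j) (s, i)) (abs_nonneg _)

lemma abs_det_le {m : ℕ} (A : Matrix (Fin m) (Fin m) ℝ) {x : ℝ} (hx : ∀ i j, |A i j| ≤ x) :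
    |A.det| ≤ m.factorial * x ^ m := by
  have := Matrix.det_le (A := A) (abv := AbsoluteValue.abs) (x := x) hx
  simpa using this

/-- Convergence of the theta series of a form with values in the exterior powers. -/
lemma summable_det_mul_exp {r : ℕ} (β : Module.Basis (Fin r) ℝ E)
    {Q : LinearMap.BilinForm ℝ E} (hs : ∀ x y, Q x y = Q y x) (hQ : ∀ x, x ≠ 0 → 0 < Q x x)
    {v : Matrix (Fin n) (Fin n) ℝ} (hv : v.PosDef) {m : ℕ} (ℓ : Fin m → E →ₗ[ℝ] ℝ)
    (σ : Fin m → Fin n) (h : Fin n × Fin r → ℝ) :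
    Summable fun k : Fin n × Fin r → ℤ =>
      (Matrix.of fun s j => ℓ j (latticeTuple β h k (σ s))).det *
        Real.exp (-Real.pi *
          ∑ i, ∑ j, v i j * Q (latticeTuple β h k i) (latticeTuple β h k j)) := by
  obtain ⟨c₁, hc₁, H₁⟩ := exists_sq_repr_le Q hs hQ β
  obtain ⟨c₂, hc₂, H₂⟩ := exists_sum_le_of_posDef hv
  set A : ℝ := ∑ j, ∑ i, |ℓ j (β i)|
  have hQ0 : ∀ x, 0 ≤ Q x x := fun x => by
    rcases eq_or_ne x 0 with rfl | hx
    · simp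
    · exact (hQ x hx).le
  refine Summable.of_norm_bounded ((summable_pow_mul_exp m
    (ε := Real.pi * (c₂ * c₁)) (by positivity) h).mul_left (m.factorial * A ^ m)) fun k => ?_
  rw [norm_mul, Real.norm_eq_abs, Real.norm_eq_abs, Real.abs_exp]
  have h1 : |(Matrix.of fun s j => ℓ j (latticeTuple β h k (σ s))).det| ≤
      m.factorial * (A * (1 + shiftSq h k)) ^ m := by
    refine abs_det_le _ fun s j => (abs_apply_latticeTuple_le _ _ _ _ _).trans ?_
    have := shiftSq_nonneg h k
    gcongr
    exact Finset.single_le_sum (f := fun j => ∑ i, |ℓ j (β i)|) (fun _ _ => by positivity)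
      (Finset.mem_univ j)
  have h2 : c₂ * c₁ * shiftSq h k ≤
      ∑ i, ∑ j, v i j * Q (latticeTuple β h k i) (latticeTuple β h k j) := by
    refine le_trans ?_ (H₂ E Q hs hQ0 _)
    rw [mul_assoc]
    exact mul_le_mul_of_nonneg_left (sum_bilin_latticeTuple_ge H₁ h k) hc₂.le
  calc _ ≤ m.factorial * (A * (1 + shiftSq h k)) ^ m *
        Real.exp (-(Real.pi * (c₂ * c₁)) * shiftSq h k) := by
        refine mul_le_mul h1 (Real.exp_le_exp.mpr ?_) (Real.exp_pos _).le
          ((abs_nonneg _).trans h1)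
        have := mul_le_mul_of_nonneg_left h2 Real.pi_pos.le
        linarith
    _ = _ := by rw [mul_pow]; ring

end LatticeTuples

/-! ### Lattices in rational vector spaces -/

section RationalLattices

variable {W : Type*} [AddCommGroup W] [Module ℚ W]

/-- A `ℤ`-lattice of full rank: finitely generated, with every vector having a nonzero multiple
in it. -/
structure IsFullLattice (M : Submodule ℤ W) : Prop where
  fg : M.FG
  exists_smul_mem : ∀ x : W, ∃ N : ℕ, N ≠ 0 ∧ N • x ∈ M

/-- A `ℤ`-basis of a full lattice is a `ℚ`-basis of the ambient space. -/
lemma IsFullLattice.exists_rat_basis {M : Submodule ℤ W} (hM : IsFullLattice M) {ι : Type*}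
    [Fintype ι] (bM : Module.Basis ι ℤ M) : ∃ β : Module.Basis ι ℚ W, ∀ i, β i = bM i := by
  have hli : LinearIndependent ℚ fun i => (bM i : W) := by
    rw [← LinearIndependent.iff_fractionRing ℤ ℚ]
    exact bM.linearIndependent.map' M.subtype (Submodule.ker_subtype M)
  have hspan : ⊤ ≤ Submodule.span ℚ (Set.range fun i => (bM i : W)) := by
    intro x _
    obtain ⟨N, hN, hx⟩ := hM.exists_smul_mem x
    have h1 : N • x ∈ Submodule.span ℚ (Set.range fun i => (bM i : W)) := by
      have h2 := congrArg (fun y : M => (y : W)) (bM.sum_repr ⟨N • x, hx⟩)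
      simp only [Submodule.coe_sum, Submodule.coe_smul] at h2
      rw [← h2]
      refine Submodule.sum_mem _ fun i _ => ?_
      rw [← Int.cast_smul_eq_zsmul ℚ]
      exact Submodule.smul_mem _ _ (Submodule.subset_span ⟨i, rfl⟩)
    have h3 : x = (N : ℚ)⁻¹ • (N • x) := by
      rw [← Nat.cast_smul_eq_nsmul ℚ, smul_smul, inv_mul_cancel₀ (by exact_mod_cast hN), one_smul]
    rw [h3]
    exact Submodule.smul_mem _ _ h1
  exact ⟨Module.Basis.mk hli hspan, fun i => by simp⟩

lemma IsFullLattice.exists_basis [FiniteDimensional ℚ W] {M : Submodule ℤ W}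
    (hM : IsFullLattice M) : ∃ (bM : Module.Basis (Fin (Module.finrank ℚ W)) ℤ M)
      (β : Module.Basis (Fin (Module.finrank ℚ W)) ℚ W), ∀ i, β i = bM i := by
  have : Module.Finite ℤ M := Module.Finite.iff_fg.mpr hM.fg
  have : IsAddTorsionFree W := .of_module_rat W
  have : Module.Free ℤ M := inferInstance
  set b₀ := Module.Free.chooseBasis ℤ M
  obtain ⟨β₀, hβ₀⟩ := hM.exists_rat_basis b₀
  have hcard : Fintype.card (Module.Free.ChooseBasisIndex ℤ M) = Module.finrank ℚ W :=
    (Module.finrank_eq_card_basis β₀).symm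
  set e := Fintype.equivFinOfCardEq hcard
  refine ⟨b₀.reindex e, β₀.reindex e, fun i => ?_⟩
  simp [hβ₀]

variable {M : Submodule ℤ W} {ι : Type*} [Fintype ι] {n : ℕ}

/-- The parametrization of a coset `M^n + h` by coordinates. -/
noncomputable def cosetEquiv (bM : Module.Basis ι ℤ M) (h : Fin n → W) :
    (Fin n × ι → ℤ) ≃ coset M h where
  toFun k := ⟨fun s => h s + ∑ i, k (s, i) • (bM i : W), fun s => by
    simp only [add_sub_cancel_left]
    exact Submodule.sum_mem _ fun i _ => Submodule.smul_mem _ _ (bM i).2⟩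
  invFun X := fun j => bM.repr ⟨X.1 j.1 - h j.1, X.2 j.1⟩ j.2
  left_inv k := by
    funext j
    have h1 : (⟨h j.1 + ∑ i, k (j.1, i) • (bM i : W) - h j.1, by
        simp only [add_sub_cancel_left]
        exact Submodule.sum_mem _ fun i _ => Submodule.smul_mem _ _ (bM i).2⟩ : M) =
        ∑ i, k (j.1, i) • bM i := by
      ext; simp
    change bM.repr ⟨h j.1 + ∑ i, k (j.1, i) • (bM i : W) - h j.1, _⟩ j.2 = k j
    rw [h1, bM.repr_sum_self]
  right_inv X := by
    ext s
    have h2 := congrArg (fun y : M => (y : W)) (bM.sum_repr ⟨X.1 s - h s, X.2 s⟩)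
    simp only [Submodule.coe_sum, Submodule.coe_smul] at h2
    simp only [h2]
    abel

lemma toReal_cosetEquiv (bM : Module.Basis ι ℤ M) (β : Module.Basis ι ℚ W)
    (hβ : ∀ i, β i = bM i) (h : Fin n → W) (k : Fin n × ι → ℤ) :
    toReal (cosetEquiv bM h k).1 =
      latticeTuple (β.baseChange ℝ) (fun j => ((β.repr (h j.1) j.2 : ℚ) : ℝ)) k := by
  funext s
  have h1 : (cosetEquiv bM h k).1 s = ∑ i, ((k (s, i) : ℚ) + β.repr (h s) i) • β i := by
    simp only [add_smul, Finset.sum_add_distrib, β.sum_repr (h s), cosetEquiv, Equiv.coe_fn_mk,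
      Int.cast_smul_eq_zsmul]
    rw [add_comm]
    simp only [hβ]
  rw [toReal, h1, TensorProduct.tmul_sum, latticeTuple]
  refine Finset.sum_congr rfl fun i _ => ?_
  rw [Module.Basis.baseChange_apply, TensorProduct.tmul_smul, TensorProduct.smul_tmul',
    TensorProduct.smul_tmul']
  congr 1
  simp [Algebra.smul_def]

end RationalLattices

section FullLattices

variable {V : Type*} [AddCommGroup V] [Module ℚ V]

lemma IsIntegralLattice.isFullLattice {B : LinearMap.BilinForm ℚ V} {L : Submodule ℤ V}
    (hL : IsIntegralLattice B L) : IsFullLattice L := by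
  refine ⟨hL.fg, fun x => ?_⟩
  have hx : x ∈ Submodule.span ℚ (L : Set V) := hL.span ▸ Submodule.mem_top
  induction hx using Submodule.span_induction with
  | mem x hx => exact ⟨1, one_ne_zero, by simpa using hx⟩
  | zero => exact ⟨1, one_ne_zero, by simp⟩
  | add x y _ _ h1 h2 =>
    obtain ⟨N₁, hN₁, h1⟩ := h1
    obtain ⟨N₂, hN₂, h2⟩ := h2
    refine ⟨N₁ * N₂, mul_ne_zero hN₁ hN₂, ?_⟩
    rw [smul_add]
    refine L.add_mem ?_ ?_
    · rw [mul_comm, mul_smul]; exact nsmul_mem h1 _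
    · rw [mul_smul]; exact nsmul_mem h2 _
  | smul a x _ h1 =>
    obtain ⟨N, hN, h1⟩ := h1
    refine ⟨a.den * N, mul_ne_zero a.den_nz hN, ?_⟩
    have : (a.den * N) • (a • x) = a.num • (N • x) := by
      rw [← Nat.cast_smul_eq_nsmul ℚ, ← Int.cast_smul_eq_zsmul ℚ, ← Nat.cast_smul_eq_nsmul ℚ,
        smul_smul, smul_smul]
      congr 1
      push_cast
      linear_combination (N : ℚ) * a.den_mul_eq_num
    rw [this]
    exact L.smul_mem _ h1

lemma IsFullLattice.latticeIn {L : Submodule ℤ V} (hL : IsFullLattice L) (W : Submodule ℚ V) :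
    IsFullLattice (latticeIn L W) := by
  refine ⟨?_, fun x => hL.exists_smul_mem x⟩
  have : IsNoetherian ℤ L := isNoetherian_of_fg_of_noetherian L hL.fg
  refine Submodule.fg_of_fg_map_injective (W.subtype.restrictScalars ℤ) W.injective_subtype ?_
  refine isNoetherian_submodule.mp this _ ?_
  rintro _ ⟨x, hx, rfl⟩
  exact hx

omit [Module ℚ V] in
/-- Finitely many vectors have a common nonzero multiple in a full lattice. -/
lemma IsFullLattice.exists_common_smul_mem {L : Submodule ℤ V} (hL : IsFullLattice L)
    {ι : Type*} [Fintype ι] (x : ι → V) : ∃ N : ℕ, N ≠ 0 ∧ ∀ i, N • x i ∈ L := by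
  choose N hN h using fun i => hL.exists_smul_mem (x i)
  refine ⟨∏ i, N i, Finset.prod_ne_zero_iff.mpr fun i _ => hN i, fun i => ?_⟩
  obtain ⟨c, hc⟩ := Finset.dvd_prod_of_mem N (Finset.mem_univ i)
  rw [hc, mul_comm, mul_smul]
  exact nsmul_mem (h i) _

variable [FiniteDimensional ℚ V] {n : ℕ}

/-- Absolute convergence of the theta series of a Lorentzian space. -/
lemma summable_phiTau {B : LinearMap.BilinForm ℚ V} (hB : IsHyperbolic (realForm B))
    {L : Submodule ℤ V} (hL : IsFullLattice L) (h : Fin n → V) {τ : Matrix (Fin n) (Fin n) ℂ}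
    (hτ : τ ∈ SiegelUpperHalf n) {Z : ℝ ⊗[ℚ] V} (hZ : realForm B Z Z = -1)
    (W : Fin n → ℝ ⊗[ℚ] V) :
    Summable fun X : coset L h => phiTau (realForm B) τ (toReal X.1) Z W := by
  obtain ⟨bM, β, hβ⟩ := hL.exists_basis
  rw [← (cosetEquiv bM h).summable_iff]
  refine Summable.of_norm ?_
  have h1 := summable_det_mul_exp (β.baseChange ℝ) (Q := majorantForm (realForm B) Z)
    (fun x y => by rw [majorantForm_apply, majorantForm_apply, hB.majorant_symm])
    (fun x hx => by rw [majorantForm_apply]; exact hB.majorant_pos hZ hx) hτ.2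
    (fun j => (realForm B).flip (W j)) id (fun j => ((β.repr (h j.1) j.2 : ℚ) : ℝ))
  refine (h1.mul_left ((2 : ℝ) ^ ((n : ℝ) / 2) * (CFC.sqrt (τ.map Complex.im)).det)).abs.congr
    fun k => ?_
  rw [Function.comp_apply, norm_phiTau _ hτ, toReal_cosetEquiv bM β hβ, amplitude]
  simp only [majorantForm_apply, id, mul_assoc]
  rfl

/-- Absolute convergence of the theta series of a positive definite space. -/
lemma summable_thetaTerm {B : LinearMap.BilinForm ℚ V} (hB : ∀ x y, B x y = B y x)
    (hpos : ∀ x, x ≠ 0 → 0 < B x x)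
    {L : Submodule ℤ V} (hL : IsFullLattice L) (h : Fin n → V) {τ : Matrix (Fin n) (Fin n) ℂ}
    (hτ : τ ∈ SiegelUpperHalf n) :
    Summable fun X : coset L h => thetaTerm B τ X.1 := by
  obtain ⟨bM, β, hβ⟩ := hL.exists_basis
  rw [← (cosetEquiv bM h).summable_iff]
  refine Summable.of_norm ?_
  have h1 := summable_det_mul_exp (β.baseChange ℝ) (Q := realForm B) (realForm_symm hB)
    (realForm_pos_of_pos hB hpos) hτ.2 (m := 0) Fin.elim0 Fin.elim0
    (fun j => ((β.repr (h j.1) j.2 : ℚ) : ℝ))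
  refine h1.congr fun k => ?_
  rw [Function.comp_apply, thetaTerm_eq _ _ hτ.1, norm_mul, Complex.norm_real, Real.norm_eq_abs,
    Real.abs_exp, toReal_cosetEquiv bM β hβ]
  have : ‖Complex.exp (Real.pi * Complex.I * (((τ.map Complex.re) * gram (realForm B)
      (latticeTuple (β.baseChange ℝ) (fun j => ((β.repr (h j.1) j.2 : ℚ) : ℝ)) k)).trace : ℝ))‖
      = 1 := by
    rw [show ∀ x : ℝ, (Real.pi * Complex.I * (x : ℂ)) = ((Real.pi * x : ℝ) : ℂ) * Complex.I from
      fun x => by push_cast; ring]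
    exact Complex.norm_exp_ofReal_mul_I _
  rw [this]
  simp

end FullLattices

/-! ### The orthogonal decomposition `V = U ⊕ U^⊥` and its lattices -/

section Decomposition

variable {V : Type*} [AddCommGroup V] [Module ℚ V] [FiniteDimensional ℚ V]
  {B : LinearMap.BilinForm ℚ V} (hB : ∀ x y, B x y = B y x) {U : Submodule ℚ V}
  (hU : ∀ x ∈ U, x ≠ 0 → 0 < B x x)
include hB hU

lemma isCompl_perp : IsCompl U (perp B U) := by
  have hr : B.IsRefl := fun x y h => by rw [hB, h]
  rw [LinearMap.BilinForm.isCompl_orthogonal_iff_disjoint hr, Submodule.disjoint_def]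
  intro x hx hx'
  by_contra h0
  exact (hU x hx h0).ne' (LinearMap.BilinForm.mem_orthogonal_iff.mp hx' x hx)

omit [FiniteDimensional ℚ V] hU hB in
lemma apply_perp (x : U) (y : perp B U) : B x y = 0 :=
  LinearMap.BilinForm.mem_orthogonal_iff.mp y.2 x x.2

lemma exists_isDecomposition {n : ℕ} {L : Submodule ℤ V} (hL : IsIntegralLattice B L)
    (h : Fin n → V) (hh : ∀ s, h s ∈ LinearMap.BilinForm.dualSubmodule B L) :
    ∃ (r : ℕ) (h₁ : Fin r → Fin n → U) (h₂ : Fin r → Fin n → perp B U),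
      IsDecomposition B L U h h₁ h₂ := by
  have hc := isCompl_perp hB hU
  set e := Submodule.prodEquivOfIsCompl U (perp B U) hc with he
  have hsplit : ∀ x : V, ((e.symm x).1 : V) + (e.symm x).2 = x := fun x => by
    have := e.apply_symm_apply x
    simpa [he] using this
  have huniq : ∀ (u u' : U) (w w' : perp B U), (u : V) + w = u' + w' → u = u' ∧ w = w' :=
    fun u u' w w' huw => by
      have h1 : e (u, w) = e (u', w') := by simpa [he] using huw
      have h2 := e.injective h1
      exact ⟨congrArg Prod.fst h2, congrArg Prod.snd h2⟩
  have hLf := hL.isFullLattice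
  -- the sublattice `L_U ⊕ L_{U^⊥}` of `L`; its index is finite
  set K : Submodule ℤ V := (latticeIn L U).map (U.subtype.restrictScalars ℤ) ⊔
    (latticeIn L (perp B U)).map ((perp B U).subtype.restrictScalars ℤ) with hK
  have hKmem : ∀ x, x ∈ K ↔ ∃ u ∈ latticeIn L U, ∃ w ∈ latticeIn L (perp B U),
      (u : V) + w = x := fun x => by
    rw [hK, Submodule.mem_sup]
    constructor
    · rintro ⟨_, ⟨u, hu, rfl⟩, _, ⟨w, hw, rfl⟩, rfl⟩
      exact ⟨u, hu, w, hw, rfl⟩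
    · rintro ⟨u, hu, w, hw, rfl⟩
      exact ⟨u, ⟨u, hu, rfl⟩, w, ⟨w, hw, rfl⟩, rfl⟩
  set K' : Submodule ℤ L := K.comap L.subtype
  have hfin : Finite (L ⧸ K') := by
    have : Module.Finite ℤ L := Module.Finite.iff_fg.mpr hL.fg
    refine Module.finite_of_fg_torsion (L ⧸ K') fun q => ?_
    obtain ⟨x, rfl⟩ := Submodule.Quotient.mk_surjective _ q
    obtain ⟨N₁, hN₁, h1⟩ := (hLf.latticeIn U).exists_smul_mem (e.symm x).1
    obtain ⟨N₂, hN₂, h2⟩ := (hLf.latticeIn (perp B U)).exists_smul_mem (e.symm x).2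
    refine ⟨⟨(N₁ * N₂ : ℕ), mem_nonZeroDivisors_of_ne_zero (by
      exact_mod_cast mul_ne_zero hN₁ hN₂)⟩, ?_⟩
    change ((N₁ * N₂ : ℕ) : ℤ) • Submodule.Quotient.mk (p := K') x = 0
    rw [← Submodule.Quotient.mk_smul, Submodule.Quotient.mk_eq_zero]
    change (((N₁ * N₂ : ℕ) : ℤ) • (x : V)) ∈ K
    refine (hKmem _).mpr ⟨(N₁ * N₂) • (e.symm x).1, ?_, (N₁ * N₂) • (e.symm x).2, ?_, ?_⟩
    · rw [mul_comm, mul_smul]; exact nsmul_mem h1 _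
    · rw [mul_smul]; exact nsmul_mem h2 _
    · rw [natCast_zsmul]
      conv_rhs => rw [← hsplit x]
      simp
  have : Fintype (Fin n → L ⧸ K') := Fintype.ofFinite _
  set ν := Fintype.equivFin (Fin n → L ⧸ K')
  set x : Fin (Fintype.card (Fin n → L ⧸ K')) → Fin n → L :=
    fun i s => (ν.symm i s).out with hx
  have hxmk : ∀ i s, Submodule.Quotient.mk (p := K') (x i s) = ν.symm i s := fun i s =>
    Quotient.out_eq _
  have hmk : ∀ a c : L, Submodule.Quotient.mk (p := K') a = Submodule.Quotient.mk c ↔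
      (a : V) - c ∈ K := fun a c => by
    rw [Submodule.Quotient.eq]; rfl
  have hdual : ∀ i s, h s + x i s ∈ LinearMap.BilinForm.dualSubmodule B L := fun i s =>
    Submodule.add_mem _ (hh s) (hL.integral (x i s).2)
  refine ⟨_, fun i s => (e.symm (h s + x i s)).1, fun i s => (e.symm (h s + x i s)).2, ?_, ?_,
    ?_, ?_⟩
  · intro i s y hy
    have h1 := hdual i s y hy
    rw [← hsplit (h s + x i s), map_add, LinearMap.add_apply, hB _ y,
      hB (((e.symm (h s + x i s)).2 : perp B U) : V) y, apply_perp, add_zero, hB] at h1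
    exact h1
  · intro i s y hy
    have h1 := hdual i s y hy
    rw [← hsplit (h s + x i s), map_add, LinearMap.add_apply, apply_perp, zero_add] at h1
    exact h1
  · intro X
    constructor
    · intro hX
      set q : Fin n → L ⧸ K' := fun s => Submodule.Quotient.mk ⟨X s - h s, hX s⟩
      have h1 : ∀ s, (X s - h s) - x (ν q) s ∈ K := fun s => by
        rw [← hmk ⟨X s - h s, hX s⟩, hxmk, Equiv.symm_apply_apply]
      choose u hu w hw huw using fun s => (hKmem _).mp (h1 s)
      refine ⟨ν q, fun s => (e.symm (h s + x (ν q) s)).1 + u s, fun s => ?_,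
        fun s => (e.symm (h s + x (ν q) s)).2 + w s, fun s => ?_, fun s => ?_⟩
      · rw [add_sub_cancel_left]; exact hu s
      · rw [add_sub_cancel_left]; exact hw s
      · have h2 := hsplit (h s + x (ν q) s)
        have h3 := huw s
        push_cast
        rw [add_add_add_comm, h2, h3]
        abel
    · rintro ⟨i, X₁, hX₁, X₂, hX₂, hX⟩ s
      have h1 : X s - h s = ((X₁ s - (e.symm (h s + x i s)).1 : U) : V) +
          ((X₂ s - (e.symm (h s + x i s)).2 : perp B U) : V) + x i s := by
        have h2 := hsplit (h s + x i s)
        rw [hX, AddSubgroupClass.coe_sub, AddSubgroupClass.coe_sub, sub_add_sub_comm, h2]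
        abel
      rw [h1]
      exact L.add_mem (L.add_mem (hX₁ s) (hX₂ s)) (x i s).2
  · intro i j hij X₁ hX₁ X₂ hX₂ Y₁ hY₁ Y₂ hY₂ hXY
    apply hij
    apply ν.symm.injective
    funext s
    rw [← hxmk, ← hxmk, hmk]
    obtain ⟨e1, e2⟩ := huniq _ _ _ _ (hXY s)
    have h1 := hsplit (h s + x i s)
    have h2 := hsplit (h s + x j s)
    refine (hKmem _).mpr ⟨(e.symm (h s + x i s)).1 - (e.symm (h s + x j s)).1, ?_,
      (e.symm (h s + x i s)).2 - (e.symm (h s + x j s)).2, ?_, ?_⟩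
    · have := Submodule.sub_mem _ (hY₁ s) (hX₁ s)
      rw [e1] at this
      simpa using this
    · have := Submodule.sub_mem _ (hY₂ s) (hX₂ s)
      rw [e2] at this
      simpa using this
    · rw [AddSubgroupClass.coe_sub, AddSubgroupClass.coe_sub, sub_add_sub_comm, h1, h2]
      abel

/-- The theta series of `V` restricts to `B_U` as the sum of the products of theta series of `U`
and of `U^⊥`. -/
lemma thetaForm_inclReal {n r : ℕ} (hV : IsHyperbolic (realForm B)) {L : Submodule ℤ V}
    (hL : IsFullLattice L) {h : Fin n → V} {h₁ : Fin r → Fin n → U} {h₂ : Fin r → Fin n → perp B U}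
    (hd : IsDecomposition B L U h h₁ h₂) {τ : Matrix (Fin n) (Fin n) ℂ}
    (hτ : τ ∈ SiegelUpperHalf n) {Z : ℝ ⊗[ℚ] (perp B U)}
    (hZ : realForm (B.restrict (perp B U)) Z Z = -1) (W : Fin n → ℝ ⊗[ℚ] (perp B U)) :
    thetaForm B L h τ (inclReal (perp B U) Z) (fun j => inclReal (perp B U) (W j)) =
      ∑ i, thetaSeries (B.restrict U) (latticeIn L U) (h₁ i) τ *
        thetaForm (B.restrict (perp B U)) (latticeIn L (perp B U)) (h₂ i) τ Z W := by
  classical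
  have hc := isCompl_perp hB hU
  set e := Submodule.prodEquivOfIsCompl U (perp B U) hc with he
  have huniq : ∀ (u u' : U) (w w' : perp B U), (u : V) + w = u' + w' → u = u' ∧ w = w' :=
    fun u u' w w' huw => by
      have h1 : e (u, w) = e (u', w') := by simpa [he] using huw
      have h2 := e.injective h1
      exact ⟨congrArg Prod.fst h2, congrArg Prod.snd h2⟩
  let F : (Σ i, coset (latticeIn L U) (h₁ i) × coset (latticeIn L (perp B U)) (h₂ i)) →
      coset L h := fun x => ⟨fun s => (x.2.1.1 s : V) + x.2.2.1 s,
        (hd.union _).mpr ⟨x.1, x.2.1.1, x.2.1.2, x.2.2.1, x.2.2.2, fun _ => rfl⟩⟩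
  have hF : Function.Bijective F := by
    constructor
    · rintro ⟨i, X₁, X₂⟩ ⟨j, Y₁, Y₂⟩ hXY
      have h1 : ∀ s, (X₁.1 s : V) + X₂.1 s = Y₁.1 s + Y₂.1 s := fun s =>
        congrFun (congrArg Subtype.val hXY) s
      obtain rfl : i = j := by
        by_contra hij
        exact hd.disjoint i j hij _ X₁.2 _ X₂.2 _ Y₁.2 _ Y₂.2 h1
      have h2 : X₁ = Y₁ := Subtype.ext (funext fun s => (huniq _ _ _ _ (h1 s)).1)
      have h3 : X₂ = Y₂ := Subtype.ext (funext fun s => (huniq _ _ _ _ (h1 s)).2)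
      rw [h2, h3]
    · rintro ⟨X, hX⟩
      obtain ⟨i, X₁, hX₁, X₂, hX₂, h1⟩ := (hd.union X).mp hX
      exact ⟨⟨i, ⟨X₁, hX₁⟩, ⟨X₂, hX₂⟩⟩, Subtype.ext (funext fun s => (h1 s).symm)⟩
  obtain ⟨FE, hFE⟩ : ∃ FE : (Σ i, coset (latticeIn L U) (h₁ i) ×
      coset (latticeIn L (perp B U)) (h₂ i)) ≃ coset L h,
      ∀ x, (FE x).1 = fun s => (x.2.1.1 s : V) + x.2.2.1 s :=
    ⟨Equiv.ofBijective F hF, fun _ => rfl⟩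
  clear_value F
  have hposU : ∀ x : U, x ≠ 0 → 0 < B.restrict U x x := fun x hx =>
    hU x x.2 (by simpa using hx)
  have hsU : ∀ x y : U, B.restrict U x y = B.restrict U y x := fun x y => hB _ _
  have hterm : ∀ x, phiTau (realForm B) τ (toReal (FE x).1) (inclReal (perp B U) Z)
      (fun j => inclReal (perp B U) (W j)) = thetaTerm (B.restrict U) τ x.2.1.1 *
        phiTau (realForm (B.restrict (perp B U))) τ (toReal x.2.2.1) Z W := fun x => by
    rw [hFE]
    exact phiTau_add hB U hτ _ _ _ _
  have hs1 : ∀ i, Summable fun X : coset (latticeIn L U) (h₁ i) =>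
      thetaTerm (B.restrict U) τ X.1 := fun i =>
    summable_thetaTerm hsU hposU (hL.latticeIn U) _ hτ
  have hs2 : ∀ i, Summable fun X : coset (latticeIn L (perp B U)) (h₂ i) =>
      phiTau (realForm (B.restrict (perp B U))) τ (toReal X.1) Z W := fun i =>
    summable_phiTau (hV.restrict _) (hL.latticeIn _) _ hτ hZ W
  have hs3 : ∀ i, Summable fun x : coset (latticeIn L U) (h₁ i) ×
      coset (latticeIn L (perp B U)) (h₂ i) => thetaTerm (B.restrict U) τ x.1.1 *
        phiTau (realForm (B.restrict (perp B U))) τ (toReal x.2.1) Z W := fun i =>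
    summable_mul_of_summable_norm
      (f := fun X : coset (latticeIn L U) (h₁ i) => thetaTerm (B.restrict U) τ X.1)
      (g := fun X : coset (latticeIn L (perp B U)) (h₂ i) =>
        phiTau (realForm (B.restrict (perp B U))) τ (toReal X.1) Z W) (hs1 i).norm (hs2 i).norm
  rw [thetaForm, ← FE.tsum_eq]
  simp only [hterm]
  have hall : Summable fun x : (Σ i, coset (latticeIn L U) (h₁ i) ×
      coset (latticeIn L (perp B U)) (h₂ i)) => thetaTerm (B.restrict U) τ x.2.1.1 *
        phiTau (realForm (B.restrict (perp B U))) τ (toReal x.2.2.1) Z W := by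
    refine ((FE.summable_iff).mpr (summable_phiTau hV hL h hτ
      (Z := inclReal (perp B U) Z) (by rwa [realForm_inclReal])
      (fun j => inclReal (perp B U) (W j)))).congr fun x => hterm x
  rw [hall.tsum_sigma' hs3, tsum_fintype]
  refine Finset.sum_congr rfl fun i _ => ?_
  rw [thetaSeries, thetaForm, tsum_mul_tsum_of_summable_norm (hs1 i).norm (hs2 i).norm]

end Decomposition

/-! ### Reduction theory of Lorentzian lattices -/

section Minkowski

open MeasureTheory in
/-- Minkowski's theorem on linear forms. -/
lemma exists_int_abs_mulVec_lt {m : ℕ} (A : Matrix (Fin m) (Fin m) ℝ) (hA : A.det ≠ 0) {δ : ℝ}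
    (hδ : 0 < δ) (h : |A.det| < δ ^ m) :
    ∃ k : Fin m → ℤ, k ≠ 0 ∧ ∀ i, |A.mulVec (fun j => (k j : ℝ)) i| < δ := by
  set bs := Pi.basisFun ℝ (Fin m)
  set s : Set (Fin m → ℝ) := (Matrix.toLin' A) ⁻¹' Set.pi Set.univ fun _ => Set.Ioo (-δ) δ with hs
  have hmem : ∀ x, x ∈ s ↔ ∀ i, |A.mulVec x i| < δ := fun x => by
    simp [hs, Set.mem_pi, abs_lt]
  have hdet : LinearMap.det (Matrix.toLin' A) = A.det := LinearMap.det_toLin' A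
  have hvol : volume s = ENNReal.ofReal |A.det|⁻¹ * ENNReal.ofReal (2 * δ) ^ m := by
    rw [hs, Measure.addHaar_preimage_linearMap _ (by rwa [hdet]), hdet, abs_inv, volume_pi_pi]
    simp [two_mul]
  have hF : volume (ZSpan.fundamentalDomain bs) = 1 := by
    have : Matrix.of (bs : Fin m → Fin m → ℝ) = 1 := by
      ext i j
      simp [bs, Matrix.one_apply, Pi.single_apply, eq_comm]
    rw [ZSpan.volume_fundamentalDomain, this]
    simp
  have hfd := ZSpan.isAddFundamentalDomain bs (volume : Measure (Fin m → ℝ))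
  have : Countable (Submodule.span ℤ (Set.range bs)).toAddSubgroup :=
    inferInstanceAs (Countable (Submodule.span ℤ (Set.range bs)))
  obtain ⟨x, hx0, hx⟩ := exists_ne_zero_mem_lattice_of_measure_mul_two_pow_lt_measure
    (L := (Submodule.span ℤ (Set.range bs)).toAddSubgroup) hfd (s := s)
    (fun x hx => by
      rw [hmem] at hx ⊢
      intro i
      rw [Matrix.mulVec_neg, Pi.neg_apply, abs_neg]
      exact hx i)
    ((convex_pi fun i _ => convex_Ioo _ _).linear_preimage _) (by
      rw [hF, one_mul, Module.finrank_fin_fun, hvol, ← ENNReal.ofReal_pow (by positivity),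
        ← ENNReal.ofReal_mul (by positivity), mul_pow, mul_left_comm,
        show (2 : ENNReal) ^ m = ENNReal.ofReal (2 ^ m) by
          rw [ENNReal.ofReal_pow (by norm_num)]; simp,
        ENNReal.ofReal_lt_ofReal_iff (by positivity)]
      refine lt_mul_of_one_lt_right (by positivity) ?_
      rw [inv_mul_eq_div, one_lt_div (by positivity)]
      exact h)
  have hx' := (bs.mem_span_iff_repr_mem ℤ (x : Fin m → ℝ)).mp x.2
  choose k hk using hx'
  have hk' : (fun j => (k j : ℝ)) = (x : Fin m → ℝ) := by
    funext j; simpa [bs] using hk j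
  refine ⟨k, fun h0 => hx0 ?_, ?_⟩
  · ext j
    have := congrFun hk' j
    simp [← this, h0]
  · rw [hk']
    exact (hmem _).mp hx

end Minkowski

section Reduction

variable {E : Type*} [AddCommGroup E] [Module ℝ E] {m : ℕ}

/-- The point of the lattice spanned by `β` with coordinates `k`. -/
noncomputable def latticePoint (β : Fin m → E) (k : Fin m → ℤ) : E := ∑ i, (k i : ℝ) • β i

/-- The Gram determinant of the majorant at `Z` does not depend on `Z`. -/
lemma det_majorant_gram (b : LinearMap.BilinForm ℝ E) (β : Module.Basis (Fin m) ℝ E)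
    {Z : E} (hZ : b Z Z = -1) :
    (Matrix.of fun i j => majorant b Z (β i) (β j)).det = -(Matrix.of fun i j => b (β i) (β j)).det
    := by
  set G : Matrix (Fin m) (Fin m) ℝ := Matrix.of fun i j => b (β i) (β j)
  set ζ : Fin m → ℝ := fun i => β.repr Z i
  set u : Fin m → ℝ := fun i => b (β i) Z
  have hGζ : ∀ i, ∑ k, G i k * ζ k = u i := fun i => by
    simp only [u]
    conv_rhs => rw [← β.sum_repr Z, map_sum]
    exact Finset.sum_congr rfl fun k _ => by simp [G, ζ, mul_comm]
  have huζ : ∑ i, u i * ζ i = -1 := by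
    rw [← hZ]
    conv_rhs => rw [← β.sum_repr Z, LinearMap.map_sum₂]
    refine Finset.sum_congr rfl fun k _ => ?_
    rw [β.sum_repr Z]
    simp [u, ζ, mul_comm]
  have h1 : (Matrix.of fun i j => majorant b Z (β i) (β j)) =
      G * (1 + Matrix.replicateCol Unit ((2 : ℝ) • ζ) * Matrix.replicateRow Unit u) := by
    rw [Matrix.mul_add, Matrix.mul_one, ← Matrix.mul_assoc]
    ext i j
    rw [Matrix.add_apply, Matrix.mul_apply]
    simp only [Matrix.of_apply, majorant, Finset.univ_unique, Finset.sum_singleton,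
      Matrix.replicateRow_apply, Matrix.mul_apply, Matrix.replicateCol_apply, Pi.smul_apply,
      smul_eq_mul]
    have h2 : ∑ k, G i k * (2 * ζ k) = 2 * u i := by
      rw [← hGζ, Finset.mul_sum]
      exact Finset.sum_congr rfl fun k _ => by ring
    rw [h2]
    rfl
  rw [h1, Matrix.det_mul, Matrix.det_one_add_replicateCol_mul_replicateRow]
  have h3 : u ⬝ᵥ ((2 : ℝ) • ζ) = -2 := by
    rw [dotProduct_smul, dotProduct, huζ]; norm_num
  rw [h3]; ring

lemma sum_mulVec_sq {P A : Matrix (Fin m) (Fin m) ℝ} (hA : A.transpose * A = P) (x : Fin m → ℝ) :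
    ∑ i, (A.mulVec x i) ^ 2 = ∑ i, ∑ j, P i j * (x i * x j) := by
  have h1 : ∑ i, (A.mulVec x i) ^ 2 = x ⬝ᵥ P.mulVec x := by
    rw [← hA, ← Matrix.mulVec_mulVec, Matrix.dotProduct_mulVec, Matrix.vecMul_transpose]
    simp [dotProduct, sq]
  rw [h1]
  simp only [dotProduct, Matrix.mulVec, Finset.mul_sum]
  exact Finset.sum_congr rfl fun i _ => Finset.sum_congr rfl fun j _ => by ring

/-- If no nonzero lattice vector is short for the majorant at `Z`, then the lattice vectors of
bounded length span. Otherwise Minkowski's theorem, applied to an ellipsoid that is thin along the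
span of these vectors and long in an orthogonal direction, gives a short vector. -/
lemma exists_spanning_of_thick {b : LinearMap.BilinForm ℝ E} (hb : IsHyperbolic b)
    (β : Module.Basis (Fin (m + 1)) ℝ E) :
    ∃ R : ℝ, 0 < R ∧ ∀ Z, b Z Z = -1 →
      (∀ k : Fin (m + 1) → ℤ, k ≠ 0 →
        1 ≤ majorant b Z (latticePoint β k) (latticePoint β k)) →
      ∃ c : Fin (m + 1) → Fin (m + 1) → ℤ, LinearIndependent ℝ (fun i => latticePoint β (c i)) ∧
        ∀ i, majorant b Z (latticePoint β (c i)) (latticePoint β (c i)) ≤ R := by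
  set d : ℝ := Real.sqrt |(Matrix.of fun i j => b (β i) (β j)).det|
  set δ : ℝ := Real.sqrt ((m + 1 : ℝ)⁻¹)
  have hδ : 0 < δ := Real.sqrt_pos.mpr (by positivity)
  have hδ2 : (m + 1 : ℝ) * δ ^ 2 = 1 := by
    rw [Real.sq_sqrt (by positivity), mul_inv_cancel₀ (by positivity)]
  -- `ρ` is the ratio of the short to the long axes
  set ρ : ℝ := (1 + 2 ^ (m + 1) * d * (δ ^ (m + 1))⁻¹)⁻¹
  have hd0 : 0 ≤ d := Real.sqrt_nonneg _
  have hρ : 0 < ρ := by positivity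
  have hρ1 : 2 ^ (m + 1) * ρ * d < δ ^ (m + 1) := by
    have : 0 < δ ^ (m + 1) := by positivity
    rw [mul_right_comm, ← div_eq_mul_inv, div_lt_iff₀ (by positivity), mul_add, mul_one,
      mul_comm (δ ^ (m + 1)), inv_mul_cancel_right₀ this.ne']
    linarith
  refine ⟨1 + (ρ ^ 2)⁻¹, by positivity, fun Z hZ hthick => ?_⟩
  set R : ℝ := 1 + (ρ ^ 2)⁻¹
  set S : Set E := {x | ∃ k, x = latticePoint β k ∧ majorant b Z x x ≤ R}
  have : Module.Finite ℝ E := Module.Finite.of_basis β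
  by_cases htop : Submodule.span ℝ S = ⊤
  · obtain ⟨f, hf, -, hli⟩ := Submodule.exists_fun_fin_finrank_span_eq ℝ S
    have hr : Module.finrank ℝ (Submodule.span ℝ S) = m + 1 := by
      rw [htop, finrank_top, Module.finrank_eq_card_basis β, Fintype.card_fin]
    choose c hc using hf
    refine ⟨fun i => c (Fin.cast hr.symm i), ?_, fun i => ?_⟩
    · have := hli.comp (Fin.cast hr.symm) (Fin.cast_injective _)
      have heq : (fun i => latticePoint β (c (Fin.cast hr.symm i))) = f ∘ Fin.cast hr.symm := by
        funext i
        exact (hc _).1.symm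
      rwa [heq]
    · rw [← (hc _).1]; exact (hc _).2
  exfalso
  obtain ⟨f, hf0, hf⟩ := Submodule.exists_le_ker_of_lt_top _ (lt_top_iff_ne_top.mpr htop)
  -- coordinates in which the majorant is the standard scalar product
  have hpd := posDef_gram (Q := majorantForm b Z)
    (fun x y => by rw [majorantForm_apply, majorantForm_apply, hb.majorant_symm])
    (fun x hx => by rw [majorantForm_apply]; exact hb.majorant_pos hZ hx) β
  have hval := bilin_combination_self (majorantForm b Z) β
  simp only [majorantForm_apply] at hpd hval
  set P : Matrix (Fin (m + 1)) (Fin (m + 1)) ℝ := Matrix.of fun i j => majorant b Z (β i) (β j)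
    with hP
  set A := (CFC.sqrt P).transpose
  have hA : A.transpose * A = P := sqrt_mul_transpose_sqrt hpd
  have hAdet : A.det = d := by
    have h1 : 0 < A.det := by
      simpa [A, Matrix.det_transpose] using det_sqrt_pos hpd
    have h2 : A.det ^ 2 = P.det := by simpa [A, Matrix.det_transpose] using det_sqrt_sq hpd
    rw [← Real.sqrt_sq h1.le, h2]
    simp only [d]
    rw [← abs_of_pos hpd.det_pos, hP, det_majorant_gram b β hZ, abs_neg]
  have hdpos : 0 < d := by
    rw [← hAdet]; simpa [A, Matrix.det_transpose] using det_sqrt_pos hpd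
  have hAu : IsUnit A.det := (hAdet ▸ hdpos.ne').isUnit
  set w : Fin (m + 1) → ℝ := Matrix.vecMul (fun i => f (β i)) A⁻¹
  have hw : ∀ x : Fin (m + 1) → ℝ, w ⬝ᵥ A.mulVec x = f (∑ i, x i • β i) := fun x => by
    simp only [w]
    rw [Matrix.dotProduct_mulVec, Matrix.vecMul_vecMul, Matrix.nonsing_inv_mul A hAu,
      Matrix.vecMul_one, map_sum]
    exact Finset.sum_congr rfl fun i _ => by rw [map_smul, smul_eq_mul, mul_comm]
  have hw0 : w ≠ 0 := fun h0 => hf0 <| β.ext fun i => by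
    have := hw (Pi.single i 1)
    rw [h0, zero_dotProduct] at this
    rw [LinearMap.zero_apply, this]
    congr 1
    simp [Pi.single_apply]
  set t₀ : ℝ := w ⬝ᵥ w with ht₀
  have ht₀pos : 0 < t₀ :=
    lt_of_le_of_ne (Finset.sum_nonneg fun i _ => mul_self_nonneg _)
      fun h => hw0 (dotProduct_self_eq_zero.mp h.symm)
  set D : Matrix (Fin (m + 1)) (Fin (m + 1)) ℝ := (2 : ℝ) • (1 +
    Matrix.replicateCol Unit (((ρ - 1) / t₀) • w) * Matrix.replicateRow Unit w) with hD
  have hDdet : D.det = 2 ^ (m + 1) * ρ := by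
    rw [hD, Matrix.det_smul, Matrix.det_one_add_replicateCol_mul_replicateRow, dotProduct_smul,
      ← ht₀, smul_eq_mul, div_mul_cancel₀ _ ht₀pos.ne', Fintype.card_fin]
    ring
  have hDy : ∀ y i, D.mulVec y i = 2 * (y i + (ρ - 1) / t₀ * (w ⬝ᵥ y) * w i) := fun y i => by
    rw [hD, Matrix.smul_mulVec, Pi.smul_apply, Matrix.add_mulVec, Matrix.one_mulVec, Pi.add_apply,
      smul_eq_mul, ← Matrix.mulVec_mulVec]
    congr 2
    simp [Matrix.mulVec, dotProduct]
    ring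
  have hDA : (D * A).det = 2 ^ (m + 1) * ρ * d := by rw [Matrix.det_mul, hDdet, hAdet]
  obtain ⟨k, hk0, hk⟩ := exists_int_abs_mulVec_lt (D * A) (by rw [hDA]; positivity) hδ (by
    rw [hDA, abs_of_pos (by positivity)]; exact hρ1)
  set y := A.mulVec fun j => (k j : ℝ) with hy
  have hnorm : majorant b Z (latticePoint β k) (latticePoint β k) = ∑ i, y i ^ 2 := by
    rw [hy, sum_mulVec_sq hA]
    exact hval _
  set t := w ⬝ᵥ y with ht
  have hsum : ∑ i, ((D * A).mulVec (fun j => (k j : ℝ)) i) ^ 2 =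
      4 * (∑ i, y i ^ 2 - t ^ 2 / t₀ + ρ ^ 2 * (t ^ 2 / t₀)) := by
    rw [← Matrix.mulVec_mulVec]
    simp only [← hy, hDy, ← ht]
    have h1 : ∀ i, (2 * (y i + (ρ - 1) / t₀ * t * w i)) ^ 2 = 4 * y i ^ 2 +
        8 * ((ρ - 1) / t₀ * t) * (w i * y i) + 4 * ((ρ - 1) / t₀ * t) ^ 2 * (w i * w i) :=
      fun i => by ring
    simp only [h1, Finset.sum_add_distrib, ← Finset.mul_sum]
    have h2 : ∑ i, w i * y i = t := rfl
    have h3 : ∑ i, w i * w i = t₀ := rfl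
    rw [h2, h3]
    field_simp
    ring
  have hle : ∑ i, ((D * A).mulVec (fun j => (k j : ℝ)) i) ^ 2 ≤ 1 := by
    calc _ ≤ ∑ _i : Fin (m + 1), δ ^ 2 := Finset.sum_le_sum fun i _ => by
            rw [← sq_abs]; exact pow_le_pow_left₀ (abs_nonneg _) (hk i).le 2
      _ = 1 := by rw [Finset.sum_const, Finset.card_univ, Fintype.card_fin, nsmul_eq_mul]
                  push_cast; exact hδ2
  have hcs : t ^ 2 / t₀ ≤ ∑ i, y i ^ 2 := by
    rw [div_le_iff₀ ht₀pos, mul_comm]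
    have := Finset.sum_mul_sq_le_sq_mul_sq Finset.univ w y
    simpa [t, t₀, dotProduct, sq] using this
  have hq : 0 ≤ t ^ 2 / t₀ := by positivity
  rw [hsum] at hle
  have h4 : ρ ^ 2 * (t ^ 2 / t₀) ≤ 1 := by linarith
  have h5 : t ^ 2 / t₀ ≤ (ρ ^ 2)⁻¹ := by
    rw [← one_div, le_div_iff₀ (by positivity)]; linarith
  have hpos2 : 0 ≤ ρ ^ 2 * (t ^ 2 / t₀) := by positivity
  have hkS : latticePoint β k ∈ S := ⟨k, rfl, by rw [hnorm]; simp only [R]; linarith⟩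
  have ht0 : t = 0 := by
    rw [ht, hy, hw]
    exact hf (Submodule.subset_span hkS)
  have := hthick k hk0
  rw [hnorm] at this
  rw [ht0] at hle
  simp at hle
  linarith

lemma apply_latticePoint_int {b : LinearMap.BilinForm ℝ E} {β : Fin m → E}
    (hint : ∀ i j, ∃ z : ℤ, b (β i) (β j) = z) (k l : Fin m → ℤ) :
    ∃ z : ℤ, b (latticePoint β k) (latticePoint β l) = z := by
  choose z hz using hint
  refine ⟨∑ i, ∑ j, k i * l j * z i j, ?_⟩
  rw [latticePoint, LinearMap.map_sum₂]
  push_cast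
  refine Finset.sum_congr rfl fun i _ => ?_
  rw [latticePoint, map_sum]
  refine Finset.sum_congr rfl fun j _ => ?_
  simp only [map_smul, LinearMap.smul_apply, smul_eq_mul, hz]
  ring

lemma latticePoint_ne_zero (β : Module.Basis (Fin m) ℝ E) {k : Fin m → ℤ} (hk : k ≠ 0) :
    latticePoint β k ≠ 0 := fun h0 => hk <| by
  funext i
  have := Fintype.linearIndependent_iff.mp β.linearIndependent _ h0 i
  exact_mod_cast this

lemma eq_zero_of_abs_lt_one {x : ℝ} (hx : ∃ z : ℤ, x = z) (h : |x| < 1) : x = 0 := by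
  obtain ⟨z, rfl⟩ := hx
  have : |z| < 1 := by exact_mod_cast h
  simp [Int.abs_lt_one_iff.mp this]

/-- If there are nonzero lattice vectors of majorant less than `1`, there is a shortest one. -/
lemma exists_shortest {b : LinearMap.BilinForm ℝ E} (hb : IsHyperbolic b)
    (β : Module.Basis (Fin m) ℝ E) {Z : E} (hZ : b Z Z = -1) {k₀ : Fin m → ℤ} (hk₀ : k₀ ≠ 0)
    (h1 : majorant b Z (latticePoint β k₀) (latticePoint β k₀) < 1) :
    ∃ k : Fin m → ℤ, k ≠ 0 ∧ majorant b Z (latticePoint β k) (latticePoint β k) < 1 ∧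
      ∀ l : Fin m → ℤ, l ≠ 0 → majorant b Z (latticePoint β k) (latticePoint β k) ≤
        majorant b Z (latticePoint β l) (latticePoint β l) := by
  obtain ⟨c, hc, H⟩ := exists_sq_repr_le (majorantForm b Z)
    (fun x y => by rw [majorantForm_apply, majorantForm_apply, hb.majorant_symm])
    (fun x hx => by rw [majorantForm_apply]; exact hb.majorant_pos hZ hx) β
  simp only [majorantForm_apply] at H
  set S : Set (Fin m → ℤ) :=
    {k | k ≠ 0 ∧ majorant b Z (latticePoint β k) (latticePoint β k) < 1} with hS
  have hfin : S.Finite := by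
    refine Set.Finite.subset (Set.Finite.pi' fun _ : Fin m =>
      Set.finite_Icc (-⌈1 + c⁻¹⌉) ⌈1 + c⁻¹⌉) fun k hk i => ?_
    have h2 := (H fun i => (k i : ℝ)).trans hk.2.le
    have h3 := abs_le_one_add_sum_sq (fun i => (k i : ℝ)) i
    have h4 : ∑ i, (k i : ℝ) ^ 2 ≤ c⁻¹ := by
      rw [← one_div, le_div_iff₀ hc]; linarith
    have h5 : |(k i : ℝ)| ≤ ((⌈1 + c⁻¹⌉ : ℤ) : ℝ) := by
      refine h3.trans (le_trans ?_ (Int.le_ceil _)); linarith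
    have h6 : |k i| ≤ ⌈1 + c⁻¹⌉ := by exact_mod_cast h5
    exact abs_le.mp h6
  obtain ⟨k, hk, hmin⟩ := hfin.exists_minimalFor
    (fun k => majorant b Z (latticePoint β k) (latticePoint β k)) S ⟨k₀, hk₀, h1⟩
  refine ⟨k, hk.1, hk.2, fun l hl => ?_⟩
  by_contra hcon
  push Not at hcon
  exact absurd (hmin ⟨hl, hcon.trans hk.2⟩ hcon.le) (not_le.mpr hcon)

/-- Reduction theory: at every point `Z` of hyperbolic space there are independent lattice vectors
with bounded inner products which, for the majorant at `Z`, are either bounded, or grow at most like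
`1 / |(e,Z)|` for an isotropic lattice vector `e` (the cusp that `Z` is close to). In the second
case they are bounded for the majorant at the point where the geodesic from `e` through `Z` leaves
the cuspidal neighbourhood. -/
lemma exists_reduced {b : LinearMap.BilinForm ℝ E} (hb : IsHyperbolic b)
    (β : Module.Basis (Fin (m + 1)) ℝ E) (hint : ∀ i j, ∃ z : ℤ, b (β i) (β j) = z) :
    ∃ R : ℝ, 0 < R ∧ ∀ Z, b Z Z = -1 →
      ∃ (c : Fin (m + 1) → Fin (m + 1) → ℤ) (e : Fin (m + 1) → ℤ),
        LinearIndependent ℝ (fun i => latticePoint β (c i)) ∧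
        b (latticePoint β e) (latticePoint β e) = 0 ∧
        (∀ i j, |b (latticePoint β (c i)) (latticePoint β (c j))| ≤ R) ∧
        (∀ i, |b (latticePoint β (c i)) (latticePoint β e)| ≤ R) ∧
        ((e = 0 ∧ ∀ i, |b (latticePoint β (c i)) Z| ≤ R) ∨
          (e ≠ 0 ∧ |b (latticePoint β e) Z| ≤ 1 ∧
            ∀ i, |b (latticePoint β e) Z * b (latticePoint β (c i)) Z| ≤ R)) := by
  obtain ⟨R₀, hR₀, H⟩ := exists_spanning_of_thick hb β
  refine ⟨2 * (R₀ + 1), by positivity, fun Z hZ => ?_⟩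
  have hle : ∀ Z', b Z' Z' = -1 → ∀ x y : E, majorant b Z' x x ≤ R₀ + 1 →
      majorant b Z' y y ≤ R₀ + 1 → |b x y| ≤ R₀ + 1 := fun Z' hZ' x y hx hy => by
    refine abs_le_of_sq_le_sq ((hb.sq_le_majorant hZ' x y).trans ?_) (by positivity)
    rw [sq]
    exact mul_le_mul hx hy (hb.majorant_nonneg hZ' y) (by positivity)
  have hleZ : ∀ Z', b Z' Z' = -1 → ∀ x : E, majorant b Z' x x ≤ R₀ + 1 → |b x Z'| ≤ R₀ + 1 :=
    fun Z' hZ' x hx => by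
      refine abs_le_of_sq_le_sq ((hb.sq_apply_le_majorant hZ' x).trans (hx.trans ?_))
        (by positivity)
      nlinarith
  by_cases hthick : ∀ k : Fin (m + 1) → ℤ, k ≠ 0 →
      1 ≤ majorant b Z (latticePoint β k) (latticePoint β k)
  · obtain ⟨c, hli, hc⟩ := H Z hZ hthick
    have hc' := fun i => (hc i).trans (by linarith : R₀ ≤ R₀ + 1)
    refine ⟨c, 0, hli, by simp [latticePoint], fun i j => ?_, fun i => ?_,
      Or.inl ⟨rfl, fun i => ?_⟩⟩
    · exact (hle Z hZ _ _ (hc' i) (hc' j)).trans (by linarith)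
    · simp [latticePoint]; positivity
    · exact (hleZ Z hZ _ (hc' i)).trans (by linarith)
  push Not at hthick
  obtain ⟨k₀, hk₀, h1⟩ := hthick
  obtain ⟨k, hk, hk1, hmin⟩ := exists_shortest hb β hZ hk₀ h1
  set e := latticePoint β k with he
  have he0 : e ≠ 0 := latticePoint_ne_zero β hk
  have hee : b e e = 0 := eq_zero_of_abs_lt_one (apply_latticePoint_int hint k k)
    ((hb.abs_self_le_majorant hZ e).trans_lt hk1)
  set η := b e Z with hη
  have hη0 : η ≠ 0 := hb.apply_ne_zero_of_isotropic hZ hee he0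
  have hmaje : majorant b Z e e = 2 * η ^ 2 := by simp only [majorant, hee, ← hη]; ring
  have hη1 : 2 * η ^ 2 < 1 := by rw [← hmaje]; exact hk1
  -- the point `Z'` on the geodesic from `e` through `Z` at which `e` has length `1`
  set α : ℝ := (Real.sqrt 2 * |η|)⁻¹ with hα
  have hαpos : 0 < α := by positivity
  have hαη : α ^ 2 * η ^ 2 = 1 / 2 := by
    rw [hα, inv_pow, mul_pow, Real.sq_sqrt (by norm_num), sq_abs]
    field_simp
  have hα1 : 1 ≤ α ^ 2 := by
    by_contra hcon
    push Not at hcon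
    have : 0 < η ^ 2 := by positivity
    nlinarith
  set γ : ℝ := (α ^ 2 - 1) / (2 * α * η) with hγ
  have hγ' : 2 * α * γ * η = α ^ 2 - 1 := by rw [hγ]; field_simp
  set Z' := α • Z + γ • e with hZ'
  have hZe : b Z e = η := hb.symm Z e
  have hZ'1 : b Z' Z' = -1 := by
    simp only [hZ', map_add, map_smul, LinearMap.add_apply, LinearMap.smul_apply, smul_eq_mul, hZ,
      hee, hZe, ← hη]
    linarith
  have hx : ∀ x, b x Z' = α * b x Z + γ * b x e := fun x => by
    simp only [hZ', map_add, map_smul, smul_eq_mul]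
  have heZ' : b e Z' = α * η := by rw [hx, hee, mul_zero, add_zero]
  have hmaje' : majorant b Z' e e = 1 := by
    simp only [majorant, hee, heZ']; linear_combination 2 * hαη
  -- `Z'` is thick: a shorter vector would be proportional to `e`
  have hthick' : ∀ l : Fin (m + 1) → ℤ, l ≠ 0 →
      1 ≤ majorant b Z' (latticePoint β l) (latticePoint β l) := fun l hl => by
    by_contra hcon
    push Not at hcon
    set x := latticePoint β l
    have hxx : b x x = 0 := eq_zero_of_abs_lt_one (apply_latticePoint_int hint l l)
      ((hb.abs_self_le_majorant hZ'1 x).trans_lt hcon)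
    have hxe : b x e = 0 := by
      refine eq_zero_of_abs_lt_one (apply_latticePoint_int hint l k) ?_
      have h2 := hb.sq_le_majorant hZ'1 x e
      rw [hmaje', mul_one] at h2
      rw [← sq_lt_one_iff_abs_lt_one]
      exact h2.trans_lt hcon
    have hprop := hb.eq_smul_of_isotropic hZ hee he0 hxx hxe
    set t := b x Z / b e Z
    have h3 : ∀ Z'', majorant b Z'' x x = t ^ 2 * majorant b Z'' e e := fun Z'' => by
      rw [hprop]
      simp only [majorant, map_smul, LinearMap.smul_apply, smul_eq_mul]; ring
    have h4 := hmin l hl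
    rw [h3, hmaje] at h4
    rw [h3, hmaje', mul_one] at hcon
    have : 0 < η ^ 2 := by positivity
    nlinarith
  obtain ⟨c, hli, hc⟩ := H Z' hZ'1 hthick'
  have hc' := fun i => (hc i).trans (by linarith : R₀ ≤ R₀ + 1)
  have hce := fun i => hle Z' hZ'1 _ e (hc' i) (by rw [hmaje']; linarith)
  refine ⟨c, k, hli, hee, fun i j => ?_, fun i => ?_, Or.inr ⟨hk, ?_, fun i => ?_⟩⟩
  · exact (hle Z' hZ'1 _ _ (hc' i) (hc' j)).trans (by linarith)
  · exact (hce i).trans (by linarith)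
  · rw [← sq_le_one_iff_abs_le_one]; nlinarith
  · have h5 := hleZ Z' hZ'1 _ (hc' i)
    set y := latticePoint β (c i)
    have h6 : η * b y Z = η / α * b y Z' - η * γ / α * b y e := by
      rw [hx]; field_simp; ring
    have h7 : |η / α| ≤ 1 := by
      rw [abs_div, abs_of_pos hαpos, div_le_one hαpos]
      refine abs_le_of_sq_le_sq ?_ hαpos.le
      nlinarith
    have h8 : |η * γ / α| ≤ 1 := by
      have : η * γ / α = (α ^ 2 - 1) / (2 * α ^ 2) := by
        rw [← hγ']; field_simp
      rw [this, abs_div, abs_of_nonneg (by linarith), abs_of_pos (by positivity),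
        div_le_one (by positivity)]
      linarith
    rw [h6]
    refine (abs_sub _ _).trans ?_
    rw [abs_mul, abs_mul]
    have := mul_le_mul h7 h5 (abs_nonneg _) zero_le_one
    have := mul_le_mul h8 (hce i) (abs_nonneg _) zero_le_one
    linarith

end Reduction

/-! ### Finiteness of orbits -/

section Pigeonhole

lemma exists_finite_representatives {α κ : Type*} (S : Set α) (c : α → κ) (hc : (c '' S).Finite)
    (r : α → α → Prop) (h : ∀ a ∈ S, ∀ b ∈ S, c a = c b → r a b) :
    ∃ T ⊆ S, T.Finite ∧ ∀ b ∈ S, ∃ a ∈ T, r a b := by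
  obtain ⟨T, hTS, hbij⟩ := Set.SurjOn.exists_bijOn_subset (Set.surjOn_image c S)
  refine ⟨T, hTS, Set.Finite.of_finite_image (hbij.image_eq ▸ hc) hbij.injOn, fun b hb => ?_⟩
  obtain ⟨a, ha, hab⟩ := hbij.surjOn (Set.mem_image_of_mem c hb)
  exact ⟨a, ha, h a (hTS ha) b hb hab⟩

end Pigeonhole

section Isometries

lemma IsHyperbolic.eq_zero_of_forall {E : Type*} [AddCommGroup E] [Module ℝ E]
    {b : LinearMap.BilinForm ℝ E} (hb : IsHyperbolic b) {Z : E} (hZ : b Z Z = -1) {x : E}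
    (hx : ∀ y, b x y = 0) : x = 0 := by
  by_contra h0
  exact (hb.pos Z x hZ (hx Z) h0).ne' (hx x)

lemma det_sq_of_isometry {K W : Type*} [Field K] [AddCommGroup W] [Module K W]
    [FiniteDimensional K W] {B : LinearMap.BilinForm K W} (hnd : ∀ x, (∀ y, B x y = 0) → x = 0)
    (hs : ∀ x y, B x y = B y x) (g : W →ₗ[K] W) (hg : ∀ x y, B (g x) (g y) = B x y) :
    LinearMap.det g ^ 2 = 1 := by
  classical
  set b := Module.finBasis K W
  have h1 : B.comp g g = B := by ext x y; exact hg x y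
  have h2 := LinearMap.BilinForm.toMatrix_comp b b B g g
  rw [h1] at h2
  have h3 := congrArg Matrix.det h2
  rw [Matrix.det_mul, Matrix.det_mul, Matrix.det_transpose, LinearMap.det_toMatrix] at h3
  have h4 : (LinearMap.BilinForm.toMatrix b B).det ≠ 0 := by
    rw [← LinearMap.BilinForm.nondegenerate_iff_det_ne_zero]
    refine ⟨fun x hx => hnd x hx, fun x hx => hnd x fun y => by rw [hs]; exact hx y⟩
  have h5 : (LinearMap.BilinForm.toMatrix b B).det * (LinearMap.det g ^ 2 - 1) = 0 := by
    linear_combination -h3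
  rcases mul_eq_zero.mp h5 with h | h
  · exact absurd h h4
  · exact sub_eq_zero.mp h

variable {V : Type*} [AddCommGroup V] [Module ℚ V] {B : LinearMap.BilinForm ℚ V}

lemma actReal_mul (g k : V ≃ₗ[ℚ] V) (Z : ℝ ⊗[ℚ] V) :
    actReal (g * k) Z = actReal g (actReal k Z) := by
  have h : actReal (g * k) = actReal g ∘ₗ actReal k := by ext x; simp [actReal]
  rw [h]; rfl

lemma realForm_actReal {g : V ≃ₗ[ℚ] V} (hg : ∀ x y, B (g x) (g y) = B x y) (x y : ℝ ⊗[ℚ] V) :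
    realForm B (actReal g x) (actReal g y) = realForm B x y := by
  induction x with
  | zero => simp
  | add x₁ x₂ h1 h2 => simp [h1, h2]
  | tmul a x =>
    induction y with
    | zero => simp
    | add y₁ y₂ h1 h2 => rw [map_add, map_add, h1, h2, map_add]
    | tmul c y =>
      simp only [actReal, LinearMap.baseChange_tmul, LinearEquiv.coe_coe]
      rw [realForm_tmul, realForm_tmul, hg]

lemma preservesSheet_of_neg (hB : IsHyperbolic (realForm B)) {Z₀ : ℝ ⊗[ℚ] V}
    (hZ₀ : realForm B Z₀ Z₀ = -1) {g : V ≃ₗ[ℚ] V} (hg : ∀ x y, B (g x) (g y) = B x y)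
    (hneg : realForm B (actReal g Z₀) Z₀ < 0) (Z : ℝ ⊗[ℚ] V) :
    actReal g Z ∈ sheet (realForm B) Z₀ ↔ Z ∈ sheet (realForm B) Z₀ := by
  have h1 : realForm B (actReal g Z₀) (actReal g Z₀) = -1 := by rw [realForm_actReal hg, hZ₀]
  simp only [sheet, Set.mem_ofPred_eq, realForm_actReal hg]
  refine and_congr_right fun hZ => ?_
  have h2 : realForm B (actReal g Z) (actReal g Z) = -1 := by rw [realForm_actReal hg, hZ]
  constructor
  · intro h
    rw [← realForm_actReal hg]
    exact hB.neg_of_neg_of_neg hZ₀ h2 h1 h hneg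
  · intro h
    rw [← realForm_actReal hg] at h
    exact hB.neg_of_neg_of_neg h1 h2 hZ₀ h (by rwa [hB.symm])

/-- The group of isometries of `V` that stabilize the lattice `L`, fix `U` pointwise and fix the
classes of the `h_s` modulo `L`. -/
def fixingGroup {n : ℕ} (B : LinearMap.BilinForm ℚ V) (L : Submodule ℤ V) (U : Submodule ℚ V)
    (h : Fin n → V) : Subgroup (V ≃ₗ[ℚ] V) where
  carrier := {g | (∀ x y, B (g x) (g y) = B x y) ∧ (∀ x ∈ U, g x = x) ∧ (∀ x, g x ∈ L ↔ x ∈ L) ∧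
    ∀ s, g (h s) - h s ∈ L}
  one_mem' := ⟨fun _ _ => rfl, fun _ _ => rfl, fun _ => Iff.rfl, fun s => by simp⟩
  mul_mem' := by
    rintro g k ⟨g1, g2, g3, g4⟩ ⟨k1, k2, k3, k4⟩
    refine ⟨fun x y => ?_, fun x hx => ?_, fun x => ?_, fun s => ?_⟩
    · rw [LinearEquiv.mul_apply, LinearEquiv.mul_apply, g1, k1]
    · rw [LinearEquiv.mul_apply, k2 x hx, g2 x hx]
    · rw [LinearEquiv.mul_apply, g3, k3]
    · rw [LinearEquiv.mul_apply]
      have h1 : g (k (h s)) - h s = g (k (h s) - h s) + (g (h s) - h s) := by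
        rw [map_sub]; abel
      rw [h1]
      exact L.add_mem ((g3 _).mpr (k4 s)) (g4 s)
  inv_mem' := by
    rintro g ⟨g1, g2, g3, g4⟩
    have e1 : ∀ x, g (g⁻¹ x) = x := fun x => by
      rw [← LinearEquiv.mul_apply, mul_inv_cancel]; rfl
    refine ⟨fun x y => ?_, fun x hx => ?_, fun x => ?_, fun s => ?_⟩
    · rw [← g1, e1, e1]
    · apply g.injective
      rw [e1, g2 x hx]
    · rw [← g3, e1]
    · rw [← g3, map_sub, e1, ← neg_sub]
      exact L.neg_mem (g4 s)

/-- The rational form underlying a hyperbolic real form is nondegenerate. -/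
lemma eq_zero_of_forall_apply (hB : IsHyperbolic (realForm B)) {Z₀ : ℝ ⊗[ℚ] V}
    (hZ₀ : realForm B Z₀ Z₀ = -1) {x : V} (hx : ∀ y, B x y = 0) : x = 0 := by
  have h1 : ((1 : ℝ) ⊗ₜ[ℚ] x : ℝ ⊗[ℚ] V) = 0 := hB.eq_zero_of_forall hZ₀ fun y => by
    induction y with
    | zero => simp
    | add y₁ y₂ h1 h2 => rw [map_add, h1, h2, add_zero]
    | tmul c y => rw [realForm_tmul, hx]; simp
  exact (Module.FaithfullyFlat.tensorProduct_mk_injective (A := ℚ) (B := ℝ) V)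
    (by simpa using h1)

variable [FiniteDimensional ℚ V]

/-- Up to finitely many translations, the isometries of the lattice that fix `U` lie in the given
subgroup `Γ` of finite index. -/
lemma exists_finite_cosets (hs : ∀ x y, B x y = B y x) (hB : IsHyperbolic (realForm B))
    {Z₀ : ℝ ⊗[ℚ] V} (hZ₀ : realForm B Z₀ Z₀ = -1) {L : Submodule ℤ V}
    {Γ : Subgroup (V ≃ₗ[ℚ] V)} (hΓ : Γ.relIndex (arithmeticGroup B L Z₀) ≠ 0)
    (U : Submodule ℚ V) {n : ℕ} (h : Fin n → V) :
    ∃ T ⊆ (fixingGroup B L U h : Set (V ≃ₗ[ℚ] V)), T.Finite ∧ ∀ g ∈ fixingGroup B L U h,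
      ∃ t ∈ T, ∃ γ ∈ Γ ⊓ fixingGroup B L U h, g = γ * t := by
  classical
  set A := fixingGroup B L U h
  have hnd : ∀ x : V, (∀ y, B x y = 0) → x = 0 := fun x hx => eq_zero_of_forall_apply hB hZ₀ hx
  -- isometries with the same determinant and the same effect on the sheets
  obtain ⟨T₁, hT₁, hT₁f, hT₁'⟩ := exists_finite_representatives (A : Set (V ≃ₗ[ℚ] V))
    (fun g => (LinearMap.det (g : V →ₗ[ℚ] V), decide (realForm B (actReal g⁻¹ Z₀) Z₀ < 0)))
    (by
      refine Set.Finite.subset (Set.Finite.prod (Set.toFinite {(1 : ℚ), -1})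
        (Set.finite_univ (α := Bool))) ?_
      rintro _ ⟨g, hg, rfl⟩
      refine ⟨?_, Set.mem_univ _⟩
      have := det_sq_of_isometry hnd hs (g : V →ₗ[ℚ] V) hg.1
      exact mul_self_eq_one_iff.mp (by rwa [← sq]))
    (fun a b => b * a⁻¹ ∈ arithmeticGroup B L Z₀) (by
      intro a ha b hb hab
      obtain ⟨hdet, hsign⟩ := Prod.mk.inj hab
      have hm : b * a⁻¹ ∈ A := A.mul_mem hb (A.inv_mem ha)
      refine ⟨hm.1, ?_, hm.2.2.1, preservesSheet_of_neg hB hZ₀ hm.1 ?_⟩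
      · have : LinearEquiv.det a = LinearEquiv.det b := by
          ext; simpa using hdet
        rw [map_mul, map_inv, this, mul_inv_cancel]
      · have h1 : realForm B (actReal (b * a⁻¹) Z₀) Z₀ =
            realForm B (actReal a⁻¹ Z₀) (actReal b⁻¹ Z₀) := by
          rw [← realForm_actReal (A.inv_mem hb).1, ← actReal_mul, ← mul_assoc, inv_mul_cancel,
            one_mul]
        have ha1 : realForm B (actReal a⁻¹ Z₀) (actReal a⁻¹ Z₀) = -1 := by
          rw [realForm_actReal (A.inv_mem ha).1, hZ₀]
        have hb1 : realForm B (actReal b⁻¹ Z₀) (actReal b⁻¹ Z₀) = -1 := by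
          rw [realForm_actReal (A.inv_mem hb).1, hZ₀]
        rw [h1]
        by_cases hneg : realForm B (actReal a⁻¹ Z₀) Z₀ < 0
        · have hneg' : realForm B (actReal b⁻¹ Z₀) Z₀ < 0 := by simpa [hneg] using hsign
          exact hB.neg_of_neg_of_neg hZ₀ ha1 hb1 hneg hneg'
        · have hneg' : ¬ realForm B (actReal b⁻¹ Z₀) Z₀ < 0 := by simpa [hneg] using hsign
          have ha2 := hB.apply_ne_zero_of_timelike hZ₀ ha1
          have hb2 := hB.apply_ne_zero_of_timelike hZ₀ hb1
          have := hB.neg_of_neg_of_neg hZ₀ (Z₁ := -actReal a⁻¹ Z₀) (Z₂ := -actReal b⁻¹ Z₀)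
            (by simpa using ha1) (by simpa using hb1)
            (by simpa using lt_of_le_of_ne (not_lt.mp hneg) ha2.symm)
            (by simpa using lt_of_le_of_ne (not_lt.mp hneg') hb2.symm)
          simpa using this)
  -- cosets of `Γ`
  have hfin : Finite (arithmeticGroup B L Z₀ ⧸ Γ.subgroupOf (arithmeticGroup B L Z₀)) := by
    have : (Γ.subgroupOf (arithmeticGroup B L Z₀)).FiniteIndex := ⟨hΓ⟩
    infer_instance
  obtain ⟨T₂, hT₂, hT₂f, hT₂'⟩ := exists_finite_representatives
    ((Subtype.val : arithmeticGroup B L Z₀ → V ≃ₗ[ℚ] V) ⁻¹' A)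
    (fun g => (QuotientGroup.mk g⁻¹ : arithmeticGroup B L Z₀ ⧸ Γ.subgroupOf _))
    (Set.toFinite _) (fun a b => (b : V ≃ₗ[ℚ] V) * (a : V ≃ₗ[ℚ] V)⁻¹ ∈ Γ) (by
      intro a _ b _ hab
      rw [QuotientGroup.eq, inv_inv, Subgroup.mem_subgroupOf] at hab
      have := Γ.inv_mem hab
      simpa using this)
  refine ⟨Set.image2
    (fun (t₂ : arithmeticGroup B L Z₀) (t₁ : V ≃ₗ[ℚ] V) => (t₂ : V ≃ₗ[ℚ] V) * t₁) T₂ T₁, ?_,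
    hT₂f.image2 _ hT₁f,
    fun g hg => ?_⟩
  · rintro _ ⟨t₂, ht₂, t₁, ht₁, rfl⟩
    exact A.mul_mem (hT₂ ht₂) (hT₁ ht₁)
  · obtain ⟨t₁, ht₁, h1⟩ := hT₁' g hg
    have hgt : g * t₁⁻¹ ∈ A := A.mul_mem hg (A.inv_mem (hT₁ ht₁))
    obtain ⟨t₂, ht₂, h2⟩ := hT₂' ⟨g * t₁⁻¹, h1⟩ hgt
    refine ⟨_, ⟨t₂, ht₂, t₁, ht₁, rfl⟩, g * t₁⁻¹ * (t₂ : V ≃ₗ[ℚ] V)⁻¹,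
      ⟨h2, A.mul_mem hgt (A.inv_mem (hT₂ ht₂))⟩, ?_⟩
    simp [mul_assoc]

/-- Let `c`, `c'` be bases made of vectors of an integral lattice `M`, with the same Gram matrix `G`
and congruent modulo a multiple of `N det G`. Then the isometry carrying `c` to `c'` acts trivially
on `N⁻¹ M / M`, because the coordinates of lattice vectors in `c` have denominator `det G`. -/
lemma basis_equiv_sub_mem {W : Type*} [AddCommGroup W] [Module ℚ W] {B : LinearMap.BilinForm ℚ W}
    {M : Submodule ℤ W} (hint : ∀ x ∈ M, ∀ y ∈ M, ∃ z : ℤ, B x y = z) {m N : ℕ} (hN : N ≠ 0)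
    (c c' : Module.Basis (Fin m) ℚ W) (hcL : ∀ i, c i ∈ M)
    (G : Matrix (Fin m) (Fin m) ℤ) (hG : ∀ i j, B (c i) (c j) = G i j) {D : ℤ} (hD : G.det ∣ D)
    (hcong : ∀ i, ∃ y ∈ M, c' i - c i = ((N : ℤ) * D) • y) {w : W} (hw : N • w ∈ M) :
    c.equiv c' (Equiv.refl _) w - w ∈ M := by
  set g := c.equiv c' (Equiv.refl _)
  choose y hy hcy using hcong
  obtain ⟨q, hq⟩ := hD
  -- the coordinates of `det G • N • w` in the basis `c` are integers
  choose ω hω using fun j => hint _ hw _ (hcL j)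
  set a : Fin m → ℤ := Matrix.vecMul ω G.adjugate
  obtain ⟨r, hr⟩ : ∃ r : Fin m → ℚ, r = fun i => c.repr (N • w) i := ⟨_, rfl⟩
  have hrw : ∑ i, r i • c i = N • w := by rw [hr]; exact c.sum_repr (N • w)
  have ha : ∀ i, (G.det : ℚ) * r i = a i := by
    have h1 : Matrix.vecMul r (G.map (Int.castRingHom ℚ)) = fun j => (ω j : ℚ) := by
      funext j
      rw [← hω, ← hrw, LinearMap.map_sum₂]
      simp [hG, Matrix.vecMul, dotProduct]
    intro i
    have h2 := congrArg (fun x => Matrix.vecMul x (G.map (Int.castRingHom ℚ)).adjugate i) h1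
    simp only [Matrix.vecMul_vecMul, Matrix.mul_adjugate] at h2
    have h3 : (G.map (Int.castRingHom ℚ)).det = (G.det : ℚ) := by
      rw [← RingHom.mapMatrix_apply, ← RingHom.map_det]; rfl
    rw [h3, Matrix.vecMul_smul, Matrix.vecMul_one, Pi.smul_apply, smul_eq_mul] at h2
    rw [h2, ← RingHom.mapMatrix_apply, ← RingHom.map_adjugate]
    simp [a, Matrix.vecMul, dotProduct]
  have h4 : (N : ℚ) • (g w - w) = (N : ℚ) • ∑ i, (a i * q) • y i := by
    have h5 : (N : ℚ) • (g w - w) = ∑ i, r i • (c' i - c i) := by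
      rw [smul_sub, Nat.cast_smul_eq_nsmul, Nat.cast_smul_eq_nsmul, ← map_nsmul, ← hrw]
      simp only [map_sum, map_smul, g, Module.Basis.equiv_apply, Equiv.refl_apply,
        ← Finset.sum_sub_distrib, smul_sub]
    rw [h5, Finset.smul_sum]
    refine Finset.sum_congr rfl fun i _ => ?_
    rw [hcy, ← Int.cast_smul_eq_zsmul ℚ, ← Int.cast_smul_eq_zsmul ℚ, smul_smul, smul_smul, hq]
    congr 1
    simp only [Int.cast_mul, Int.cast_natCast]
    linear_combination ((N : ℚ) * q) * ha i
  have hN' : (N : ℚ) ≠ 0 := by exact_mod_cast hN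
  rw [smul_right_injective _ hN' h4]
  exact Submodule.sum_mem _ fun i _ => Submodule.smul_mem _ _ (hy i)

omit [FiniteDimensional ℚ V] in
/-- Two bases of `U^⊥` made of lattice vectors with the same Gram matrix `G`, congruent modulo a
multiple of `N det G`, differ by an isometry of `V` that fixes `U` and acts trivially on
`N⁻¹ L_{U^⊥} / L_{U^⊥}`. -/
lemma exists_fixing_of_gram_eq (hs : ∀ x y, B x y = B y x) {U : Submodule ℚ V}
    (hc : IsCompl U (perp B U)) {L : Submodule ℤ V} (hint : ∀ x ∈ L, ∀ y ∈ L, ∃ z : ℤ, B x y = z)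
    {m n : ℕ} {h : Fin n → V} {N : ℕ} (hN : N ≠ 0)
    (hNL : ∀ x ∈ L, ∀ u ∈ U, ∀ w : perp B U, u + w = x → N • w ∈ latticeIn L (perp B U))
    {h' : Fin n → perp B U} (hh' : ∀ s, h s = h' s)
    (hNh : ∀ s, N • h' s ∈ latticeIn L (perp B U))
    (c c' : Module.Basis (Fin m) ℚ (perp B U)) (hcL : ∀ i, c i ∈ latticeIn L (perp B U))
    (hcL' : ∀ i, c' i ∈ latticeIn L (perp B U))
    (hgram : ∀ i j, B (c i) (c j) = B (c' i) (c' j)) (G : Matrix (Fin m) (Fin m) ℤ)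
    (hG : ∀ i j, B (c i) (c j) = G i j) {D : ℤ} (hD : G.det ∣ D)
    (hcong : ∀ i, ∃ y ∈ latticeIn L (perp B U), c' i - c i = ((N : ℤ) * D) • y) :
    ∃ g ∈ fixingGroup B L U h, ∀ w : perp B U, g w = c.equiv c' (Equiv.refl _) w := by
  set e := Submodule.prodEquivOfIsCompl U (perp B U) hc with he
  have hintW : ∀ x ∈ latticeIn L (perp B U), ∀ y ∈ latticeIn L (perp B U),
      ∃ z : ℤ, (B.restrict (perp B U)) x y = z := fun x hx y hy => hint _ hx _ hy
  obtain ⟨gW, hgW⟩ : ∃ gW, gW = c.equiv c' (Equiv.refl _) := ⟨_, rfl⟩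
  have hgsymm : gW.symm = c'.equiv c (Equiv.refl _) := by
    rw [hgW, Module.Basis.equiv_symm]; rfl
  have key1 : ∀ w, N • w ∈ latticeIn L (perp B U) → gW w - w ∈ latticeIn L (perp B U) :=
    fun w hw => by
      rw [hgW]; exact basis_equiv_sub_mem hintW hN c c' hcL G hG hD hcong hw
  have key2 : ∀ w, N • w ∈ latticeIn L (perp B U) → gW.symm w - w ∈ latticeIn L (perp B U) :=
    fun w hw => by
      rw [hgsymm]
      refine basis_equiv_sub_mem hintW hN c' c hcL' G (fun i j => ?_) hD (fun i => ?_) hw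
      · rw [← hG, hgram]; rfl
      · obtain ⟨y, hy, h1⟩ := hcong i
        exact ⟨-y, Submodule.neg_mem _ hy, by rw [smul_neg, ← h1]; abel⟩
  set g : V ≃ₗ[ℚ] V := e.symm ≪≫ₗ (LinearEquiv.prodCongr (LinearEquiv.refl ℚ U) gW) ≪≫ₗ e with hg
  have hgadd : ∀ (u : U) (w : perp B U), g ((u : V) + w) = u + gW w := fun u w => by
    have h1 : e.symm ((u : V) + w) = (u, w) := by
      rw [LinearEquiv.symm_apply_eq]; simp [he]
    simp [hg, he]
  have hgs : ∀ (u : U) (w : perp B U), g.symm ((u : V) + w) = u + gW.symm w := fun u w => by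
    rw [LinearEquiv.symm_apply_eq, hgadd]; simp
  have hsplit : ∀ x : V, ∃ (u : U) (w : perp B U), x = u + w := fun x => by
    refine ⟨(e.symm x).1, (e.symm x).2, ?_⟩
    have := e.apply_symm_apply x
    simpa [he] using this.symm
  have hgw : ∀ w : perp B U, g w = gW w := fun w => by simpa using hgadd 0 w
  have hgu : ∀ u : U, g u = u := fun u => by simpa using hgadd u 0
  have hiso : ∀ w w' : perp B U, B (gW w) (gW w') = B w w' := by
    have h1 : (B.restrict (perp B U)).comp gW.toLinearMap gW.toLinearMap =
        B.restrict (perp B U) := by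
      refine LinearMap.BilinForm.ext_basis c fun i j => ?_
      simp [hgW, hgram]
    intro w w'
    exact LinearMap.congr_fun (LinearMap.congr_fun h1 w) w'
  have hfix : ∀ x ∈ L, g x ∈ L := fun x hx => by
    obtain ⟨u, w, rfl⟩ := hsplit x
    have h1 := key1 w (hNL _ hx u u.2 w rfl)
    have h2 : g ((u : V) + w) = (u + w) + ((gW w - w : perp B U) : V) := by
      rw [hgadd]; push_cast; abel
    rw [h2]
    exact L.add_mem hx h1
  have hfix' : ∀ x ∈ L, g.symm x ∈ L := fun x hx => by
    obtain ⟨u, w, rfl⟩ := hsplit x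
    have h1 := key2 w (hNL _ hx u u.2 w rfl)
    have h2 : g.symm ((u : V) + w) = (u + w) + ((gW.symm w - w : perp B U) : V) := by
      rw [hgs]; push_cast; abel
    rw [h2]
    exact L.add_mem hx h1
  refine ⟨g, ⟨fun x y => ?_, fun x hx => hgu ⟨x, hx⟩, fun x => ⟨fun hx => ?_, hfix x⟩, fun s => ?_⟩,
    fun w => by rw [hgw, hgW]⟩
  · obtain ⟨u, w, rfl⟩ := hsplit x
    obtain ⟨u', w', rfl⟩ := hsplit y
    have hp : ∀ (u : U) (w : perp B U), B (w : V) u = 0 := fun u w => by rw [hs, apply_perp]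
    rw [hgadd, hgadd]
    simp only [map_add, LinearMap.add_apply, apply_perp, hp, hiso]
  · simpa using hfix' _ hx
  · rw [hh', hgw]
    exact key1 _ (hNh s)

lemma exists_smul_perp_mem (hs : ∀ x y, B x y = B y x) {U : Submodule ℚ V}
    (hU : ∀ x ∈ U, x ≠ 0 → 0 < B x x) {L : Submodule ℤ V} (hL : IsFullLattice L) {n : ℕ}
    (h' : Fin n → perp B U) :
    ∃ N : ℕ, N ≠ 0 ∧ (∀ x ∈ L, ∀ u ∈ U, ∀ w : perp B U, u + w = x →
      N • w ∈ latticeIn L (perp B U)) ∧ ∀ s, N • h' s ∈ latticeIn L (perp B U) := by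
  have hc := isCompl_perp hs hU
  set e := Submodule.prodEquivOfIsCompl U (perp B U) hc with he
  obtain ⟨bL, β, hβ⟩ := hL.exists_basis
  obtain ⟨N, hN, h1⟩ := (hL.latticeIn (perp B U)).exists_common_smul_mem
    (Sum.elim (fun i => (e.symm (β i)).2) h')
  refine ⟨N, hN, fun x hx u hu w huw => ?_, fun s => h1 (Sum.inr s)⟩
  have h2 : w = ∑ i, bL.repr ⟨x, hx⟩ i • (e.symm (β i)).2 := by
    have h3 : e.symm x = (⟨u, hu⟩, w) := by
      rw [LinearEquiv.symm_apply_eq]; simp [he, huw]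
    have h4 : x = ∑ i, bL.repr ⟨x, hx⟩ i • β i := by
      have := congrArg (Subtype.val : L → V) (bL.sum_repr ⟨x, hx⟩)
      rw [Submodule.coe_sum] at this
      simpa [hβ] using this.symm
    have h5 : w = (e.symm x).2 := by rw [h3]
    rw [h5]
    conv_lhs => rw [h4]
    simp [Prod.snd_sum]
  rw [h2, Finset.smul_sum]
  refine Submodule.sum_mem _ fun i _ => ?_
  rw [smul_comm]
  exact Submodule.smul_mem _ _ (h1 (Sum.inl i))

omit [FiniteDimensional ℚ V] in
lemma map_mem_perp {U : Submodule ℚ V} {L : Submodule ℤ V} {n : ℕ} {h : Fin n → V}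
    {g : V ≃ₗ[ℚ] V} (hg : g ∈ fixingGroup B L U h) {w : V} (hw : w ∈ perp B U) :
    g w ∈ perp B U := by
  rw [LinearMap.BilinForm.mem_orthogonal_iff] at hw ⊢
  intro u hu
  rw [← hg.2.1 u hu, hg.1]
  exact hw u hu

/-- The linearly independent families of vectors of `L_{U^⊥}` together with a further vector,
all whose inner products are bounded by `R`. -/
def boundedFrames (B : LinearMap.BilinForm ℚ V) (L : Submodule ℤ V) (U : Submodule ℚ V) (m R : ℕ) :
    Set ((Fin m → perp B U) × perp B U) :=
  {x | (∀ i, x.1 i ∈ latticeIn L (perp B U)) ∧ x.2 ∈ latticeIn L (perp B U) ∧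
    LinearIndependent ℚ x.1 ∧ (∀ i j, |B (x.1 i) (x.1 j)| ≤ R) ∧ ∀ i, |B (x.1 i) x.2| ≤ R}

/-- The isometries of `L` that fix `U` act on the bases of `U^⊥` in `L` with bounded Gram matrix
with finitely many orbits. -/
lemma exists_finite_orbits (hs : ∀ x y, B x y = B y x) (hB : IsHyperbolic (realForm B))
    {Z₀ : ℝ ⊗[ℚ] V} (hZ₀ : realForm B Z₀ Z₀ = -1) {L : Submodule ℤ V} (hL : IsIntegralLattice B L)
    {Γ : Subgroup (V ≃ₗ[ℚ] V)} (hΓ : Γ.relIndex (arithmeticGroup B L Z₀) ≠ 0)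
    {U : Submodule ℚ V} (hU : ∀ x ∈ U, x ≠ 0 → 0 < B x x) {n : ℕ} (h' : Fin n → perp B U)
    (m R : ℕ) (hm : Module.finrank ℚ (perp B U) = m) :
    ∃ T ⊆ boundedFrames B L U m R, T.Finite ∧ ∀ x ∈ boundedFrames B L U m R, ∃ t ∈ T,
      ∃ γ ∈ Γ ⊓ fixingGroup B L U (fun s => (h' s : V)),
        (∀ i, γ (t.1 i) = x.1 i) ∧ γ t.2 = x.2 := by
  classical
  set A := fixingGroup B L U (fun s => (h' s : V)) with hA
  set S := boundedFrames B L U m R with hS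
  have hc := isCompl_perp hs hU
  have hint : ∀ x ∈ L, ∀ y ∈ L, ∃ z : ℤ, B x y = z := fun x hx y hy => by
    obtain ⟨z, hz⟩ := Submodule.mem_one.mp (hL.integral hx y hy)
    exact ⟨z, by simpa using hz.symm⟩
  have hndW : ∀ w : perp B U, (∀ w' : perp B U, B w w' = 0) → w = 0 := fun w hw => by
    have : (w : V) = 0 := eq_zero_of_forall_apply hB hZ₀ fun y => by
      obtain ⟨u, hu, w', hw', rfl⟩ := Submodule.mem_sup.mp
        (hc.sup_eq_top ▸ Submodule.mem_top : y ∈ U ⊔ perp B U)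
      rw [map_add, hs _ u, apply_perp ⟨u, hu⟩, zero_add]
      exact hw ⟨w', hw'⟩
    exact Subtype.ext this
  obtain ⟨N, hN, hNL, hNh⟩ := exists_smul_perp_mem hs hU hL.isFullLattice h'
  obtain ⟨bM, β, hβ⟩ := (hL.isFullLattice.latticeIn (perp B U)).exists_basis
  -- a common multiple of the possible Gram determinants
  set D : ℕ := (Nat.factorial (Fintype.card (Fin m)) * R ^ Fintype.card (Fin m)).factorial with hD
  have hND : NeZero (N * D) := ⟨mul_ne_zero hN (Nat.factorial_ne_zero _)⟩
  have hsub : ∀ x ∈ S, ∃ z : Fin m → Fin m → ℤ, ∀ i j, B (x.1 i) (x.1 j) = z i j ∧ |z i j| ≤ R := by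
    intro x hx
    have h0 : ∀ i j, ∃ z : ℤ, B (x.1 i) (x.1 j) = z := fun i j => hint _ (hx.1 i) _ (hx.1 j)
    choose z hz using h0
    refine ⟨z, fun i j => ⟨hz i j, ?_⟩⟩
    have := hx.2.2.2.1 i j
    rw [hz] at this
    exact_mod_cast this
  have hsub' : ∀ x ∈ S, ∀ i, ∃ z : ℤ, B (x.1 i) x.2 = z ∧ |z| ≤ R := by
    intro x hx i
    obtain ⟨z, hz⟩ : ∃ z : ℤ, B (x.1 i) x.2 = z := hint _ (hx.1 i) _ hx.2.1
    refine ⟨z, hz, ?_⟩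
    have := hx.2.2.2.2 i
    rw [hz] at this
    exact_mod_cast this
  set cl : (Fin m → perp B U) × perp B U → (Fin m → Fin m → ℤ) × (Fin m → ℤ) ×
      (Fin m → Fin (Module.finrank ℚ (perp B U)) → ZMod (N * D)) :=
    fun x => (fun i j => ⌊B (x.1 i) (x.1 j)⌋, fun i => ⌊B (x.1 i) x.2⌋,
      fun i k => ((⌊β.repr (x.1 i) k⌋ : ℤ) : ZMod (N * D)))
  obtain ⟨T₁, hT₁, hT₁f, hT₁'⟩ := exists_finite_representatives S cl
    (by
      refine Set.Finite.subset (Set.Finite.prod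
        (Set.Finite.pi' fun _ : Fin m => Set.Finite.pi' fun _ : Fin m => Set.finite_Icc (-R : ℤ) R)
        (Set.Finite.prod (Set.Finite.pi' fun _ : Fin m => Set.finite_Icc (-R : ℤ) R)
          (Set.toFinite Set.univ))) ?_
      rintro _ ⟨x, hx, rfl⟩
      obtain ⟨z, hz⟩ := hsub x hx
      refine ⟨fun i j => ?_, fun i => ?_, Set.mem_univ _⟩
      · simp only [cl, (hz i j).1, Int.floor_intCast]
        exact abs_le.mp (hz i j).2
      · obtain ⟨y, hy, hy'⟩ := hsub' x hx i
        simp only [cl, hy, Int.floor_intCast]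
        exact abs_le.mp hy')
    (fun x y => ∃ g ∈ A, (∀ i, g (x.1 i) = y.1 i) ∧ g x.2 = y.2) (by
      intro x hx y hy hxy
      obtain ⟨h1, h2⟩ := Prod.mk.inj hxy
      obtain ⟨h2, h3⟩ := Prod.mk.inj h2
      obtain ⟨G, hG⟩ := hsub x hx
      have hgram : ∀ i j, B (x.1 i) (x.1 j) = B (y.1 i) (y.1 j) := fun i j => by
        obtain ⟨G', hG'⟩ := hsub y hy
        have := congrFun (congrFun h1 i) j
        simp only [(hG i j).1, (hG' i j).1, Int.floor_intCast] at this
        rw [(hG i j).1, (hG' i j).1, this]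
      have hgram' : ∀ i, B (x.1 i) x.2 = B (y.1 i) y.2 := fun i => by
        obtain ⟨z, hz, _⟩ := hsub' x hx i
        obtain ⟨z', hz', _⟩ := hsub' y hy i
        have := congrFun h2 i
        simp only [hz, hz', Int.floor_intCast] at this
        rw [hz, hz', this]
      have hcard : Fintype.card (Fin m) = Module.finrank ℚ (perp B U) := by simp [hm]
      set c := basisOfLinearIndependentOfCardEqFinrank' x.1 hx.2.2.1 hcard with hc1
      set c' := basisOfLinearIndependentOfCardEqFinrank' y.1 hy.2.2.1 hcard with hc2
      have hcx : ∀ i, c i = x.1 i := fun i => by simp [hc1]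
      have hcy : ∀ i, c' i = y.1 i := fun i => by simp [hc2]
      have hdet0 : (Matrix.of G).det ≠ 0 := by
        have h4 : (LinearMap.BilinForm.toMatrix c (B.restrict (perp B U))).det ≠ 0 := by
          rw [← LinearMap.BilinForm.nondegenerate_iff_det_ne_zero]
          refine ⟨fun w hw => hndW w hw, fun w hw => hndW w fun w' => ?_⟩
          rw [hs]; exact hw w'
        have h5 : LinearMap.BilinForm.toMatrix c (B.restrict (perp B U)) =
            (Int.castRingHom ℚ).mapMatrix (Matrix.of G) := by
          ext i j
          simp only [LinearMap.BilinForm.toMatrix_apply, hcx]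
          exact (hG i j).1
        rw [h5, ← RingHom.map_det] at h4
        exact fun h => h4 (by rw [h, map_zero])
      have hdvd : (Matrix.of G).det ∣ (D : ℤ) := by
        rw [← Int.natAbs_dvd_natAbs, Int.natAbs_natCast]
        refine Nat.dvd_factorial (Int.natAbs_pos.mpr hdet0) ?_
        have := Matrix.det_le (A := Matrix.of G) (abv := AbsoluteValue.abs) (x := (R : ℤ))
          fun i j => (hG i j).2
        rw [AbsoluteValue.abs_apply, Int.abs_eq_natAbs, nsmul_eq_mul] at this
        exact_mod_cast this
      have hrepr : ∀ w (hw : w ∈ latticeIn L (perp B U)) k, β.repr w k = bM.repr ⟨w, hw⟩ k := by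
        intro w hw k
        have h5 : w = ∑ k, (bM.repr ⟨w, hw⟩ k : ℚ) • β k := by
          have := congrArg (Subtype.val) (bM.sum_repr ⟨w, hw⟩)
          rw [Submodule.coe_sum] at this
          simpa [hβ, Int.cast_smul_eq_zsmul] using this.symm
        conv_lhs => rw [h5]
        rw [Module.Basis.repr_sum_self]
      obtain ⟨g, hgA, hg⟩ := exists_fixing_of_gram_eq hs hc hint hN hNL (h := fun s => (h' s : V))
        (fun s => rfl) hNh c c' (fun i => hcx i ▸ hx.1 i) (fun i => hcy i ▸ hy.1 i)
        (fun i j => by rw [hcx, hcx, hcy, hcy, hgram]) (Matrix.of G)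
        (fun i j => by rw [hcx, hcx]; exact (hG i j).1) hdvd (fun i => by
          have h6 : ∀ k, ((N : ℤ) * D) ∣
              bM.repr ⟨_, hy.1 i⟩ k - bM.repr ⟨_, hx.1 i⟩ k := fun k => by
            have := congrFun (congrFun h3 i) k
            simp only [hrepr _ (hx.1 i), hrepr _ (hy.1 i), Int.floor_intCast] at this
            exact_mod_cast (ZMod.intCast_eq_intCast_iff_dvd_sub _ _ _).mp this
          choose q hq using h6
          refine ⟨∑ k, q k • (bM k : perp B U), Submodule.sum_mem _ fun k _ =>
            Submodule.smul_mem _ _ (bM k).2, ?_⟩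
          have h7 := congrArg Subtype.val (bM.sum_repr (⟨_, hy.1 i⟩ - ⟨_, hx.1 i⟩))
          rw [hcx, hcy, Finset.smul_sum]
          refine Eq.trans ?_ (h7.symm.trans ?_)
          · simp
          · simp only [Submodule.coe_sum]
            refine Finset.sum_congr rfl fun k _ => ?_
            rw [map_sub, Finsupp.sub_apply, hq, smul_smul]; rfl)
      have hgc : ∀ i, g (x.1 i) = y.1 i := fun i => by
        rw [hg, ← hcx, Module.Basis.equiv_apply, Equiv.refl_apply, hcy]
      refine ⟨g, hgA, hgc, ?_⟩
      have h8 : c.equiv c' (Equiv.refl _) x.2 - y.2 = 0 := by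
        refine hndW _ fun w' => ?_
        have h9 : (B.restrict (perp B U)) (c.equiv c' (Equiv.refl _) x.2 - y.2) = 0 := by
          refine c'.ext fun i => ?_
          rw [map_sub, LinearMap.sub_apply, LinearMap.zero_apply, sub_eq_zero]
          change B (c.equiv c' (Equiv.refl _) x.2 : perp B U) (c' i) = B y.2 (c' i)
          rw [← hg, hcy, hs, ← hgc, hgA.1, hgc, hgram', hs]
        exact LinearMap.congr_fun h9 w'
      rw [hg, sub_eq_zero.mp h8])
  obtain ⟨T₂, hT₂, hT₂f, hT₂'⟩ := exists_finite_cosets hs hB hZ₀ hΓ U (fun s => (h' s : V))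
  -- the translate of a frame by an isometry
  have hmove : ∀ t ∈ A, ∀ x ∈ S, ∃ y ∈ S, (∀ i, t (x.1 i) = y.1 i) ∧ t x.2 = y.2 := by
    intro t ht x hx
    refine ⟨(fun i => ⟨t (x.1 i), map_mem_perp ht (x.1 i).2⟩, ⟨t x.2, map_mem_perp ht x.2.2⟩),
      ⟨fun i => (ht.2.2.1 _).mpr (hx.1 i), (ht.2.2.1 _).mpr hx.2.1, ?_, fun i j => ?_, fun i => ?_⟩,
      fun i => rfl, rfl⟩
    · refine LinearIndependent.of_comp (perp B U).subtype ?_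
      have := (hx.2.2.1.map' (perp B U).subtype (Submodule.ker_subtype _)).map'
        (t : V →ₗ[ℚ] V) (LinearEquiv.ker t)
      exact this
    · rw [ht.1]; exact hx.2.2.2.1 i j
    · rw [ht.1]; exact hx.2.2.2.2 i
  choose! f hfS hf1 hf2 using hmove
  refine ⟨Set.image2 f T₂ T₁, ?_, hT₂f.image2 _ hT₁f, fun x hx => ?_⟩
  · rintro _ ⟨t, ht, x, hx, rfl⟩
    exact hfS _ (hT₂ ht) _ (hT₁ hx)
  · obtain ⟨y, hy, g, hg, hgi, hge⟩ := hT₁' x hx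
    obtain ⟨t, ht, γ, hγ, rfl⟩ := hT₂' g hg
    refine ⟨_, ⟨t, ht, y, hy, rfl⟩, γ, hγ, fun i => ?_, ?_⟩
    · rw [← hf1 _ (hT₂ ht) _ (hT₁ hy), ← hgi]; rfl
    · rw [← hf2 _ (hT₂ ht) _ (hT₁ hy), ← hge]; rfl

end Isometries

/-! ### Odd theta functions near the cusp -/

section OddKernel

/-- The theta function of an odd function decays exponentially near `0`: by Poisson summation its
dual series has no constant term. -/
lemma exists_oddKernel_le (x₀ : ℝ) (hx₀ : 0 < x₀) : ∃ C : ℝ, 0 < C ∧ ∀ (a x : ℝ), 0 < x → x ≤ x₀ →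
    |HurwitzZeta.oddKernel a x| ≤ C * Real.exp (-(1 / 2) * (1 / x)) := by
  obtain ⟨C₁, hC₁, H⟩ := exists_pow_mul_exp_le 2
  have hsum : Summable fun k : ℤ => |(k : ℝ)| * Real.exp (-(k : ℝ) ^ 2 * (1 / x₀)) := by
    refine (HurwitzZeta.hasSum_int_sinKernel 0 (t := 1 / x₀ / Real.pi)
      (by positivity)).summable.norm.congr fun k => ?_
    simp only [norm_mul, norm_neg, Complex.norm_I, one_mul, Complex.norm_intCast,
      Complex.ofReal_zero,
      mul_zero, zero_mul, Complex.exp_zero, mul_one, Complex.norm_real, Real.norm_eq_abs,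
      Real.abs_exp]
    congr 2
    field_simp
  set C₂ := ∑' k : ℤ, |(k : ℝ)| * Real.exp (-(k : ℝ) ^ 2 * (1 / x₀))
  have hC₂ : 0 ≤ C₂ := tsum_nonneg fun k => by positivity
  refine ⟨C₁ * (C₂ + 1), by positivity, fun a x hx hxx => ?_⟩
  have ht : 0 < 1 / x := by positivity
  have ht0 : 1 / x₀ ≤ 1 / x := one_div_le_one_div_of_le hx hxx
  have h1 : |HurwitzZeta.sinKernel a (1 / x)| ≤ C₂ * Real.exp (-(1 / x)) := by
    have hs := HurwitzZeta.hasSum_int_sinKernel a ht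
    rw [← Real.norm_eq_abs, ← Complex.norm_real, ← hs.tsum_eq]
    refine tsum_of_norm_bounded (hsum.hasSum.mul_right _) fun k => ?_
    rw [norm_mul, norm_mul, norm_mul, norm_neg, Complex.norm_I, one_mul, Complex.norm_intCast,
      show (2 * Real.pi * Complex.I * a * k : ℂ) = ((2 * Real.pi * a * k : ℝ) : ℂ) * Complex.I by
        push_cast; ring, Complex.norm_exp_ofReal_mul_I, mul_one, Complex.norm_real,
      Real.norm_eq_abs, Real.abs_exp]
    rw [mul_assoc |(k : ℝ)|, ← Real.exp_add]
    rcases eq_or_ne k 0 with rfl | hk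
    · simp
    refine mul_le_mul_of_nonneg_left (Real.exp_le_exp.mpr ?_) (abs_nonneg _)
    have hk2 : (1 : ℝ) ≤ (k : ℝ) ^ 2 := by
      have : (1 : ℤ) ≤ k ^ 2 := by have := sq_pos_of_ne_zero hk; omega
      exact_mod_cast this
    have hp := Real.pi_gt_three
    nlinarith [mul_le_mul_of_nonneg_left ht0 (sq_nonneg (k : ℝ)),
      mul_le_mul_of_nonneg_right hk2 ht.le,
      mul_nonneg (mul_nonneg (by linarith : 0 ≤ Real.pi - 2) (sq_nonneg (k : ℝ))) ht.le]
  have h2 : 1 / x ^ (3 / 2 : ℝ) ≤ (1 + 1 / x) ^ 2 := by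
    rw [one_div, ← Real.inv_rpow hx.le, ← one_div]
    calc (1 / x) ^ (3 / 2 : ℝ) ≤ (1 + 1 / x) ^ (3 / 2 : ℝ) :=
          Real.rpow_le_rpow ht.le (by linarith) (by norm_num)
      _ ≤ (1 + 1 / x) ^ (2 : ℝ) :=
          Real.rpow_le_rpow_of_exponent_le (by linarith) (by norm_num)
      _ = (1 + 1 / x) ^ 2 := by norm_cast
  rw [HurwitzZeta.oddKernel_functional_equation, abs_mul, abs_of_pos (by positivity)]
  have h3 := H 1 one_pos le_rfl (1 / x) ht.le
  calc _ ≤ (1 + 1 / x) ^ 2 * (C₂ * Real.exp (-(1 / x))) :=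
        mul_le_mul h2 h1 (abs_nonneg _) (by positivity)
    _ = C₂ * ((1 + 1 / x) ^ 2 * Real.exp (-1 * (1 / x))) := by rw [neg_one_mul]; ring
    _ ≤ C₂ * (C₁ * Real.exp (-(1 / 2) * (1 / x))) :=
        mul_le_mul_of_nonneg_left (by simpa using h3) hC₂
    _ ≤ _ := by
        have := mul_pos hC₁ (Real.exp_pos (-(1 / 2) * (1 / x)))
        nlinarith

/-- A Gaussian sum whose terms are odd functions of one of the summation variables is
exponentially small when the Gaussian is flat in that variable. -/
lemma exists_norm_tsum_odd_le (J : Type*) [Fintype J] (N : ℕ) (x₀ : ℝ) (hx₀ : 0 < x₀) :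
    ∃ C : ℝ, 0 < C ∧ ∃ K : ℕ, ∀ (ε A x : ℝ) (h : J → ℝ) (g : (J → ℤ) → ℂ) (θ : (J → ℤ) → ℝ),
      0 < ε → ε ≤ 1 → 0 ≤ A → 0 < x → x ≤ x₀ →
      (∀ k, ‖g k‖ ≤ A * ((1 + shiftSq h k) ^ N * Real.exp (-ε * shiftSq h k))) →
      (Summable fun y : ℤ × (J → ℤ) => g y.2 *
        (((y.1 + θ y.2) * Real.exp (-Real.pi * (y.1 + θ y.2) ^ 2 * x) : ℝ) : ℂ)) →
      ‖∑' y : ℤ × (J → ℤ), g y.2 *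
        (((y.1 + θ y.2) * Real.exp (-Real.pi * (y.1 + θ y.2) ^ 2 * x) : ℝ) : ℂ)‖ ≤
        A * C * ε⁻¹ ^ K * Real.exp (-(1 / 2) * (1 / x)) := by
  obtain ⟨C₁, hC₁, H₁⟩ := exists_oddKernel_le x₀ hx₀
  obtain ⟨C₂, hC₂, K, H₂⟩ := exists_sum_pow_mul_exp_le J N
  refine ⟨C₂ * C₁, by positivity, K, fun ε A x h g θ hε hε1 hA hx hxx hg hs => ?_⟩
  have hs' := (Equiv.prodComm (J → ℤ) ℤ).summable_iff.mpr hs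
  rw [← (Equiv.prodComm (J → ℤ) ℤ).tsum_eq]
  rw [Function.comp_def] at hs'
  rw [Summable.tsum_prod hs']
  simp only [Equiv.prodComm_apply, Prod.fst_swap, Prod.snd_swap]
  have h1 : ∀ k : J → ℤ, ∑' t : ℤ, g k *
      (((t + θ k) * Real.exp (-Real.pi * (t + θ k) ^ 2 * x) : ℝ) : ℂ) =
        g k * (HurwitzZeta.oddKernel (θ k) x : ℝ) := fun k => by
    rw [tsum_mul_left,
      (Complex.hasSum_ofReal.mpr (HurwitzZeta.hasSum_int_oddKernel (θ k) hx)).tsum_eq]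
  simp only [h1]
  have h2 : ∀ k : J → ℤ, ‖g k * (HurwitzZeta.oddKernel (θ k) x : ℝ)‖ ≤
      (A * (C₁ * Real.exp (-(1 / 2) * (1 / x)))) *
        ((1 + shiftSq h k) ^ N * Real.exp (-ε * shiftSq h k)) := fun k => by
    rw [norm_mul, Complex.norm_real, Real.norm_eq_abs]
    calc _ ≤ (A * ((1 + shiftSq h k) ^ N * Real.exp (-ε * shiftSq h k))) *
          (C₁ * Real.exp (-(1 / 2) * (1 / x))) :=
          mul_le_mul (hg k) (H₁ _ _ hx hxx) (abs_nonneg _) ((norm_nonneg _).trans (hg k))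
      _ = _ := by ring
  refine (tsum_of_norm_bounded ((summable_pow_mul_exp N hε h).hasSum.mul_left _) h2).trans ?_
  have h3 : ∑' k : J → ℤ, (1 + shiftSq h k) ^ N * Real.exp (-ε * shiftSq h k) ≤ C₂ * ε⁻¹ ^ K :=
    (summable_pow_mul_exp N hε h).tsum_le_of_sum_le fun s => H₂ ε hε hε1 h s
  calc _ ≤ (A * (C₁ * Real.exp (-(1 / 2) * (1 / x)))) * (C₂ * ε⁻¹ ^ K) :=
        mul_le_mul_of_nonneg_left h3 (by positivity)
    _ = _ := by ring

end OddKernel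

/-! ### The volume functional and its expansion at an isotropic vector -/

section Pluecker

variable {E : Type*} [AddCommGroup E] [Module ℝ E] {n : ℕ}

/-- The determinant of the inner products of `n + 1` vectors with the vectors of a frame `g`. -/
noncomputable def frameDet (b : LinearMap.BilinForm ℝ E) (g : Fin (n + 1) → E)
    (w : Fin (n + 1) → E) : ℝ :=
  (Matrix.of fun r k => b (w r) (g k)).det

/-- The relation between `n + 2` vectors of a space of dimension `n + 1`. -/
lemma sum_apply_mul_frameDet (b : LinearMap.BilinForm ℝ E) (g : Module.Basis (Fin (n + 1)) ℝ E)
    (w : Fin (n + 2) → E) (z : E) :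
    ∑ i : Fin (n + 2),
      (-1) ^ (i : ℕ) * b (w i) z * frameDet b g (fun r => w (i.succAbove r)) = 0 := by
  set M : Matrix (Fin (n + 2)) (Fin (n + 2)) ℝ :=
    Matrix.of fun r c => Fin.cons (α := fun _ => ℝ) (b (w r) z) (fun k => b (w r) (g k)) c
  have h1 : M.det = 0 := by
    rw [← Matrix.exists_mulVec_eq_zero_iff]
    refine ⟨Fin.cons (α := fun _ => ℝ) 1 (fun k => -g.repr z k), fun h => ?_, ?_⟩
    · have := congrFun h 0
      simp at this
    · funext r
      rw [Matrix.mulVec, dotProduct, Fin.sum_univ_succ]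
      simp only [M, Matrix.of_apply, Fin.cons_zero, Fin.cons_succ, mul_one, Pi.zero_apply]
      have hz : b (w r) z = ∑ k, g.repr z k * b (w r) (g k) := by
        conv_lhs => rw [← g.sum_repr z]
        simp only [map_sum, map_smul, smul_eq_mul]
      rw [hz, ← Finset.sum_add_distrib]
      exact Finset.sum_eq_zero fun k _ => by ring
  rw [Matrix.det_succ_column_zero] at h1
  exact h1

variable {b : LinearMap.BilinForm ℝ E} (hs : ∀ x y, b x y = b y x)
  (g : Module.Basis (Fin (n + 1)) ℝ E) {e : E} {X : Fin n → E} (hX : ∀ s, b (X s) e = 0)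
include hX hs

/-- The minors attached to an isotropic vector `e` and a tuple `X` orthogonal to it. -/
noncomputable def cuspMinor (b : LinearMap.BilinForm ℝ E) (g : Fin (n + 1) → E) (e d : E)
    (X : Fin n → E) (s : Fin n) : ℝ :=
  (-1) ^ ((s.succ.succ : Fin (n + 2)) : ℕ) * frameDet b g
    (fun r => (Fin.cons e (Fin.cons d X : Fin (n + 1) → E) : Fin (n + 2) → E)
      ((s.succ.succ : Fin (n + 2)).succAbove r))

/-- For `X` orthogonal to the isotropic vector `e`, the volume of `(Z, X)` is a combination of the
`(x_s, Z)` with coefficients that do not change when multiples of `e` are added to the `x_s`. -/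
lemma frameDet_eq_sum_cuspMinor (he : b e e = 0) {d : E} (hd : b d e ≠ 0) (Z : E) :
    frameDet b g (Fin.cons Z X) =
      -(b d e)⁻¹ * ∑ s, b (X s) Z * cuspMinor b g e d X s := by
  have e0 : ∀ (p q : E), (fun r => (Fin.cons p (Fin.cons q X : Fin (n + 1) → E) : Fin (n + 2) → E)
      ((0 : Fin (n + 2)).succAbove r)) = (Fin.cons q X : Fin (n + 1) → E) := fun p q => by
    funext r; simp
  have e1 : ∀ (p q : E), (fun r => (Fin.cons p (Fin.cons q X : Fin (n + 1) → E) : Fin (n + 2) → E)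
      ((1 : Fin (n + 2)).succAbove r)) = (Fin.cons p X : Fin (n + 1) → E) := fun p q => by
    funext r
    refine Fin.cases ?_ (fun i => ?_) r
    · simp
    · rw [Fin.one_succAbove_succ]; simp
  -- expansion with two vectors added in front of `X`
  have key : ∀ p q z : E,
      b p z * frameDet b g (Fin.cons q X) - b q z * frameDet b g (Fin.cons p X) +
      ∑ s, b (X s) z * cuspMinor b g p q X s = 0 := fun p q z => by
    have h := sum_apply_mul_frameDet b g (Fin.cons p (Fin.cons q X : Fin (n + 1) → E)) z
    rw [Fin.sum_univ_succ, Fin.sum_univ_succ] at h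
    rw [e0, show (Fin.succ (0 : Fin (n + 1))) = (1 : Fin (n + 2)) from rfl, e1] at h
    simp only [Fin.cons_zero, Fin.cons_succ, Fin.val_zero, pow_zero, one_mul] at h
    have h1 : (Fin.cons p (Fin.cons q X : Fin (n + 1) → E) : Fin (n + 2) → E) 1 = q := by
      rw [show (1 : Fin (n + 2)) = Fin.succ 0 from rfl, Fin.cons_succ, Fin.cons_zero]
    rw [h1, Fin.val_one, pow_one, ← add_assoc] at h
    rw [← h]
    congr 1
    · ring
    · refine Finset.sum_congr rfl fun s _ => ?_
      rw [cuspMinor]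
      ring
  have h1 := key Z e e
  have h2 := key Z d e
  have h3 := key e d Z
  simp only [hX, zero_mul, Finset.sum_const_zero, add_zero, he, sub_zero] at h1 h2
  rcases eq_or_ne (b Z e) 0 with h0 | h0
  · -- then `Z` is orthogonal to `e` as well
    have h4 : frameDet b g (Fin.cons Z X) = 0 := by
      rw [h0, zero_mul, zero_sub, neg_eq_zero] at h2
      exact (mul_eq_zero.mp h2).resolve_left hd
    have h5 := key e d Z
    rw [hs e Z, h0, zero_mul, zero_sub] at h5
    have h6 : frameDet b g (Fin.cons e X) = 0 := by
      have := key e d e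
      simp only [hX, zero_mul, Finset.sum_const_zero, add_zero, he, zero_sub, neg_eq_zero] at this
      exact (mul_eq_zero.mp this).resolve_left hd
    rw [h6, mul_zero, neg_zero, zero_add] at h5
    rw [h4, h5, mul_zero]
  · have h4 : frameDet b g (Fin.cons e X) = 0 := (mul_eq_zero.mp h1).resolve_left h0
    rw [h4, mul_zero, sub_zero, hs e Z] at h3
    rw [neg_mul, eq_neg_iff_add_eq_zero, eq_comm]
    field_simp
    linear_combination -h3 + h2

omit hX hs in
lemma cuspMinor_add_smul (g : Fin (n + 1) → E) (d : E) (a : Fin n → ℝ) (s : Fin n) :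
    cuspMinor b g e d (fun s => X s + a s • e) s = cuspMinor b g e d X s := by
  rw [cuspMinor, cuspMinor]
  congr 1
  set c : Fin (n + 2) → ℝ := Fin.cons 0 (Fin.cons 0 a : Fin (n + 1) → ℝ) with hc
  have hw : ∀ i : Fin (n + 2),
      (Fin.cons e (Fin.cons d (fun s => X s + a s • e) : Fin (n + 1) → E) : Fin (n + 2) → E) i =
      (Fin.cons e (Fin.cons d X : Fin (n + 1) → E) : Fin (n + 2) → E) i + c i • e := fun i => by
    refine Fin.cases ?_ (fun i => Fin.cases ?_ (fun i => ?_) i) i <;> simp [hc]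
  have h0 : (s.succ.succ : Fin (n + 2)).succAbove 0 = 0 := Fin.succAbove_ne_zero_zero (by simp)
  refine Matrix.det_eq_of_forall_row_eq_smul_add_const
    (fun r => c ((s.succ.succ : Fin (n + 2)).succAbove r)) 0 ?_ fun i j => ?_
  · simp [h0, hc]
  · simp only [Matrix.of_apply, hw, h0, Fin.cons_zero]
    simp

end Pluecker

/-! ### The theta kernel near a cusp -/

section Bounds

variable {E : Type*} [AddCommGroup E] [Module ℝ E] {n r : ℕ}

/-- The `n`-tuple of vectors with coordinates `a` in the family `β`. -/
def tupleOf (β : Fin r → E) (a : Fin n × Fin r → ℝ) : Fin n → E := fun s => ∑ i, a (s, i) • β i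

lemma latticeTuple_eq (β : Fin r → E) (h : Fin n × Fin r → ℝ) (k : Fin n × Fin r → ℤ) :
    latticeTuple β h k = tupleOf β fun j => (k j : ℝ) + h j := rfl

/-- The exponent `tr (v (X,X)_Z)`. -/
noncomputable def majorantTrace (b : LinearMap.BilinForm ℝ E) (v : Matrix (Fin n) (Fin n) ℝ) (Z : E)
    (X : Fin n → E) : ℝ :=
  ∑ i, ∑ j, v i j * majorant b Z (X i) (X j)

lemma abs_apply_tupleOf_le (ℓ : E →ₗ[ℝ] ℝ) (β : Fin r → E) (a : Fin n × Fin r → ℝ) (s : Fin n) :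
    |ℓ (tupleOf β a s)| ≤ (∑ i, |ℓ (β i)|) * (1 + ∑ j, a j ^ 2) := by
  have := abs_apply_latticeTuple_le ℓ β a 0 s
  simpa [latticeTuple_eq, shiftSq] using this

variable {b : LinearMap.BilinForm ℝ E} (hb : IsHyperbolic b) {Z₁ : E} (hZ₁ : b Z₁ Z₁ = -1)
  {v : Matrix (Fin n) (Fin n) ℝ} (hv : v.PosDef)
include hb

include hv in
lemma exists_majorantTrace_ge_majorant : ∃ c : ℝ, 0 < c ∧ ∀ Z, b Z Z = -1 → ∀ X : Fin n → E,
    c * ∑ s, majorant b Z (X s) (X s) ≤ majorantTrace b v Z X := by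
  obtain ⟨c, hc, H⟩ := exists_sum_le_of_posDef hv
  refine ⟨c, hc, fun Z hZ X => ?_⟩
  have := H E (majorantForm b Z) (fun x y => by
      rw [majorantForm_apply, majorantForm_apply, hb.majorant_symm])
    (fun x => by rw [majorantForm_apply]; exact hb.majorant_nonneg hZ x) X
  simp only [majorantForm_apply] at this
  exact this

include hZ₁ hv in
/-- The Gaussian at `Z` is bounded by a Gaussian in the coordinates whose width is controlled by
the distance of `Z` from the base point. -/
lemma exists_majorantTrace_ge (β : Module.Basis (Fin r) ℝ E) : ∃ c : ℝ, 0 < c ∧ c ≤ 1 ∧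
    ∀ (Z : E) (ν : ℝ), b Z Z = -1 → 1 ≤ ν → |b Z₁ Z| ≤ ν → ∀ a : Fin n × Fin r → ℝ,
      c / ν ^ 2 * ∑ j, a j ^ 2 ≤ majorantTrace b v Z (tupleOf β a) := by
  obtain ⟨c₁, hc₁, H₁⟩ := exists_sq_repr_le (majorantForm b Z₁)
    (fun x y => by rw [majorantForm_apply, majorantForm_apply, hb.majorant_symm])
    (fun x hx => by rw [majorantForm_apply]; exact hb.majorant_pos hZ₁ hx) β
  obtain ⟨c₂, hc₂, H₂⟩ := exists_majorantTrace_ge_majorant hb hv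
  refine ⟨min (c₂ * c₁ / 4) 1, by positivity, min_le_right _ _, fun Z ν hZ hν hZν a => ?_⟩
  have hν2 : 0 < ν ^ 2 := by positivity
  have hle : (b Z₁ Z) ^ 2 ≤ ν ^ 2 := by rw [← sq_abs (b Z₁ Z)]; gcongr
  have h1 : c₁ * ∑ j, a j ^ 2 ≤ 4 * ν ^ 2 * ∑ s, majorant b Z (tupleOf β a s) (tupleOf β a s) := by
    rw [Fintype.sum_prod_type, Finset.mul_sum, Finset.mul_sum]
    refine Finset.sum_le_sum fun s _ => ?_
    have h2 := H₁ fun i => a (s, i)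
    rw [majorantForm_apply] at h2
    refine h2.trans ((hb.majorant_le hZ hZ₁ _).trans ?_)
    have := hb.majorant_nonneg hZ (tupleOf β a s)
    exact mul_le_mul_of_nonneg_right (by linarith) this
  have h3 : 0 ≤ ∑ j, a j ^ 2 := Finset.sum_nonneg fun _ _ => sq_nonneg _
  calc _ ≤ (c₂ * c₁ / 4) / ν ^ 2 * ∑ j, a j ^ 2 := by
        gcongr; exact min_le_left _ _
    _ = c₂ * ((c₁ * ∑ j, a j ^ 2) / (4 * ν ^ 2)) := by field_simp
    _ ≤ c₂ * ∑ s, majorant b Z (tupleOf β a s) (tupleOf β a s) := by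
        gcongr
        rw [div_le_iff₀ (by positivity)]
        linarith
    _ ≤ _ := H₂ Z hZ _

include hZ₁ in
lemma exists_frameDet_le (β : Fin (n + 1) → E) : ∃ C : ℝ, 0 < C ∧
    ∀ (Z : E) (ν : ℝ), b Z Z = -1 → 1 ≤ ν → |b Z₁ Z| ≤ ν → ∀ a : Fin n × Fin (n + 1) → ℝ,
      |frameDet b β (Fin.cons Z (tupleOf β a))| ≤
        C * ν ^ (n + 1) * (1 + ∑ j, a j ^ 2) ^ (n + 1) := by
  set A : ℝ := 1 + ∑ k, ∑ i, |b (β i) (β k)| + ∑ k, 2 * (1 + majorant b Z₁ (β k) (β k)) with hA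
  have hmaj : ∀ k, 0 ≤ majorant b Z₁ (β k) (β k) := fun k => hb.majorant_nonneg hZ₁ _
  have h0 : 0 ≤ ∑ k, ∑ i, |b (β i) (β k)| :=
    Finset.sum_nonneg fun k _ => Finset.sum_nonneg fun i _ => abs_nonneg _
  have h0' : 0 ≤ ∑ k, 2 * (1 + majorant b Z₁ (β k) (β k)) :=
    Finset.sum_nonneg fun k _ => by linarith [hmaj k]
  have hA1 : 0 < A := by linarith
  refine ⟨(n + 1).factorial * A ^ (n + 1), by positivity, fun Z ν hZ hν hZν a => ?_⟩
  have hS : 0 ≤ ∑ j, a j ^ 2 := Finset.sum_nonneg fun _ _ => sq_nonneg _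
  refine (abs_det_le _ (x := A * ν * (1 + ∑ j, a j ^ 2)) fun i k => ?_).trans
    (le_of_eq (by simp only [mul_pow]; ring))
  rw [Matrix.of_apply]
  refine Fin.cases ?_ (fun s => ?_) i
  · rw [Fin.cons_zero]
    have h1 := hb.sq_le_majorant hZ₁ Z (β k)
    have h2 : majorant b Z₁ Z Z ≤ 2 * ν ^ 2 := by
      have : (b Z Z₁) ^ 2 ≤ ν ^ 2 := by rw [hb.symm, ← sq_abs (b Z₁ Z)]; gcongr
      simp only [majorant, hZ]; nlinarith
    have h3 : |b Z (β k)| ≤ ν * (2 * (1 + majorant b Z₁ (β k) (β k))) := by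
      refine abs_le_of_sq_le_sq (h1.trans ?_) (by have := hmaj k; positivity)
      calc _ ≤ 2 * ν ^ 2 * majorant b Z₁ (β k) (β k) := mul_le_mul_of_nonneg_right h2 (hmaj k)
        _ ≤ _ := by
          have := hmaj k
          have : 0 ≤ ν ^ 2 := by positivity
          nlinarith [mul_nonneg this (hmaj k), mul_nonneg this (mul_nonneg (hmaj k) (hmaj k))]
    have h4 : 2 * (1 + majorant b Z₁ (β k) (β k)) ≤ A := by
      have := Finset.single_le_sum (f := fun k => 2 * (1 + majorant b Z₁ (β k) (β k)))
        (fun k _ => by linarith [hmaj k]) (Finset.mem_univ k)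
      linarith
    have h5 : |b Z (β k)| ≤ A * ν := h3.trans (by rw [mul_comm]; gcongr)
    have : 0 < A * ν := by positivity
    nlinarith
  · rw [Fin.cons_succ]
    have h1 := abs_apply_tupleOf_le (b.flip (β k)) β a s
    have h2 : ∑ i, |b.flip (β k) (β i)| ≤ A := by
      have := Finset.single_le_sum (f := fun k => ∑ i, |b (β i) (β k)|)
        (fun k _ => Finset.sum_nonneg fun i _ => abs_nonneg _) (Finset.mem_univ k)
      change ∑ i, |b (β i) (β k)| ≤ A
      linarith
    have h3 : |b (tupleOf β a s) (β k)| ≤ A * (1 + ∑ j, a j ^ 2) := h1.trans (by gcongr)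
    refine h3.trans ?_
    have : 0 ≤ A * (1 + ∑ j, a j ^ 2) := by positivity
    nlinarith

omit hb in
lemma exists_cuspMinor_le (b : LinearMap.BilinForm ℝ E) (β : Fin (n + 1) → E)
    (e d : E) : ∃ C : ℝ, 0 < C ∧ ∀ (s : Fin n) (a : Fin n × Fin (n + 1) → ℝ),
      |cuspMinor b β e d (tupleOf β a) s| ≤ C * (1 + ∑ j, a j ^ 2) ^ (n + 1) := by
  set A : ℝ := 1 + ∑ k, ∑ i, |b (β i) (β k)| + ∑ k, (|b e (β k)| + |b d (β k)|) with hA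
  have h0 : 0 ≤ ∑ k, ∑ i, |b (β i) (β k)| :=
    Finset.sum_nonneg fun k _ => Finset.sum_nonneg fun i _ => abs_nonneg _
  have h0' : 0 ≤ ∑ k, (|b e (β k)| + |b d (β k)|) :=
    Finset.sum_nonneg fun k _ => by positivity
  have hA1 : 0 < A := by linarith
  refine ⟨(n + 1).factorial * A ^ (n + 1), by positivity, fun s a => ?_⟩
  have hS : 0 ≤ ∑ j, a j ^ 2 := Finset.sum_nonneg fun _ _ => sq_nonneg _
  rw [cuspMinor, abs_mul, abs_pow, abs_neg, abs_one, one_pow, one_mul]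
  refine (abs_det_le _ (x := A * (1 + ∑ j, a j ^ 2)) fun i k => ?_).trans
    (le_of_eq (by simp only [mul_pow]; ring))
  rw [Matrix.of_apply]
  have hed : |b e (β k)| ≤ A ∧ |b d (β k)| ≤ A := by
    have := Finset.single_le_sum (f := fun k => |b e (β k)| + |b d (β k)|)
      (fun k _ => by positivity) (Finset.mem_univ k)
    have h1 := abs_nonneg (b e (β k))
    have h2 := abs_nonneg (b d (β k))
    constructor <;> linarith
  change |b ((Fin.cons e (Fin.cons d (tupleOf β a) : Fin (n + 1) → E) : Fin (n + 2) → E)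
    ((s.succ.succ : Fin (n + 2)).succAbove i)) (β k)| ≤ _
  refine Fin.cases ?_ (fun i => Fin.cases ?_ (fun s => ?_) i)
    ((s.succ.succ : Fin (n + 2)).succAbove i)
  · rw [Fin.cons_zero]; nlinarith [hed.1]
  · rw [Fin.cons_succ, Fin.cons_zero]; nlinarith [hed.2]
  · rw [Fin.cons_succ, Fin.cons_succ]
    have h1 := abs_apply_tupleOf_le (b.flip (β k)) β a s
    have h2 : ∑ i, |b.flip (β k) (β i)| ≤ A := by
      have := Finset.single_le_sum (f := fun k => ∑ i, |b (β i) (β k)|)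
        (fun k _ => Finset.sum_nonneg fun i _ => abs_nonneg _) (Finset.mem_univ k)
      change ∑ i, |b (β i) (β k)| ≤ A
      linarith
    exact h1.trans (by gcongr)

end Bounds

section Terms

variable {E : Type*} [AddCommGroup E] [Module ℝ E] {n : ℕ}

/-- The summand of the theta kernel, with the value of the form on tangent vectors replaced by the
volume of `(Z, X)`. -/
noncomputable def kernelTerm (b : LinearMap.BilinForm ℝ E) (g : Fin (n + 1) → E)
    (u v : Matrix (Fin n) (Fin n) ℝ) (Z : E) (X : Fin n → E) : ℂ :=
  Complex.exp (((Real.pi * ∑ i, ∑ j, u i j * b (X i) (X j) : ℝ) : ℂ) * Complex.I) *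
    ((frameDet b g (Fin.cons Z X) * Real.exp (-Real.pi * majorantTrace b v Z X) : ℝ) : ℂ)

lemma norm_kernelTerm (b : LinearMap.BilinForm ℝ E) (g : Fin (n + 1) → E)
    (u v : Matrix (Fin n) (Fin n) ℝ) (Z : E) (X : Fin n → E) :
    ‖kernelTerm b g u v Z X‖ =
      |frameDet b g (Fin.cons Z X)| * Real.exp (-Real.pi * majorantTrace b v Z X) := by
  rw [kernelTerm, norm_mul, Complex.norm_exp_ofReal_mul_I, one_mul, Complex.norm_real,
    Real.norm_eq_abs, abs_mul, Real.abs_exp]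

open Classical in
/-- The `κ`-th part of the term of the theta kernel of a tuple `X` orthogonal to `e`; it is an odd
function of the linear form `∑_s v_κs (x_s, Z)`. -/
noncomputable def cuspTerm (b : LinearMap.BilinForm ℝ E) (g : Fin (n + 1) → E)
    (u v : Matrix (Fin n) (Fin n) ℝ) (e d Z : E) (κ : Fin n) (X : Fin n → E) : ℂ :=
  if ∀ s, b (X s) e = 0 then
    Complex.exp (((Real.pi * ∑ i, ∑ j, u i j * b (X i) (X j) : ℝ) : ℂ) * Complex.I) *
      ((-(b d e)⁻¹ * (∑ s, v⁻¹ s κ * cuspMinor b g e d X s) * (∑ s, v κ s * b (X s) Z) *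
        Real.exp (-Real.pi * majorantTrace b v Z X) : ℝ) : ℂ)
  else 0

variable {b : LinearMap.BilinForm ℝ E} (hs : ∀ x y, b x y = b y x)
  {u v : Matrix (Fin n) (Fin n) ℝ}
include hs

lemma sum_cuspTerm (hv : IsUnit v.det) (g : Module.Basis (Fin (n + 1)) ℝ E) {e d : E}
    (he : b e e = 0) (hd : b d e ≠ 0) (Z : E) {X : Fin n → E} (hX : ∀ s, b (X s) e = 0) :
    ∑ κ, cuspTerm b g u v e d Z κ X = kernelTerm b g u v Z X := by
  simp only [cuspTerm, if_pos hX]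
  rw [← Finset.mul_sum, kernelTerm, ← Complex.ofReal_sum, frameDet_eq_sum_cuspMinor hs g hX he hd]
  congr 2
  rw [← Finset.sum_mul]
  congr 1
  have h1 : ∀ s, b (X s) Z = ∑ κ, v⁻¹ s κ * ∑ s', v κ s' * b (X s') Z := fun s => by
    have := congrFun (congrArg (fun A => Matrix.mulVec A fun s => b (X s) Z)
      (Matrix.nonsing_inv_mul v hv)) s
    rw [← Matrix.mulVec_mulVec, Matrix.one_mulVec] at this
    exact this.symm
  rw [Finset.mul_sum]
  conv_rhs =>
    enter [2, s]
    rw [h1 s, Finset.sum_mul, Finset.mul_sum]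
  rw [Finset.sum_comm]
  refine Finset.sum_congr rfl fun κ _ => ?_
  generalize ∑ s, v κ s * b (X s) Z = L
  rw [mul_assoc, Finset.sum_mul, Finset.mul_sum]
  refine Finset.sum_congr rfl fun s _ => ?_
  ring

/-- Dependence of the `κ`-th part on the multiple of `e` that is added to `x_κ`: the square in the
Gaussian is completed at the point `-c`. -/
lemma cuspTerm_add_smul (hvs : ∀ i j, v i j = v j i) (g : Fin (n + 1) → E) {e d Z : E}
    (he : b e e = 0) {κ : Fin n} (hκ : v κ κ ≠ 0) (hη : b e Z ≠ 0) {X : Fin n → E}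
    (hX : ∀ s, b (X s) e = 0) {c : ℝ}
    (hc : c = (∑ s, v κ s * b (X s) Z) / (b e Z * v κ κ)) (t : ℝ) :
    cuspTerm b g u v e d Z κ (fun s => X s + (Pi.single κ t : Fin n → ℝ) s • e) =
      (Complex.exp (((Real.pi * ∑ i, ∑ j, u i j * b (X i) (X j) : ℝ) : ℂ) * Complex.I) *
        ((-(b d e)⁻¹ * (∑ s, v⁻¹ s κ * cuspMinor b g e d X s) * (b e Z * v κ κ) *
          Real.exp (-Real.pi * majorantTrace b v Z
            (fun s => X s + (Pi.single κ (-c) : Fin n → ℝ) s • e)) : ℝ) : ℂ)) *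
        (((t + c) * Real.exp (-Real.pi * (t + c) ^ 2 * (2 * v κ κ * b e Z ^ 2)) : ℝ) : ℂ) := by
  have hXe : ∀ (a : Fin n → ℝ) s, b (X s + a s • e) e = 0 := fun a s => by simp [hX, he]
  have heX : ∀ s, b e (X s) = 0 := fun s => by rw [hs, hX]
  have hbb : ∀ (a : Fin n → ℝ) i j, b (X i + a i • e) (X j + a j • e) = b (X i) (X j) :=
    fun a i j => by simp [hX, he, heX]
  have hl : ∀ t, ∑ s, v κ s * b (X s + (Pi.single κ t : Fin n → ℝ) s • e) Z =
      (t + c) * (b e Z * v κ κ) := fun t => by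
    have : ∑ s, v κ s * b (X s + (Pi.single κ t : Fin n → ℝ) s • e) Z =
        ∑ s, v κ s * b (X s) Z + ∑ s, v κ s * (Pi.single κ t : Fin n → ℝ) s * b e Z := by
      rw [← Finset.sum_add_distrib]
      refine Finset.sum_congr rfl fun s _ => ?_
      simp only [map_add, map_smul, LinearMap.add_apply, LinearMap.smul_apply, smul_eq_mul]
      ring
    rw [this, ← Finset.sum_mul]
    simp only [Pi.single_apply, mul_ite, mul_zero, Finset.sum_ite_eq', Finset.mem_univ, if_true]
    rw [hc]
    field_simp
    ring
  have hq0 : ∀ t, majorantTrace b v Z (fun s => X s + (Pi.single κ t : Fin n → ℝ) s • e) =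
      majorantTrace b v Z X + 4 * t * (b e Z) * (∑ s, v κ s * b (X s) Z) +
        2 * t ^ 2 * (b e Z) ^ 2 * v κ κ := fun t => by
    set a : Fin n → ℝ := Pi.single κ t with ha
    have h1 : ∀ i j, v i j * majorant b Z (X i + a i • e) (X j + a j • e) =
        v i j * majorant b Z (X i) (X j) + (2 * b e Z) * (a i * (v i j * b (X j) Z)) +
          (2 * b e Z) * (a j * (v j i * b (X i) Z)) + 2 * (b e Z) ^ 2 * (a i * (v i j * a j)) :=
      fun i j => by
        rw [majorant, hbb, majorant, hvs j i]
        simp only [map_add, map_smul, LinearMap.add_apply, LinearMap.smul_apply, smul_eq_mul]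
        ring
    have h2 : ∀ y : Fin n → ℝ, ∑ i, a i * y i = t * y κ := fun y => by
      simp [ha, Pi.single_apply]
    simp only [majorantTrace, h1, Finset.sum_add_distrib, ← Finset.mul_sum]
    rw [Finset.sum_comm (f := fun i j => a j * (v j i * b (X i) Z))]
    simp only [← Finset.mul_sum, h2]
    have h3 : ∑ j, v κ j * a j = t * v κ κ := by
      rw [← h2 fun j => v κ j]
      exact Finset.sum_congr rfl fun j _ => mul_comm _ _
    rw [h3]
    ring
  have hcl : ∑ s, v κ s * b (X s) Z = c * (b e Z * v κ κ) := by
    rw [hc]; field_simp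
  have hq : majorantTrace b v Z (fun s => X s + (Pi.single κ t : Fin n → ℝ) s • e) =
      majorantTrace b v Z (fun s => X s + (Pi.single κ (-c) : Fin n → ℝ) s • e) +
        (t + c) ^ 2 * (2 * v κ κ * b e Z ^ 2) := by
    rw [hq0, hq0, hcl]; ring
  have hexp : Real.exp (-Real.pi * majorantTrace b v Z
      (fun s => X s + (Pi.single κ t : Fin n → ℝ) s • e)) =
      Real.exp (-Real.pi * majorantTrace b v Z
        (fun s => X s + (Pi.single κ (-c) : Fin n → ℝ) s • e)) *
        Real.exp (-Real.pi * (t + c) ^ 2 * (2 * v κ κ * b e Z ^ 2)) := by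
    rw [hq, ← Real.exp_add]; congr 1; ring
  rw [cuspTerm, if_pos (hXe _), hl, hexp]
  simp only [hbb, cuspMinor_add_smul]
  rw [mul_assoc (Complex.exp _), ← Complex.ofReal_mul]
  congr 2
  ring

end Terms

section CuspEstimate

variable {E : Type*} [AddCommGroup E] [Module ℝ E] {n : ℕ}
  {b : LinearMap.BilinForm ℝ E} (hb : IsHyperbolic b) {Z₁ : E} (hZ₁ : b Z₁ Z₁ = -1)
  {v : Matrix (Fin n) (Fin n) ℝ} (hv : v.PosDef) (u : Matrix (Fin n) (Fin n) ℝ)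
  (β : Module.Basis (Fin (n + 1)) ℝ E)

lemma exp_neg_pi_mul_le {q q' : ℝ} (h : q' ≤ q) (hq : 0 ≤ q') :
    Real.exp (-Real.pi * q) ≤ Real.exp (-q') := by
  have := Real.pi_gt_three
  exact Real.exp_le_exp.mpr (by nlinarith)

include hb hZ₁ hv

lemma exists_norm_kernelTerm_le : ∃ C c : ℝ, 0 < C ∧ 0 < c ∧ c ≤ 1 ∧
    ∀ (Z : E) (ν : ℝ), b Z Z = -1 → 1 ≤ ν → |b Z₁ Z| ≤ ν → ∀ a : Fin n × Fin (n + 1) → ℝ,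
      ‖kernelTerm b β u v Z (tupleOf β a)‖ ≤ C * ν ^ (n + 1) *
        ((1 + ∑ j, a j ^ 2) ^ (n + 1) * Real.exp (-(c / ν ^ 2) * ∑ j, a j ^ 2)) := by
  obtain ⟨c, hc, hc1, H₁⟩ := exists_majorantTrace_ge hb hZ₁ hv β
  obtain ⟨C, hC, H₂⟩ := exists_frameDet_le hb hZ₁ β
  refine ⟨C, c, hC, hc, hc1, fun Z ν hZ hν hZν a => ?_⟩
  rw [norm_kernelTerm, ← mul_assoc]
  have hS : 0 ≤ ∑ j, a j ^ 2 := Finset.sum_nonneg fun _ _ => sq_nonneg _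
  refine mul_le_mul (H₂ Z ν hZ hν hZν a) ?_ (Real.exp_pos _).le (by positivity)
  rw [neg_mul (c / ν ^ 2)]
  exact exp_neg_pi_mul_le (H₁ Z ν hZ hν hZν a) (by positivity)

/-- The theta kernel grows at most polynomially in the distance from the base point. -/
lemma exists_norm_kernel_le (h : Fin n × Fin (n + 1) → ℝ) : ∃ C : ℝ, 0 < C ∧ ∃ K : ℕ,
    ∀ (Z : E) (ν : ℝ), b Z Z = -1 → 1 ≤ ν → |b Z₁ Z| ≤ ν →
      (Summable fun k => kernelTerm b β u v Z (latticeTuple β h k)) ∧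
      ‖∑' k, kernelTerm b β u v Z (latticeTuple β h k)‖ ≤ C * ν ^ K := by
  obtain ⟨C, c, hC, hc, hc1, H⟩ := exists_norm_kernelTerm_le hb hZ₁ hv u β
  obtain ⟨C₂, hC₂, K, H₂⟩ := exists_sum_pow_mul_exp_le (Fin n × Fin (n + 1)) (n + 1)
  refine ⟨C * (C₂ * c⁻¹ ^ K), by positivity, n + 1 + 2 * K, fun Z ν hZ hν hZν => ?_⟩
  have hν0 : 0 < ν := by linarith
  have hε : 0 < c / ν ^ 2 := by positivity
  have hε1 : c / ν ^ 2 ≤ 1 := by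
    rw [div_le_one (by positivity)]; nlinarith
  have hsum := (summable_pow_mul_exp (n + 1) hε h).mul_left (C * ν ^ (n + 1))
  have hle : ∀ k, ‖kernelTerm b β u v Z (latticeTuple β h k)‖ ≤ C * ν ^ (n + 1) *
      ((1 + shiftSq h k) ^ (n + 1) * Real.exp (-(c / ν ^ 2) * shiftSq h k)) := fun k =>
    H Z ν hZ hν hZν fun j => (k j : ℝ) + h j
  refine ⟨Summable.of_norm_bounded hsum hle, (tsum_of_norm_bounded hsum.hasSum hle).trans ?_⟩
  rw [tsum_mul_left]
  calc _ ≤ C * ν ^ (n + 1) * (C₂ * (c / ν ^ 2)⁻¹ ^ K) := by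
        refine mul_le_mul_of_nonneg_left ?_ (by positivity)
        exact (summable_pow_mul_exp (n + 1) hε h).tsum_le_of_sum_le fun s => H₂ _ hε hε1 h s
    _ = _ := by rw [inv_div, div_eq_mul_inv, mul_pow, pow_add ν (n + 1), pow_mul ν 2]; ring

variable {e : E} (he : b e e = 0) (he0 : e ≠ 0)
include he he0

open Classical in
/-- The tuples that are not orthogonal to the cusp `e` contribute an exponentially small amount. -/
lemma exists_norm_kernel_not_orthogonal_le (h : Fin n × Fin (n + 1) → ℝ) {δ : ℝ} (hδ : 0 < δ)
    (hgap : ∀ k s, b (latticeTuple β h k s) e ≠ 0 → δ ≤ |b (latticeTuple β h k s) e|) :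
    ∃ C c : ℝ, 0 < C ∧ 0 < c ∧ ∃ K : ℕ, ∀ (Z : E) (ν : ℝ), b Z Z = -1 → 1 ≤ ν → |b Z₁ Z| ≤ ν →
      (Summable fun k => if ∀ s, b (latticeTuple β h k s) e = 0 then 0 else
        kernelTerm b β u v Z (latticeTuple β h k)) ∧
      ‖∑' k, if ∀ s, b (latticeTuple β h k s) e = 0 then 0 else
        kernelTerm b β u v Z (latticeTuple β h k)‖ ≤
        C * ν ^ K * Real.exp (-c * (1 / (b e Z) ^ 2)) := by
  obtain ⟨c₁, hc₁, hc1, H₁⟩ := exists_majorantTrace_ge hb hZ₁ hv β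
  obtain ⟨c₂, hc₂, H₂⟩ := exists_majorantTrace_ge_majorant hb hv
  obtain ⟨C₀, hC₀, H₀⟩ := exists_frameDet_le hb hZ₁ β
  obtain ⟨C₃, hC₃, K, H₃⟩ := exists_sum_pow_mul_exp_le (Fin n × Fin (n + 1)) (n + 1)
  refine ⟨C₀ * (C₃ * (c₁ / 2)⁻¹ ^ K), c₂ * δ ^ 2 / 4, by positivity, by positivity,
    n + 1 + 2 * K, fun Z ν hZ hν hZν => ?_⟩
  have hη : b e Z ≠ 0 := hb.apply_ne_zero_of_isotropic hZ he he0
  have hν0 : 0 < ν := by linarith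
  have hε : 0 < c₁ / 2 / ν ^ 2 := by positivity
  have hε1 : c₁ / 2 / ν ^ 2 ≤ 1 := by
    rw [div_le_one (by positivity)]; nlinarith
  set D := Real.exp (-(c₂ * δ ^ 2 / 4) * (1 / (b e Z) ^ 2)) with hD
  have hsum := (summable_pow_mul_exp (n + 1) hε h).mul_left (C₀ * ν ^ (n + 1) * D)
  have hle : ∀ k, ‖if ∀ s, b (latticeTuple β h k s) e = 0 then 0 else
      kernelTerm b β u v Z (latticeTuple β h k)‖ ≤ C₀ * ν ^ (n + 1) * D *
      ((1 + shiftSq h k) ^ (n + 1) * Real.exp (-(c₁ / 2 / ν ^ 2) * shiftSq h k)) := fun k => by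
    have hS := shiftSq_nonneg h k
    split_ifs with hk
    · rw [norm_zero]; positivity
    · push Not at hk
      obtain ⟨s, hs⟩ := hk
      set X := latticeTuple β h k with hX
      have h1 : c₁ / ν ^ 2 * shiftSq h k ≤ majorantTrace b v Z X :=
        H₁ Z ν hZ hν hZν fun j => (k j : ℝ) + h j
      -- Cauchy-Schwarz for the majorant, for which `e` has length `2 (e,Z)²`
      have h2 : c₂ * (δ ^ 2 / (2 * (b e Z) ^ 2)) ≤ majorantTrace b v Z X := by
        refine le_trans ?_ (H₂ Z hZ X)
        refine mul_le_mul_of_nonneg_left ?_ hc₂.le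
        have h3 : δ ^ 2 ≤ majorant b Z (X s) (X s) * (2 * (b e Z) ^ 2) := by
          have h4 := hb.sq_le_majorant hZ (X s) e
          have h5 : majorant b Z e e = 2 * (b e Z) ^ 2 := by simp only [majorant, he]; ring
          rw [h5] at h4
          refine le_trans ?_ h4
          rw [← sq_abs (b (X s) e)]
          exact pow_le_pow_left₀ hδ.le (hgap k s hs) 2
        rw [div_le_iff₀ (by positivity)]
        refine h3.trans (mul_le_mul_of_nonneg_right ?_ (by positivity))
        exact Finset.single_le_sum (f := fun s => majorant b Z (X s) (X s))
          (fun s _ => hb.majorant_nonneg hZ _) (Finset.mem_univ s)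
      have h3 : Real.exp (-Real.pi * majorantTrace b v Z X) ≤
          D * Real.exp (-(c₁ / 2 / ν ^ 2) * shiftSq h k) := by
        rw [hD, ← Real.exp_add]
        have : -(c₂ * δ ^ 2 / 4) * (1 / (b e Z) ^ 2) + -(c₁ / 2 / ν ^ 2) * shiftSq h k =
            -((c₂ * (δ ^ 2 / (2 * (b e Z) ^ 2)) + c₁ / ν ^ 2 * shiftSq h k) / 2) := by
          field_simp; ring
        rw [this]
        exact exp_neg_pi_mul_le (by linarith) (by positivity)
      rw [norm_kernelTerm]
      calc _ ≤ C₀ * ν ^ (n + 1) * (1 + shiftSq h k) ^ (n + 1) *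
            (D * Real.exp (-(c₁ / 2 / ν ^ 2) * shiftSq h k)) :=
            mul_le_mul (H₀ Z ν hZ hν hZν fun j => (k j : ℝ) + h j) h3 (Real.exp_pos _).le
              (by positivity)
        _ = _ := by ring
  refine ⟨Summable.of_norm_bounded hsum hle, (tsum_of_norm_bounded hsum.hasSum hle).trans ?_⟩
  rw [tsum_mul_left]
  calc _ ≤ C₀ * ν ^ (n + 1) * D * (C₃ * (c₁ / 2 / ν ^ 2)⁻¹ ^ K) := by
        refine mul_le_mul_of_nonneg_left ?_ (by positivity)
        exact (summable_pow_mul_exp (n + 1) hε h).tsum_le_of_sum_le fun s => H₃ _ hε hε1 h s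
    _ = _ := by rw [inv_div, div_eq_mul_inv, mul_pow, pow_add ν (n + 1), pow_mul ν 2]; ring

end CuspEstimate

section SplitCoordinate

variable {J : Type*} [DecidableEq J]

/-- The real vector with coordinate `t` at `j₀` and the shifted integral coordinates `k`
elsewhere. -/
noncomputable def splitVector (h : J → ℝ) (j₀ : J) (k : {j // j ≠ j₀} → ℤ) (t : ℝ) : J → ℝ :=
  fun j => if hj : j = j₀ then t else k ⟨j, hj⟩ + h j

lemma funSplitAt_symm_add (h : J → ℝ) (j₀ : J) (t : ℤ) (k : {j // j ≠ j₀} → ℤ) :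
    (fun j => (((Equiv.funSplitAt j₀ ℤ).symm (t, k) j : ℤ) : ℝ) + h j) =
      splitVector h j₀ k (t + h j₀) := by
  funext j
  rw [splitVector, Equiv.funSplitAt_symm_apply]
  split_ifs with hj
  · rw [hj]
  · rfl

lemma sum_splitVector_sq [Fintype J] (h : J → ℝ) (j₀ : J) (k : {j // j ≠ j₀} → ℤ) (t : ℝ) :
    ∑ j, splitVector h j₀ k t j ^ 2 = t ^ 2 + shiftSq (fun j : {j // j ≠ j₀} => h j) k := by
  rw [Fintype.sum_eq_add_sum_subtype_ne _ j₀]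
  congr 1
  · simp [splitVector]
  · refine Finset.sum_congr rfl fun j _ => ?_
    simp [splitVector, j.2]

lemma tupleOf_splitVector {E : Type*} [AddCommGroup E] [Module ℝ E] {n r : ℕ} (β : Fin r → E)
    (h : Fin n × Fin r → ℝ) (κ : Fin n) (i₀ : Fin r) (k : {j // j ≠ (κ, i₀)} → ℤ) (t : ℝ) :
    tupleOf β (splitVector h (κ, i₀) k t) = fun s => tupleOf β (splitVector h (κ, i₀) k 0) s +
      (Pi.single κ t : Fin n → ℝ) s • β i₀ := by
  funext s
  have h1 : ∀ i, splitVector h (κ, i₀) k t (s, i) = splitVector h (κ, i₀) k 0 (s, i) +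
      if i = i₀ then (Pi.single κ t : Fin n → ℝ) s else 0 := fun i => by
    by_cases hi : i = i₀ <;> by_cases hs : s = κ <;> simp [splitVector, hi, hs, Prod.ext_iff]
  simp only [tupleOf, h1, add_smul, Finset.sum_add_distrib, ite_smul, zero_smul,
    Finset.sum_ite_eq', Finset.mem_univ, if_true]

end SplitCoordinate

section CuspEstimate

variable {E : Type*} [AddCommGroup E] [Module ℝ E] {n : ℕ}
  {b : LinearMap.BilinForm ℝ E} (hb : IsHyperbolic b) {Z₁ : E} (hZ₁ : b Z₁ Z₁ = -1)
  {v : Matrix (Fin n) (Fin n) ℝ} (hv : v.PosDef) (u : Matrix (Fin n) (Fin n) ℝ)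
  (β : Module.Basis (Fin (n + 1)) ℝ E) {i₀ : Fin (n + 1)} (he : b (β i₀) (β i₀) = 0)
include hb hZ₁ hv he

omit he in
lemma summable_cuspTerm (h : Fin n × Fin (n + 1) → ℝ) (e d : E) (κ : Fin n) {Z : E}
    (hZ : b Z Z = -1) :
    Summable fun k => cuspTerm b β u v e d Z κ (latticeTuple β h k) := by
  obtain ⟨c, hc, hc1, H₁⟩ := exists_majorantTrace_ge hb hZ₁ hv β
  obtain ⟨C, hC, H₂⟩ := exists_cuspMinor_le b β e d
  set ν := max 1 |b Z₁ Z|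
  have hν0 : 0 < ν := lt_of_lt_of_le one_pos (le_max_left _ _)
  set A := |(b d e)⁻¹| * ∑ s, |v⁻¹ s κ| * C
  set A' := ∑ s, |v κ s| * ∑ i, |b.flip Z (β i)|
  have hA : 0 ≤ A := mul_nonneg (abs_nonneg _) (Finset.sum_nonneg fun _ _ => by positivity)
  have hA' : 0 ≤ A' := Finset.sum_nonneg fun _ _ => mul_nonneg (abs_nonneg _)
    (Finset.sum_nonneg fun _ _ => abs_nonneg _)
  refine Summable.of_norm_bounded ((summable_pow_mul_exp (n + 1 + 1)
    (show 0 < c / ν ^ 2 by positivity) h).mul_left (A * A')) fun k => ?_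
  have hS := shiftSq_nonneg h k
  rw [cuspTerm]
  split_ifs with hk
  · set X := latticeTuple β h k with hX
    rw [norm_mul, Complex.norm_exp_ofReal_mul_I, one_mul, Complex.norm_real, Real.norm_eq_abs,
      abs_mul, abs_mul, abs_mul, abs_neg, Real.abs_exp]
    have h1 : |∑ s, v⁻¹ s κ * cuspMinor b β e d X s| ≤
        (∑ s, |v⁻¹ s κ| * C) * (1 + shiftSq h k) ^ (n + 1) := by
      rw [Finset.sum_mul]
      refine (Finset.abs_sum_le_sum_abs _ _).trans (Finset.sum_le_sum fun s _ => ?_)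
      rw [abs_mul, mul_assoc]
      exact mul_le_mul_of_nonneg_left (H₂ s fun j => (k j : ℝ) + h j) (abs_nonneg _)
    have h2 : |∑ s, v κ s * b (X s) Z| ≤ A' * (1 + shiftSq h k) := by
      rw [Finset.sum_mul]
      refine (Finset.abs_sum_le_sum_abs _ _).trans (Finset.sum_le_sum fun s _ => ?_)
      rw [abs_mul, mul_assoc]
      exact mul_le_mul_of_nonneg_left (abs_apply_latticeTuple_le (b.flip Z) β h k s) (abs_nonneg _)
    have h3 : Real.exp (-Real.pi * majorantTrace b v Z X) ≤
        Real.exp (-(c / ν ^ 2) * shiftSq h k) := by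
      rw [neg_mul (c / ν ^ 2)]
      exact exp_neg_pi_mul_le (H₁ Z ν hZ (le_max_left _ _) (le_max_right _ _)
        fun j => (k j : ℝ) + h j) (by positivity)
    calc _ ≤ |(b d e)⁻¹| * ((∑ s, |v⁻¹ s κ| * C) * (1 + shiftSq h k) ^ (n + 1)) *
          (A' * (1 + shiftSq h k)) * Real.exp (-(c / ν ^ 2) * shiftSq h k) :=
          mul_le_mul (mul_le_mul (mul_le_mul_of_nonneg_left h1 (abs_nonneg _)) h2 (abs_nonneg _)
            (mul_nonneg (abs_nonneg _) ((abs_nonneg _).trans h1))) h3 (Real.exp_pos _).le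
            (mul_nonneg (mul_nonneg (abs_nonneg _) ((abs_nonneg _).trans h1))
              ((abs_nonneg _).trans h2))
      _ = _ := by simp only [A]; ring
  · rw [norm_zero]; positivity

/-- The tuples orthogonal to the cusp contribute an exponentially small amount as well, by
cancellation in the sums over the multiples of `e`. -/
lemma exists_norm_cuspTerm_le (h : Fin n × Fin (n + 1) → ℝ) (κ : Fin n) :
    ∃ C c : ℝ, 0 < C ∧ 0 < c ∧ ∃ K : ℕ, ∀ (Z : E) (ν : ℝ), b Z Z = -1 → 1 ≤ ν → |b Z₁ Z| ≤ ν →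
      |b (β i₀) Z| ≤ 1 →
      ‖∑' k, cuspTerm b β u v (β i₀) Z₁ Z κ (latticeTuple β h k)‖ ≤
        C * ν ^ K * Real.exp (-c * (1 / (b (β i₀) Z) ^ 2)) := by
  classical
  set e := β i₀ with he'
  have he0 : e ≠ 0 := β.ne_zero i₀
  have hκ : 0 < v κ κ := hv.diag_pos
  have hvs : ∀ i j, v i j = v j i := fun i j => by
    have := hv.isHermitian.apply i j
    simpa using this.symm
  obtain ⟨c, hc, hc1, H₁⟩ := exists_majorantTrace_ge hb hZ₁ hv β
  obtain ⟨C, hC, H₂⟩ := exists_cuspMinor_le b β e Z₁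
  obtain ⟨C₃, hC₃, K, H₃⟩ := exists_norm_tsum_odd_le
    {j : Fin n × Fin (n + 1) // j ≠ (κ, i₀)} (n + 1)
    (2 * v κ κ) (by positivity)
  set A := |(b Z₁ e)⁻¹| * (∑ s, |v⁻¹ s κ| * C) * v κ κ with hA
  have hA0 : 0 ≤ A := mul_nonneg (mul_nonneg (abs_nonneg _)
    (Finset.sum_nonneg fun _ _ => by positivity)) hκ.le
  refine ⟨(A + 1) * C₃ * c⁻¹ ^ K, 1 / (4 * v κ κ), by positivity, by positivity, 2 * K,
    fun Z ν hZ hν hZν hη1 => ?_⟩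
  have hν0 : 0 < ν := by linarith
  have hη : b e Z ≠ 0 := hb.apply_ne_zero_of_isotropic hZ he he0
  have hsum := summable_cuspTerm hb hZ₁ hv u β h e Z₁ κ hZ
  set eqv := Equiv.funSplitAt (κ, i₀) ℤ
  rw [← eqv.symm.summable_iff] at hsum
  rw [← eqv.symm.tsum_eq]
  -- the tuple without its coefficient at `e` in the vector with index `κ`
  set X₀ : ({j // j ≠ (κ, i₀)} → ℤ) → Fin n → E := fun k => tupleOf β (splitVector h (κ, i₀) k 0)
    with hX₀
  set θ : ({j // j ≠ (κ, i₀)} → ℤ) → ℝ := fun k => (∑ s, v κ s * b (X₀ k s) Z) / (b e Z * v κ κ)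
    with hθ
  set g : ({j // j ≠ (κ, i₀)} → ℤ) → ℂ := fun k => if ∀ s, b (X₀ k s) e = 0 then
      Complex.exp (((Real.pi * ∑ i, ∑ j, u i j * b (X₀ k i) (X₀ k j) : ℝ) : ℂ) * Complex.I) *
        ((-(b Z₁ e)⁻¹ * (∑ s, v⁻¹ s κ * cuspMinor b β e Z₁ (X₀ k) s) * (b e Z * v κ κ) *
          Real.exp (-Real.pi * majorantTrace b v Z
            (fun s => X₀ k s + (Pi.single κ (-θ k) : Fin n → ℝ) s • e)) : ℝ) : ℂ) else 0 with hg
  have hterm : ∀ y : ℤ × ({j // j ≠ (κ, i₀)} → ℤ),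
      cuspTerm b β u v e Z₁ Z κ (latticeTuple β h (eqv.symm y)) =
      g y.2 * (((y.1 + (h (κ, i₀) + θ y.2)) * Real.exp (-Real.pi *
        (y.1 + (h (κ, i₀) + θ y.2)) ^ 2 * (2 * v κ κ * b e Z ^ 2)) : ℝ) : ℂ) := by
    rintro ⟨t, k⟩
    have hX : latticeTuple β h (eqv.symm (t, k)) =
        fun s => X₀ k s + (Pi.single κ (t + h (κ, i₀)) : Fin n → ℝ) s • e := by
      rw [latticeTuple_eq, funSplitAt_symm_add, tupleOf_splitVector]
    rw [hX]
    by_cases hk : ∀ s, b (X₀ k s) e = 0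
    · rw [cuspTerm_add_smul hb.symm hvs β he hκ.ne' hη hk rfl, hg]
      simp only [if_pos hk, add_assoc, hθ]
    · have hk' : ¬ ∀ s, b (X₀ k s + (Pi.single κ (t + h (κ, i₀)) : Fin n → ℝ) s • e) e = 0 := by
        simpa [he] using hk
      rw [cuspTerm, if_neg hk', hg]
      simp only [if_neg hk, zero_mul]
  have hsum' := hsum.congr (g := fun y : ℤ × ({j // j ≠ (κ, i₀)} → ℤ) => g y.2 *
      (((y.1 + (h (κ, i₀) + θ y.2)) * Real.exp (-Real.pi *
        (y.1 + (h (κ, i₀) + θ y.2)) ^ 2 * (2 * v κ κ * b e Z ^ 2)) : ℝ) : ℂ)) hterm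
  rw [tsum_congr hterm]
  have hη2 : (b e Z) ^ 2 ≤ 1 := by rw [← sq_abs]; exact pow_le_one₀ (abs_nonneg _) hη1
  have hη0 : 0 < (b e Z) ^ 2 := by positivity
  refine (H₃ (c / ν ^ 2) (A + 1) (2 * v κ κ * b e Z ^ 2) (fun j => h j) g
    (fun k => h (κ, i₀) + θ k) (by positivity) ?_ (by positivity) (by positivity)
    (by nlinarith) (fun k => ?_) hsum').trans (le_of_eq ?_)
  · rw [div_le_one (by positivity)]; nlinarith
  · set S := shiftSq (fun j : {j : Fin n × Fin (n + 1) // j ≠ (κ, i₀)} => h j) k with hS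
    have hS0 : 0 ≤ S := shiftSq_nonneg _ _
    rw [hg]
    dsimp only
    split_ifs with hk
    · rw [norm_mul, Complex.norm_exp_ofReal_mul_I, one_mul, Complex.norm_real, Real.norm_eq_abs,
        abs_mul, abs_mul, abs_mul, abs_neg, Real.abs_exp, abs_mul, abs_of_pos hκ]
      have h1 : |∑ s, v⁻¹ s κ * cuspMinor b β e Z₁ (X₀ k) s| ≤
          (∑ s, |v⁻¹ s κ| * C) * (1 + S) ^ (n + 1) := by
        rw [Finset.sum_mul]
        refine (Finset.abs_sum_le_sum_abs _ _).trans (Finset.sum_le_sum fun s _ => ?_)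
        rw [abs_mul, mul_assoc]
        refine mul_le_mul_of_nonneg_left ((H₂ s _).trans (le_of_eq ?_)) (abs_nonneg _)
        rw [sum_splitVector_sq]; simp [hS]
      have h3 : Real.exp (-Real.pi * majorantTrace b v Z
            (fun s => X₀ k s + (Pi.single κ (-θ k) : Fin n → ℝ) s • e)) ≤
          Real.exp (-(c / ν ^ 2) * S) := by
        rw [neg_mul (c / ν ^ 2), ← tupleOf_splitVector]
        refine exp_neg_pi_mul_le (le_trans ?_ (H₁ Z ν hZ hν hZν _)) (by positivity)
        rw [sum_splitVector_sq]
        refine mul_le_mul_of_nonneg_left ?_ (by positivity)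
        linarith [sq_nonneg (-θ k)]
      calc _ ≤ |(b Z₁ e)⁻¹| * ((∑ s, |v⁻¹ s κ| * C) * (1 + S) ^ (n + 1)) * (1 * v κ κ) *
            Real.exp (-(c / ν ^ 2) * S) := by gcongr
        _ = A * ((1 + S) ^ (n + 1) * Real.exp (-(c / ν ^ 2) * S)) := by rw [hA]; ring
        _ ≤ _ := by
          refine mul_le_mul_of_nonneg_right (by linarith) (by positivity)
    · rw [norm_zero]; positivity
  · rw [inv_div, div_eq_mul_inv (ν ^ 2), mul_pow, ← pow_mul]
    have : -(1 / 2) * (1 / (2 * v κ κ * b e Z ^ 2)) = -(1 / (4 * v κ κ)) * (1 / b e Z ^ 2) := by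
      field_simp; ring
    rw [this]; ring

omit hb hZ₁ hv he in
lemma exists_pow_mul_exp_neg_inv_sq_le (K : ℕ) {c R : ℝ} (hc : 0 < c) (hR : 0 ≤ R) :
    ∃ C : ℝ, 0 < C ∧ ∀ η : ℝ, η ≠ 0 →
      ((R + 1) / |η|) ^ K * Real.exp (-c * (1 / η ^ 2)) ≤ C * |η| := by
  obtain ⟨C, hC, H⟩ := exists_pow_mul_exp_le (K + 1)
  refine ⟨(R + 1) ^ K * (C * (min c 1)⁻¹ ^ (K + 1)), by positivity, fun η hη => ?_⟩
  have hη0 : 0 < |η| := abs_pos.mpr hη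
  have hm : 0 < min c 1 := lt_min hc one_pos
  have h1 := H (min c 1) hm (min_le_right _ _) (1 / η ^ 2) (by positivity)
  have h2 : 1 / |η| ≤ 1 + 1 / η ^ 2 := by
    rw [← sq_abs η, ← one_div_pow]
    nlinarith [sq_nonneg (1 / |η| - 1), show 0 < 1 / |η| by positivity]
  have h3 : Real.exp (-c * (1 / η ^ 2)) ≤ Real.exp (-(min c 1) * (1 / η ^ 2)) := by
    refine Real.exp_le_exp.mpr ?_
    rw [neg_mul, neg_mul, neg_le_neg_iff]
    exact mul_le_mul_of_nonneg_right (min_le_left _ _) (by positivity)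
  have h4 : (1 / |η|) ^ (K + 1) * Real.exp (-c * (1 / η ^ 2)) ≤ C * (min c 1)⁻¹ ^ (K + 1) := by
    calc _ ≤ (1 + 1 / η ^ 2) ^ (K + 1) * Real.exp (-(min c 1) * (1 / η ^ 2)) := by gcongr
      _ ≤ _ := h1
      _ ≤ C * (min c 1)⁻¹ ^ (K + 1) * 1 := by
        refine mul_le_mul_of_nonneg_left ?_ (by positivity)
        refine Real.exp_le_one_iff.mpr ?_
        have : 0 ≤ min c 1 / 2 * (1 / η ^ 2) := by positivity
        linarith
      _ = _ := mul_one _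
  calc _ = (R + 1) ^ K * ((1 / |η|) ^ (K + 1) * Real.exp (-c * (1 / η ^ 2))) * |η| := by
        rw [div_eq_mul_one_div, mul_pow, pow_succ (1 / |η|)]; field_simp
    _ ≤ (R + 1) ^ K * (C * (min c 1)⁻¹ ^ (K + 1)) * |η| := by gcongr

/-- The theta kernel vanishes at a cusp. -/
lemma exists_norm_kernel_cusp_le (h : Fin n × Fin (n + 1) → ℝ) {δ : ℝ} (hδ : 0 < δ)
    (hgap : ∀ k s, b (latticeTuple β h k s) (β i₀) ≠ 0 → δ ≤ |b (latticeTuple β h k s) (β i₀)|)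
    {R : ℝ} (hR : 0 ≤ R) :
    ∃ C : ℝ, 0 < C ∧ ∀ Z : E, b Z Z = -1 → |b (β i₀) Z| ≤ 1 → |b (β i₀) Z * b Z₁ Z| ≤ R →
      ‖∑' k, kernelTerm b β u v Z (latticeTuple β h k)‖ ≤ C * |b (β i₀) Z| := by
  classical
  set e := β i₀ with he'
  have he0 : e ≠ 0 := β.ne_zero i₀
  obtain ⟨C₁, c₁, hC₁, hc₁, K₁, H₁⟩ :=
    exists_norm_kernel_not_orthogonal_le hb hZ₁ hv u β he he0 h hδ hgap
  choose C₂ c₂ hC₂ hc₂ K₂ H₂ using exists_norm_cuspTerm_le hb hZ₁ hv u β he h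
  obtain ⟨D₁, hD₁, G₁⟩ := exists_pow_mul_exp_neg_inv_sq_le K₁ hc₁ hR
  choose D₂ hD₂ G₂ using fun κ => exists_pow_mul_exp_neg_inv_sq_le (K₂ κ) (hc₂ κ) hR
  have hsum0 : 0 ≤ ∑ κ, C₂ κ * D₂ κ :=
    Finset.sum_nonneg fun κ _ => (mul_pos (hC₂ κ) (hD₂ κ)).le
  refine ⟨C₁ * D₁ + ∑ κ, C₂ κ * D₂ κ, by positivity, fun Z hZ hη1 hηR => ?_⟩
  have hη : b e Z ≠ 0 := hb.apply_ne_zero_of_isotropic hZ he he0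
  have hη0 : 0 < |b e Z| := abs_pos.mpr hη
  set ν := (R + 1) / |b e Z| with hν
  have hν1 : 1 ≤ ν := by rw [hν, le_div_iff₀ hη0]; linarith
  have hνZ : |b Z₁ Z| ≤ ν := by
    rw [hν, le_div_iff₀ hη0, mul_comm, ← abs_mul]; linarith
  obtain ⟨hs₁, hb₁⟩ := H₁ Z ν hZ hν1 hνZ
  have hs₂ : ∀ κ, Summable fun k => cuspTerm b β u v e Z₁ Z κ (latticeTuple β h k) := fun κ =>
    summable_cuspTerm hb hZ₁ hv u β h e Z₁ κ hZ
  have hd : b Z₁ e ≠ 0 := by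
    rw [hb.symm]; exact hb.apply_ne_zero_of_isotropic hZ₁ he he0
  have hsplit : ∀ k, kernelTerm b β u v Z (latticeTuple β h k) =
      (if ∀ s, b (latticeTuple β h k s) e = 0 then 0 else
        kernelTerm b β u v Z (latticeTuple β h k)) +
      ∑ κ, cuspTerm b β u v e Z₁ Z κ (latticeTuple β h k) := fun k => by
    by_cases hk : ∀ s, b (latticeTuple β h k s) e = 0
    · rw [if_pos hk, zero_add, sum_cuspTerm hb.symm hv.det_pos.ne'.isUnit β he hd Z hk]
    · simp [cuspTerm, if_neg hk]
  rw [tsum_congr hsplit, hs₁.tsum_add (summable_sum fun κ _ => hs₂ κ),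
    Summable.tsum_finsetSum fun κ _ => hs₂ κ]
  refine (norm_add_le _ _).trans ?_
  rw [add_mul]
  refine add_le_add (hb₁.trans ?_) ((norm_sum_le _ _).trans ?_)
  · rw [mul_assoc, mul_assoc]
    exact mul_le_mul_of_nonneg_left (G₁ _ hη) hC₁.le
  · rw [Finset.sum_mul]
    refine Finset.sum_le_sum fun κ _ => (H₂ κ Z ν hZ hν1 hνZ hη1).trans ?_
    rw [mul_assoc, mul_assoc]
    exact mul_le_mul_of_nonneg_left (G₂ κ _ hη) (hC₂ κ).le

end CuspEstimate

/-! ### Hyperbolic volume as Lebesgue measure on a truncated cone -/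

section Cone

open MeasureTheory
open scoped ENNReal

/-- The truncated forward light cone: the vectors `x` with `x_n > 0` and `-1 < (x,x) < 0` in
`ℝ^{n,1}`. -/
def cone (n : ℕ) : Set (Fin (n + 1) → ℝ) :=
  {x | 0 < x (Fin.last n) ∧ ∑ i : Fin n, x i.castSucc ^ 2 < x (Fin.last n) ^ 2 ∧
    x (Fin.last n) ^ 2 < 1 + ∑ i : Fin n, x i.castSucc ^ 2}

/-- The length `√(-(x,x))` of a timelike vector. -/
noncomputable def coneHeight {n : ℕ} (x : Fin (n + 1) → ℝ) : ℝ :=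
  √(x (Fin.last n) ^ 2 - ∑ i : Fin n, x i.castSucc ^ 2)

/-- The chart coordinate of the point of hyperbolic space on the ray through `x`. -/
noncomputable def coneProj {n : ℕ} (x : Fin (n + 1) → ℝ) : Fin n → ℝ :=
  (coneHeight x)⁻¹ • fun i => x i.castSucc

lemma measurableSet_cone (n : ℕ) : MeasurableSet (cone n) := by
  have h1 : Measurable fun x : Fin (n + 1) → ℝ => ∑ i : Fin n, x i.castSucc ^ 2 := by fun_prop
  have h2 : Measurable fun x : Fin (n + 1) → ℝ => x (Fin.last n) ^ 2 := by fun_prop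
  exact (measurableSet_lt measurable_const (measurable_pi_apply _)).inter
    ((measurableSet_lt h1 h2).inter (measurableSet_lt h2 (h1.const_add 1)))

lemma measurable_coneProj (n : ℕ) : Measurable (coneProj : (Fin (n + 1) → ℝ) → Fin n → ℝ) := by
  unfold coneProj coneHeight
  fun_prop

/-- The substitution `t = √(s² + q)`. -/
lemma lintegral_Ioo_sqrt {q : ℝ} (hq : 0 ≤ q) (K : ℝ → ℝ≥0∞) :
    ∫⁻ t in {t : ℝ | 0 < t ∧ q < t ^ 2 ∧ t ^ 2 < 1 + q}, K (√(t ^ 2 - q)) =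
      ∫⁻ s in Set.Ioo (0 : ℝ) 1, ENNReal.ofReal (s / √(s ^ 2 + q)) * K s := by
  have himage : (fun s : ℝ => √(s ^ 2 + q)) '' Set.Ioo (0 : ℝ) 1 =
      {t : ℝ | 0 < t ∧ q < t ^ 2 ∧ t ^ 2 < 1 + q} := by
    ext t
    constructor
    · rintro ⟨s, ⟨hs0, hs1⟩, rfl⟩
      have h : √(s ^ 2 + q) ^ 2 = s ^ 2 + q := Real.sq_sqrt (by positivity)
      refine ⟨Real.sqrt_pos.mpr (by positivity), ?_, ?_⟩
      · rw [h]; have := pow_pos hs0 2; linarith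
      · rw [h]; nlinarith
    · rintro ⟨ht, h1, h2⟩
      refine ⟨√(t ^ 2 - q), ⟨Real.sqrt_pos.mpr (by linarith), ?_⟩, ?_⟩
      · rw [Real.sqrt_lt' one_pos]; linarith
      · simp only
        rw [Real.sq_sqrt (by linarith), sub_add_cancel, Real.sqrt_sq ht.le]
  rw [← himage, lintegral_image_eq_lintegral_abs_deriv_mul (f' := fun s => s / √(s ^ 2 + q))
    measurableSet_Ioo]
  · refine setLIntegral_congr_fun measurableSet_Ioo fun s hs => ?_
    have h : √(s ^ 2 + q) ^ 2 = s ^ 2 + q := Real.sq_sqrt (by positivity)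
    rw [h, add_sub_cancel_right, Real.sqrt_sq hs.1.le,
      abs_of_nonneg (div_nonneg hs.1.le (Real.sqrt_nonneg _))]
  · intro s hs
    have hpos : s ^ 2 + q ≠ 0 := by have := pow_pos hs.1 2; linarith
    have h := (((hasDerivAt_pow 2 s).add_const q).sqrt hpos).hasDerivWithinAt (s := Set.Ioo 0 1)
    have h' : ((2 : ℕ) : ℝ) * s ^ (2 - 1) / (2 * √(s ^ 2 + q)) = s / √(s ^ 2 + q) := by
      push_cast
      rw [pow_one, mul_div_mul_left _ _ two_ne_zero]
    rwa [h'] at h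
  · intro s hs t ht hst
    have h1 : s ^ 2 + q = t ^ 2 + q := by
      have := congrArg (· ^ 2) hst
      simp only at this
      rwa [Real.sq_sqrt (by positivity), Real.sq_sqrt (by positivity)] at this
    exact (pow_left_inj₀ hs.1.le ht.1.le two_ne_zero).mp (by linarith)

lemma lintegral_comp_inv_smul {n : ℕ} {s : ℝ} (hs : 0 < s) {g : (Fin n → ℝ) → ℝ≥0∞}
    (hg : Measurable g) : ∫⁻ x, g (s⁻¹ • x) = ENNReal.ofReal (s ^ n) * ∫⁻ x, g x := by
  have h := Measure.map_addHaar_smul (volume : Measure (Fin n → ℝ)) (inv_ne_zero hs.ne')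
  rw [← lintegral_map (μ := volume) hg (measurable_const_smul s⁻¹), h, lintegral_smul_measure,
    Module.finrank_fin_fun, smul_eq_mul]
  congr 2
  rw [inv_pow, inv_inv, abs_of_pos (by positivity)]

/-- Integration over hyperbolic space, in the hyperboloid chart, is integration over the truncated
cone of functions that are constant on rays. -/
lemma lintegral_cone {n : ℕ} {k : (Fin n → ℝ) → ℝ≥0∞} (hk : Measurable k) :
    ∫⁻ x in cone n, k (coneProj x) = (∫⁻ s in Set.Ioo (0 : ℝ) 1, ENNReal.ofReal (s ^ n)) *
      ∫⁻ y, ENNReal.ofReal (1 / √(1 + ∑ i, y i ^ 2)) * k y := by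
  set C : Set (ℝ × (Fin n → ℝ)) :=
    {p | 0 < p.1 ∧ ∑ i, p.2 i ^ 2 < p.1 ^ 2 ∧ p.1 ^ 2 < 1 + ∑ i, p.2 i ^ 2} with hC
  have hCm : MeasurableSet C := by
    have h1 : Measurable fun p : ℝ × (Fin n → ℝ) => ∑ i, p.2 i ^ 2 := by fun_prop
    have h2 : Measurable fun p : ℝ × (Fin n → ℝ) => p.1 ^ 2 := by fun_prop
    exact (measurableSet_lt measurable_const measurable_fst).inter
      ((measurableSet_lt h1 h2).inter (measurableSet_lt h2 (h1.const_add 1)))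
  set G : ℝ × (Fin n → ℝ) → ℝ≥0∞ :=
    C.indicator fun p => k ((√(p.1 ^ 2 - ∑ i, p.2 i ^ 2))⁻¹ • p.2) with hG
  have hGm : Measurable G := Measurable.indicator (hk.comp (by fun_prop)) hCm
  have h1 : ∫⁻ x in cone n, k (coneProj x) = ∫⁻ p, G p := by
    rw [← (volume_preserving_piFinSuccAbove (fun _ : Fin (n + 1) => ℝ)
      (Fin.last n)).lintegral_comp hGm,
      ← lintegral_indicator (measurableSet_cone n)]
    refine lintegral_congr fun x => ?_
    have hx : MeasurableEquiv.piFinSuccAbove (fun _ : Fin (n + 1) => ℝ) (Fin.last n) x =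
        (x (Fin.last n), fun i => x i.castSucc) := by
      refine Prod.ext rfl (funext fun i => ?_)
      change x ((Fin.last n).succAbove i) = _
      rw [Fin.succAbove_last]
    rw [hx]
    by_cases hxc : x ∈ cone n
    · rw [Set.indicator_of_mem hxc, hG, Set.indicator_of_mem (show _ ∈ C from hxc)]
      rfl
    · rw [Set.indicator_of_notMem hxc, hG, Set.indicator_of_notMem (show _ ∉ C from hxc)]
  have h2 : ∀ x : Fin n → ℝ, ∫⁻ t, G (t, x) = ∫⁻ s in Set.Ioo (0 : ℝ) 1,
      ENNReal.ofReal (s / √(s ^ 2 + ∑ i, x i ^ 2)) * k (s⁻¹ • x) := fun x => by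
    have hq : 0 ≤ ∑ i, x i ^ 2 := Finset.sum_nonneg fun _ _ => sq_nonneg _
    rw [← lintegral_Ioo_sqrt hq fun s => k (s⁻¹ • x)]
    have h3 : Measurable fun t : ℝ => t ^ 2 := by fun_prop
    have h4 : MeasurableSet {t : ℝ | 0 < t ∧ ∑ i, x i ^ 2 < t ^ 2 ∧ t ^ 2 < 1 + ∑ i, x i ^ 2} :=
      (measurableSet_lt measurable_const measurable_id).inter
        ((measurableSet_lt measurable_const h3).inter (measurableSet_lt h3 measurable_const))
    rw [← lintegral_indicator h4]
    rfl
  rw [h1, Measure.volume_eq_prod, lintegral_prod_symm' _ hGm]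
  simp only [h2]
  rw [lintegral_lintegral_swap (by
    refine Measurable.aemeasurable ?_
    exact Measurable.mul (by fun_prop) (hk.comp (by fun_prop)))]
  rw [← lintegral_mul_const _ (by fun_prop)]
  refine setLIntegral_congr_fun measurableSet_Ioo fun s hs => ?_
  have hs0 := hs.1
  have h3 : ∀ x : Fin n → ℝ, ENNReal.ofReal (s / √(s ^ 2 + ∑ i, x i ^ 2)) * k (s⁻¹ • x) =
      (fun y : Fin n → ℝ => ENNReal.ofReal (1 / √(1 + ∑ i, y i ^ 2)) * k y) (s⁻¹ • x) := fun x => by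
    simp only [Pi.smul_apply, smul_eq_mul, mul_pow, ← Finset.mul_sum]
    congr 2
    have : s ^ 2 + ∑ i, x i ^ 2 = s ^ 2 * (1 + s⁻¹ ^ 2 * ∑ i, x i ^ 2) := by field_simp
    rw [this, Real.sqrt_mul (by positivity), Real.sqrt_sq hs0.le]
    field_simp
  simp only [h3]
  have hm : Measurable fun y : Fin n → ℝ => ENNReal.ofReal (1 / √(1 + ∑ i, y i ^ 2)) := by fun_prop
  exact lintegral_comp_inv_smul hs0 (hm.mul hk)

lemma lintegral_Ioo_pow_ne_zero (n : ℕ) :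
    ∫⁻ s in Set.Ioo (0 : ℝ) 1, ENNReal.ofReal (s ^ n) ≠ 0 := by
  rw [← lintegral_indicator measurableSet_Ioo, Ne, lintegral_eq_zero_iff' (by
    exact ((by fun_prop : Measurable fun s : ℝ => ENNReal.ofReal (s ^ n)).indicator
      measurableSet_Ioo).aemeasurable)]
  intro h
  have h1 : (volume : Measure ℝ) (Set.Ioo (0 : ℝ) 1) = 0 := by
    refine measure_mono_null (fun s hs => ?_) (ae_iff.mp h)
    simp only [Set.mem_ofPred_eq, Set.indicator_of_mem hs, Pi.zero_apply, ENNReal.ofReal_eq_zero,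
      not_le]
    exact pow_pos hs.1 n
  simp at h1

end Cone

section Unfolding

open MeasureTheory
open scoped ENNReal

/-- Unfolding: if the translates of finitely many sets `S_t` cover `F`, and the translates of
`F` are disjoint up to null sets, the integral over `F` of an invariant function is at most the sum
of its integrals over the `S_t`. -/
lemma setLIntegral_le_sum_of_translates {α G ι : Type*} [MeasurableSpace α] {μ : Measure α}
    [Countable G] (A : G → α ≃ᵐ α) (hA : ∀ g, MeasurePreserving (A g) μ μ) {F : Set α}
    (hF : MeasurableSet F) (T : Finset ι) {S : ι → Set α} (hS : ∀ t ∈ T, MeasurableSet (S t))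
    (hcover : ∀ x ∈ F, ∃ t ∈ T, ∃ g, ∃ y ∈ S t, A g y = x)
    (hdisj : ∀ g g', g ≠ g' → μ (A g ⁻¹' F ∩ A g' ⁻¹' F) = 0) {k : α → ℝ≥0∞}
    (hk : ∀ t ∈ T, ∀ x ∈ S t, ∀ g, A g x ∈ F → k (A g x) = k x) :
    ∫⁻ x in F, k x ∂μ ≤ ∑ t ∈ T, ∫⁻ x in S t, k x ∂μ := by
  have h1 : F ⊆ ⋃ t : T, ⋃ g, (A g '' S t ∩ F) := fun x hx => by
    obtain ⟨t, ht, g, y, hy, rfl⟩ := hcover x hx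
    exact Set.mem_iUnion.mpr ⟨⟨t, ht⟩, Set.mem_iUnion.mpr ⟨g, ⟨y, hy, rfl⟩, hx⟩⟩
  calc ∫⁻ x in F, k x ∂μ ≤ ∫⁻ x in ⋃ t : T, ⋃ g, (A g '' S t ∩ F), k x ∂μ :=
        lintegral_mono_set h1
    _ ≤ ∑' t : T, ∫⁻ x in ⋃ g, (A g '' S t ∩ F), k x ∂μ := lintegral_iUnion_le _ _
    _ = ∑ t ∈ T, ∫⁻ x in ⋃ g, (A g '' S t ∩ F), k x ∂μ := by
        rw [tsum_fintype, Finset.sum_coe_sort T fun t => ∫⁻ x in ⋃ g, (A g '' S t ∩ F), k x ∂μ]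
    _ ≤ _ := Finset.sum_le_sum fun t ht => ?_
  have h2 : ∀ g, ∫⁻ x in A g '' S t ∩ F, k x ∂μ = ∫⁻ x in S t ∩ A g ⁻¹' F, k x ∂μ := fun g => by
    rw [← (hA g).setLIntegral_comp_preimage_emb (A g).measurableEmbedding]
    have h3 : A g ⁻¹' (A g '' S t ∩ F) = S t ∩ A g ⁻¹' F := by
      rw [Set.preimage_inter, Set.preimage_image_eq _ (A g).injective]
    rw [h3]
    exact setLIntegral_congr_fun ((hS t ht).inter ((A g).measurable hF))
      fun x hx => hk t ht x hx.1 g hx.2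
  calc _ ≤ ∑' g, ∫⁻ x in A g '' S t ∩ F, k x ∂μ := lintegral_iUnion_le _ _
    _ = ∑' g, ∫⁻ x in S t ∩ A g ⁻¹' F, k x ∂μ := by simp only [h2]
    _ = ∫⁻ x in ⋃ g, (S t ∩ A g ⁻¹' F), k x ∂μ := by
        rw [lintegral_iUnion₀ (fun g => ((hS t ht).inter ((A g).measurable hF)).nullMeasurableSet)]
        intro g g' hgg
        have h3 : (S t ∩ A g ⁻¹' F) ∩ (S t ∩ A g' ⁻¹' F) ⊆ A g ⁻¹' F ∩ A g' ⁻¹' F :=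
          fun x hx => ⟨hx.1.2, hx.2.2⟩
        exact measure_mono_null h3 (hdisj g g' hgg)
    _ ≤ _ := lintegral_mono_set (Set.iUnion_subset fun g => Set.inter_subset_left)

end Unfolding

/-! ### Integrals over quotients of hyperbolic space -/

section Frame

variable {E : Type*} [AddCommGroup E] [Module ℝ E] {n : ℕ} {b : LinearMap.BilinForm ℝ E}
  {f : Fin (n + 1) → E}

lemma sum_chart_castSucc_sq (y : Fin n → ℝ) :
    ∑ i : Fin n, chart n y i.castSucc ^ 2 = ∑ i, y i ^ 2 := by simp [chart]

lemma chart_last (y : Fin n → ℝ) : chart n y (Fin.last n) = √(1 + ∑ i, y i ^ 2) := by simp [chart]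

lemma chart_castSucc (y : Fin n → ℝ) (i : Fin n) : chart n y i.castSucc = y i := by simp [chart]

lemma chart_last_sq (y : Fin n → ℝ) : chart n y (Fin.last n) ^ 2 = 1 + ∑ i, y i ^ 2 := by
  rw [chart_last, Real.sq_sqrt]
  have : 0 ≤ ∑ i, y i ^ 2 := Finset.sum_nonneg fun _ _ => sq_nonneg _
  positivity

namespace IsLorentzFrame

variable (hf : IsLorentzFrame b f)
include hf

lemma apply_sum_right (x : Fin (n + 1) → ℝ) (j : Fin (n + 1)) :
    b (∑ k, x k • f k) (f j) = if j = Fin.last n then -x j else x j := by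
  rw [LinearMap.map_sum₂]
  simp only [map_smul, LinearMap.smul_apply, smul_eq_mul, hf _ _]
  simp only [mul_ite, mul_zero, Finset.sum_ite_eq', Finset.mem_univ, if_true]
  split_ifs <;> ring

lemma apply_sum_sum (x z : Fin (n + 1) → ℝ) : b (∑ k, x k • f k) (∑ k, z k • f k) =
    ∑ i : Fin n, x i.castSucc * z i.castSucc - x (Fin.last n) * z (Fin.last n) := by
  rw [map_sum]
  simp only [map_smul, smul_eq_mul, hf.apply_sum_right]
  rw [Fin.sum_univ_castSucc]
  simp only [Fin.castSucc_ne_last, if_false, if_true]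
  simp only [mul_comm, mul_neg]
  ring

lemma linearIndependent : LinearIndependent ℝ f := by
  rw [Fintype.linearIndependent_iff]
  intro x hx j
  have h := hf.apply_sum_right x j
  rw [hx, map_zero, LinearMap.zero_apply] at h
  split_ifs at h <;> linarith

lemma hypPoint_self (y : Fin n → ℝ) : b (hypPoint f y) (hypPoint f y) = -1 := by
  rw [hypPoint, hf.apply_sum_sum, ← sq, chart_last_sq]
  simp only [← sq, sum_chart_castSucc_sq]
  ring

lemma hypPoint_last (y : Fin n → ℝ) :
    b (hypPoint f y) (f (Fin.last n)) = -√(1 + ∑ i, y i ^ 2) := by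
  rw [hypPoint, hf.apply_sum_right, if_pos rfl, chart_last]

lemma apply_last_last : b (f (Fin.last n)) (f (Fin.last n)) = -1 := by simp [hf _ _]

lemma hypPoint_last_neg (y : Fin n → ℝ) : b (hypPoint f y) (f (Fin.last n)) < 0 := by
  rw [hf.hypPoint_last, neg_lt_zero]
  have : 0 ≤ ∑ i, y i ^ 2 := Finset.sum_nonneg fun _ _ => sq_nonneg _
  exact Real.sqrt_pos.mpr (by positivity)

end IsLorentzFrame

omit [Module ℝ E] in
lemma coneHeight_mem {x : Fin (n + 1) → ℝ} (hx : x ∈ cone n) :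
    0 < coneHeight x ∧ coneHeight x < 1 := by
  obtain ⟨_, h1, h2⟩ := hx
  refine ⟨Real.sqrt_pos.mpr (by linarith), ?_⟩
  rw [coneHeight, Real.sqrt_lt' one_pos]
  linarith

lemma coneHeight_smul_chart {x : Fin (n + 1) → ℝ} (hx : x ∈ cone n) :
    coneHeight x • chart n (coneProj x) = x := by
  obtain ⟨hs, _⟩ := coneHeight_mem hx
  obtain ⟨h0, h1, h2⟩ := hx
  funext k
  rw [Pi.smul_apply, smul_eq_mul]
  refine Fin.lastCases ?_ (fun i => ?_) k
  · have hsq : coneHeight x ^ 2 = x (Fin.last n) ^ 2 - ∑ i : Fin n, x i.castSucc ^ 2 :=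
      Real.sq_sqrt (by linarith)
    rw [chart_last]
    refine (pow_left_inj₀ (by positivity) h0.le two_ne_zero).mp ?_
    have : 0 ≤ ∑ i, coneProj x i ^ 2 := Finset.sum_nonneg fun _ _ => sq_nonneg _
    rw [mul_pow, Real.sq_sqrt (by positivity)]
    simp only [coneProj, Pi.smul_apply, smul_eq_mul, mul_pow, ← Finset.mul_sum]
    field_simp
    linarith
  · rw [chart_castSucc]
    simp only [coneProj, Pi.smul_apply, smul_eq_mul]
    field_simp

/-- A vector of the cone is a multiple of a point of hyperbolic space. -/
lemma sum_smul_eq_coneHeight_smul (f : Fin (n + 1) → E) {x : Fin (n + 1) → ℝ} (hx : x ∈ cone n) :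
    ∑ k, x k • f k = coneHeight x • hypPoint f (coneProj x) := by
  rw [hypPoint, Finset.smul_sum]
  refine Finset.sum_congr rfl fun k _ => ?_
  rw [smul_smul]
  congr 1
  exact (congrFun (coneHeight_smul_chart hx) k).symm

lemma mem_cone_iff (hf : IsLorentzFrame b f) (x : Fin (n + 1) → ℝ) :
    x ∈ cone n ↔ b (∑ k, x k • f k) (f (Fin.last n)) < 0 ∧
      -1 < b (∑ k, x k • f k) (∑ k, x k • f k) ∧ b (∑ k, x k • f k) (∑ k, x k • f k) < 0 := by
  rw [hf.apply_sum_right, hf.apply_sum_sum, if_pos rfl]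
  simp only [← sq]
  constructor
  · rintro ⟨h0, h1, h2⟩
    exact ⟨by linarith, by linarith, by linarith⟩
  · rintro ⟨h0, h1, h2⟩
    exact ⟨by linarith, by linarith, by linarith⟩

variable (fb : Module.Basis (Fin (n + 1)) ℝ E)

/-- A linear automorphism in the coordinates of the frame. -/
noncomputable def coordMap (fb : Module.Basis (Fin (n + 1)) ℝ E) (g : E ≃ₗ[ℝ] E) :
    (Fin (n + 1) → ℝ) ≃ᵐ (Fin (n + 1) → ℝ) :=
  (fb.equivFun.symm ≪≫ₗ g ≪≫ₗ fb.equivFun).toContinuousLinearEquiv.toHomeomorph.toMeasurableEquiv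

lemma coordMap_apply (g : E ≃ₗ[ℝ] E) (x : Fin (n + 1) → ℝ) :
    coordMap fb g x = fb.equivFun (g (fb.equivFun.symm x)) := rfl

lemma sum_coordMap (hfb : ⇑fb = f) (g : E ≃ₗ[ℝ] E) (x : Fin (n + 1) → ℝ) :
    ∑ k, coordMap fb g x k • f k = g (∑ k, x k • f k) := by
  rw [coordMap_apply, ← hfb, ← fb.equivFun_symm_apply, LinearEquiv.symm_apply_apply,
    fb.equivFun_symm_apply]

open MeasureTheory in
lemma measurePreserving_coordMap (hs : ∀ x y, b x y = b y x)
    (hnd : ∀ x, (∀ y, b x y = 0) → x = 0) (g : E ≃ₗ[ℝ] E)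
    (hg : ∀ x y, b (g x) (g y) = b x y) : MeasurePreserving (coordMap fb g) volume volume := by
  have : FiniteDimensional ℝ E := fb.finiteDimensional_of_finite
  have h1 : LinearMap.det (g : E →ₗ[ℝ] E) ^ 2 = 1 := det_sq_of_isometry hnd hs _ hg
  set L : (Fin (n + 1) → ℝ) →ₗ[ℝ] (Fin (n + 1) → ℝ) :=
    fb.equivFun.toLinearMap ∘ₗ (g : E →ₗ[ℝ] E) ∘ₗ fb.equivFun.symm.toLinearMap with hL
  have h2 : LinearMap.det L = LinearMap.det (g : E →ₗ[ℝ] E) := LinearMap.det_conj _ _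
  have h3 : LinearMap.det L ≠ 0 := fun h => by rw [← h2, h] at h1; norm_num at h1
  refine ⟨(coordMap fb g).measurable, ?_⟩
  have h4 := Measure.map_linearMap_addHaar_eq_smul_addHaar (volume : Measure (Fin (n + 1) → ℝ)) h3
  have h5 : |(LinearMap.det L)⁻¹| = 1 := by
    rw [h2, abs_inv, inv_eq_one]
    exact (pow_left_inj₀ (abs_nonneg _) zero_le_one two_ne_zero).mp (by rw [sq_abs, h1, one_pow])
  rw [h5, ENNReal.ofReal_one, one_smul] at h4
  exact h4

end Frame

section Quotient

open MeasureTheory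
open scoped ENNReal

variable {E : Type*} [AddCommGroup E] [Module ℝ E] {n : ℕ} {b : LinearMap.BilinForm ℝ E}
  (hb : IsHyperbolic b) {f : Fin (n + 1) → E} (hf : IsLorentzFrame b f)
  (fb : Module.Basis (Fin (n + 1)) ℝ E) (hfb : ⇑fb = f)
include hb hf hfb

/-- An invariant function on hyperbolic space has finite integral over a set `F` with disjoint
translates if its integrals over finitely many sets, whose translates cover hyperbolic space, are
finite. -/
lemma lintegral_chart_lt_top {G ι : Type*} [Countable G] (ρ : G → E ≃ₗ[ℝ] E)
    (hρ : ∀ g x y, b (ρ g x) (ρ g y) = b x y)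
    (hρ' : ∀ g Z, b Z Z = -1 → (b (ρ g Z) (f (Fin.last n)) < 0 ↔ b Z (f (Fin.last n)) < 0))
    {F : Set (Fin n → ℝ)} (hF : MeasurableSet F)
    (hdisj : ∀ g g', g ≠ g' → volume {y | y ∈ F ∧ ∃ y' ∈ F, ∃ Z, ρ g Z = hypPoint f y ∧
      ρ g' Z = hypPoint f y'} = 0)
    {k : E → ℝ≥0∞} (hkm : Measurable fun y => k (hypPoint f y))
    (hk : ∀ g Z, b Z Z = -1 → b Z (f (Fin.last n)) < 0 → k (ρ g Z) = k Z)
    (T : Finset ι) {S : ι → Set E} (hS : ∀ t ∈ T, MeasurableSet {y | hypPoint f y ∈ S t})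
    (hcover : ∀ Z, b Z Z = -1 → b Z (f (Fin.last n)) < 0 → ∃ t ∈ T, ∃ g, ∃ Z' ∈ S t, ρ g Z' = Z)
    (hfin : ∀ t ∈ T, ∫⁻ x in cone n ∩ coneProj ⁻¹' {y | hypPoint f y ∈ S t},
      k (hypPoint f (coneProj x)) < ∞) :
    ∫⁻ y in F, ENNReal.ofReal (1 / √(1 + ∑ i, y i ^ 2)) * k (hypPoint f y) < ∞ := by
  have hlast := hf.apply_last_last
  have hnd : ∀ x, (∀ y, b x y = 0) → x = 0 := fun x hx => hb.eq_zero_of_forall hlast hx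
  set A := fun g => coordMap fb (ρ g) with hA
  have hAmp : ∀ g, MeasurePreserving (A g) volume volume := fun g =>
    measurePreserving_coordMap fb hb.symm hnd (ρ g) (hρ g)
  have hAsum : ∀ g x, ∑ k, A g x k • f k = ρ g (∑ k, x k • f k) := fun g x =>
    sum_coordMap fb hfb (ρ g) x
  have hunit : ∀ y, b (hypPoint f y) (hypPoint f y) = -1 := hf.hypPoint_self
  -- the group acts on the cone, compatibly with the projection to hyperbolic space
  have hAcone : ∀ g x, A g x ∈ cone n ↔ x ∈ cone n := by
    have hsgn : ∀ (h : E ≃ₗ[ℝ] E), (∀ x y, b (h x) (h y) = b x y) →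
        (∀ Z, b Z Z = -1 → b Z (f (Fin.last n)) < 0 → b (h Z) (f (Fin.last n)) < 0) →
        ∀ x, x ∈ cone n → coordMap fb h x ∈ cone n := fun h hh hh' x hx => by
      rw [mem_cone_iff hf, sum_coordMap fb hfb, hh]
      refine ⟨?_, ((mem_cone_iff hf x).mp hx).2⟩
      have h1 := hh' _ (hunit (coneProj x)) (hf.hypPoint_last_neg _)
      rw [sum_smul_eq_coneHeight_smul f hx, map_smul, map_smul, LinearMap.smul_apply, smul_eq_mul]
      exact mul_neg_of_pos_of_neg (coneHeight_mem hx).1 h1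
    intro g x
    refine ⟨fun h => ?_, fun h => hsgn (ρ g) (hρ g) (fun Z hZ hZ' => (hρ' g Z hZ).mpr hZ') x h⟩
    have h1 := hsgn (ρ g).symm (fun x y => by rw [← hρ g]; simp)
      (fun Z hZ hZ' => (hρ' g _ (by rw [← hρ g]; simpa using hZ)).mp (by simpa using hZ')) _ h
    have h2 : coordMap fb (ρ g).symm (A g x) = x := by
      rw [coordMap_apply]
      change fb.equivFun ((ρ g).symm (fb.equivFun.symm
        (fb.equivFun (ρ g (fb.equivFun.symm x))))) = x
      rw [LinearEquiv.symm_apply_apply, LinearEquiv.symm_apply_apply, LinearEquiv.apply_symm_apply]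
    rwa [h2] at h1
  have hAproj : ∀ g x, x ∈ cone n →
      ρ g (hypPoint f (coneProj x)) = hypPoint f (coneProj (A g x)) := by
    intro g x hx
    have hx' := (hAcone g x).mpr hx
    have h1 := hAsum g x
    rw [sum_smul_eq_coneHeight_smul f hx, sum_smul_eq_coneHeight_smul f hx', map_smul] at h1
    have h2 : coneHeight (A g x) = coneHeight x := by
      have h3 := congrArg (fun Z => b Z Z) h1
      simp only [map_smul, LinearMap.smul_apply, smul_eq_mul, hρ, hunit] at h3
      nlinarith [(coneHeight_mem hx).1, (coneHeight_mem hx').1]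
    rw [h2] at h1
    exact (smul_right_injective _ (coneHeight_mem hx).1.ne' h1).symm
  have hFm : MeasurableSet (cone n ∩ coneProj ⁻¹' F) :=
    (measurableSet_cone n).inter (measurable_coneProj n hF)
  -- null sets of the chart give null sets of the cone
  have hnull : ∀ N : Set (Fin n → ℝ), volume N = 0 →
      (volume : Measure (Fin (n + 1) → ℝ)) (cone n ∩ coneProj ⁻¹' N) = 0 := fun N hN => by
    set N' := toMeasurable volume N
    have hN' : volume N' = 0 := by rw [measure_toMeasurable, hN]
    have hN'm : MeasurableSet N' := measurableSet_toMeasurable _ _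
    have h1 := lintegral_cone (n := n) (k := N'.indicator 1) (measurable_one.indicator hN'm)
    have h2 : ∫⁻ y : Fin n → ℝ, ENNReal.ofReal (1 / √(1 + ∑ i, y i ^ 2)) *
        N'.indicator (1 : (Fin n → ℝ) → ℝ≥0∞) y = 0 := by
      rw [lintegral_eq_zero_iff' (by
        have hm : Measurable fun y : Fin n → ℝ => ENNReal.ofReal (1 / √(1 + ∑ i, y i ^ 2)) := by
          fun_prop
        exact (hm.mul (measurable_one.indicator hN'm)).aemeasurable)]
      refine measure_mono_null (fun y hy => ?_) hN'
      by_contra hy'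
      refine hy ?_
      change _ * N'.indicator 1 y = 0
      rw [Set.indicator_of_notMem hy', mul_zero]
    rw [h2, mul_zero] at h1
    have h3 : ∫⁻ x in cone n, N'.indicator (1 : (Fin n → ℝ) → ℝ≥0∞) (coneProj x) =
        volume (cone n ∩ coneProj ⁻¹' N') := by
      have h4 : (fun x : Fin (n + 1) → ℝ => N'.indicator (1 : (Fin n → ℝ) → ℝ≥0∞) (coneProj x)) =
          (coneProj ⁻¹' N').indicator 1 := rfl
      rw [h4, lintegral_indicator_one (measurable_coneProj n hN'm),
        Measure.restrict_apply (measurable_coneProj n hN'm), Set.inter_comm]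
    rw [h3] at h1
    exact measure_mono_null (Set.inter_subset_inter_right _
      (Set.preimage_mono (subset_toMeasurable _ _))) h1
  have hmain := setLIntegral_le_sum_of_translates A hAmp hFm T
    (S := fun t => cone n ∩ coneProj ⁻¹' {y | hypPoint f y ∈ S t})
    (fun t ht => (measurableSet_cone n).inter (measurable_coneProj n (hS t ht)))
    (by
      rintro x ⟨hx, hxF⟩
      obtain ⟨t, ht, g, Z', hZ', hg⟩ := hcover _ (hunit (coneProj x)) (hf.hypPoint_last_neg _)
      refine ⟨t, ht, g, (A g).symm x, ?_, by simp⟩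
      have h1 : (A g).symm x ∈ cone n := by rw [← hAcone g]; simpa using hx
      refine ⟨h1, ?_⟩
      have h2 := hAproj g _ h1
      rw [MeasurableEquiv.apply_symm_apply, ← hg] at h2
      change hypPoint f _ ∈ S t
      rwa [(ρ g).injective h2])
    (by
      intro g g' hgg
      have h1 : A g ⁻¹' (cone n ∩ coneProj ⁻¹' F) ∩ A g' ⁻¹' (cone n ∩ coneProj ⁻¹' F) ⊆
          A g ⁻¹' (cone n ∩ coneProj ⁻¹' {y | y ∈ F ∧ ∃ y' ∈ F, ∃ Z, ρ g Z = hypPoint f y ∧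
            ρ g' Z = hypPoint f y'}) := by
        rintro x ⟨⟨hx1, hx2⟩, ⟨hx3, hx4⟩⟩
        have hx := (hAcone g x).mp hx1
        exact ⟨hx1, hx2, _, hx4, hypPoint f (coneProj x), hAproj g x hx, hAproj g' x hx⟩
      refine measure_mono_null h1 ?_
      rw [(hAmp g).measure_preimage_equiv]
      exact hnull _ (hdisj g g' hgg))
    (k := fun x => k (hypPoint f (coneProj x)))
    (by
      rintro t ht x ⟨hx, _⟩ g _
      rw [← hAproj g x hx, hk g _ (hunit _) (hf.hypPoint_last_neg _)])
  have hfinite : ∫⁻ x in cone n ∩ coneProj ⁻¹' F, k (hypPoint f (coneProj x)) < ∞ :=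
    hmain.trans_lt (ENNReal.sum_lt_top.mpr hfin)
  have h1 := lintegral_cone (n := n) (k := F.indicator fun y => k (hypPoint f y)) (hkm.indicator hF)
  have h2 : ∫⁻ x in cone n, F.indicator (fun y => k (hypPoint f y)) (coneProj x) =
      ∫⁻ x in cone n ∩ coneProj ⁻¹' F, k (hypPoint f (coneProj x)) := by
    have h4 : (fun x : Fin (n + 1) → ℝ => F.indicator (fun y => k (hypPoint f y)) (coneProj x)) =
        (coneProj ⁻¹' F).indicator fun x => k (hypPoint f (coneProj x)) := rfl
    rw [h4, setLIntegral_indicator (measurable_coneProj n hF), Set.inter_comm]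
  have h3 : ∫⁻ y in F, ENNReal.ofReal (1 / √(1 + ∑ i, y i ^ 2)) * k (hypPoint f y) =
      ∫⁻ y, ENNReal.ofReal (1 / √(1 + ∑ i, y i ^ 2)) *
        F.indicator (fun y => k (hypPoint f y)) y := by
    rw [← lintegral_indicator hF]
    refine lintegral_congr fun y => ?_
    by_cases hy : y ∈ F <;> simp [hy]
  rw [h2] at h1
  rw [h3]
  by_contra hcon
  rw [not_lt, top_le_iff] at hcon
  rw [hcon, ENNReal.mul_top (lintegral_Ioo_pow_ne_zero n)] at h1
  exact hfinite.ne h1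

end Quotient

/-! ### Integrals over reduced regions -/

section Region

open MeasureTheory
open scoped ENNReal

variable {E : Type*} [AddCommGroup E] [Module ℝ E] {n : ℕ} {b : LinearMap.BilinForm ℝ E}
  {f : Fin (n + 1) → E}

lemma continuous_chart (n : ℕ) (k : Fin (n + 1)) : Continuous fun y : Fin n → ℝ => chart n y k := by
  refine Fin.lastCases ?_ (fun i => ?_) k
  · simp only [chart_last]; fun_prop
  · simp only [chart_castSucc]; fun_prop

lemma continuous_apply_hypPoint (b : LinearMap.BilinForm ℝ E) (f : Fin (n + 1) → E) (x : E) :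
    Continuous fun y => b x (hypPoint f y) := by
  have h : (fun y => b x (hypPoint f y)) = fun y => ∑ k, chart n y k * b x (f k) := by
    funext y
    simp [hypPoint]
  rw [h]
  exact continuous_finsetSum _ fun k _ => (continuous_chart n k).mul_const _

/-- The boost along the hyperbolic plane spanned by isotropic vectors `e`, `e'` with
`(e,e') = 1`. -/
lemma exists_boost (hs : ∀ x y, b x y = b y x) {e e' : E} (he : b e e = 0) (he' : b e' e' = 0)
    (hee : b e e' = 1) {l : ℝ} (hl : l ≠ 0) : ∃ g : E ≃ₗ[ℝ] E,
      (∀ x y, b (g x) (g y) = b x y) ∧ ∀ x, b e (g x) = l⁻¹ * b e x ∧ b e' (g x) = l * b e' x := by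
  let A : ℝ → E →ₗ[ℝ] E := fun l =>
    LinearMap.id + (l - 1) • (b e').smulRight e + (l⁻¹ - 1) • (b e).smulRight e'
  have hA : ∀ l x, A l x = x + ((l - 1) * b e' x) • e + ((l⁻¹ - 1) * b e x) • e' := fun l x => by
    simp [A, mul_smul]
  have hee' : b e' e = 1 := by rw [hs, hee]
  have h1 : ∀ l x, b e (A l x) = l⁻¹ * b e x := fun l x => by
    rw [hA]; simp only [map_add, map_smul, smul_eq_mul, he, hee]; ring
  have h2 : ∀ l x, b e' (A l x) = l * b e' x := fun l x => by
    rw [hA]; simp only [map_add, map_smul, smul_eq_mul, he', hee']; ring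
  have h3 : ∀ l, l ≠ 0 → ∀ x, A l (A l⁻¹ x) = x := fun l hl x => by
    rw [hA l (A l⁻¹ x), h1, h2, hA, inv_inv]
    have : ∀ (x : E) (a₁ a₂ b₁ b₂ : ℝ), a₁ + b₁ = 0 → a₂ + b₂ = 0 →
        x + a₁ • e + a₂ • e' + b₁ • e + b₂ • e' = x := fun x a₁ a₂ b₁ b₂ h h' => by
      rw [show x + a₁ • e + a₂ • e' + b₁ • e + b₂ • e' =
        x + (a₁ + b₁) • e + (a₂ + b₂) • e' by module, h, h', zero_smul, zero_smul, add_zero,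
        add_zero]
    refine this _ _ _ _ _ ?_ ?_ <;> field_simp <;> ring
  refine ⟨LinearEquiv.ofLinearMap (A l) (A l⁻¹) (LinearMap.ext fun x => h3 l hl x)
    (LinearMap.ext fun x => ?_), fun x y => ?_, fun x => ⟨h1 l x, h2 l x⟩⟩
  · have := h3 l⁻¹ (inv_ne_zero hl) x
    rwa [inv_inv] at this
  · change b (A l x) (A l y) = b x y
    rw [hA l x]
    simp only [map_add, map_smul, LinearMap.add_apply, LinearMap.smul_apply, smul_eq_mul, h1, h2]
    rw [hA l y]
    simp only [map_add, map_smul, smul_eq_mul, hs x e, hs x e']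
    field_simp
    ring

/-- Bounds for the products with a basis bound the products with every vector. -/
lemma exists_abs_apply_le [FiniteDimensional ℝ E] {c : Fin (n + 1) → E}
    (hc : LinearIndependent ℝ c) (hn : Module.finrank ℝ E = Fintype.card (Fin (n + 1))) (x : E)
    (R : ℝ) (b : LinearMap.BilinForm ℝ E) :
    ∃ ρ, ∀ (a : ℝ) (Z : E), (∀ i, |a * b (c i) Z| ≤ R) → |a * b x Z| ≤ ρ := by
  set cb := basisOfLinearIndependentOfCardEqFinrank hc hn.symm with hcb
  refine ⟨∑ i, |cb.repr x i| * R, fun a Z h => ?_⟩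
  have h1 : a * b x Z = ∑ i, cb.repr x i * (a * b (c i) Z) := by
    conv_lhs => rw [← cb.sum_repr x]
    rw [LinearMap.map_sum₂, Finset.mul_sum]
    refine Finset.sum_congr rfl fun i _ => ?_
    rw [hcb, coe_basisOfLinearIndependentOfCardEqFinrank, map_smul, LinearMap.smul_apply,
      smul_eq_mul]
    ring
  rw [h1]
  refine (Finset.abs_sum_le_sum_abs _ _).trans (Finset.sum_le_sum fun i _ => ?_)
  rw [abs_mul]
  exact mul_le_mul_of_nonneg_left (h i) (abs_nonneg _)

variable (hb : IsHyperbolic b) (hf : IsLorentzFrame b f)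
  (fb : Module.Basis (Fin (n + 1)) ℝ E) (hfb : ⇑fb = f)
include hb hf hfb

/-- A set of points of hyperbolic space that an isometry moves close to `f_n` has bounded cone
volume. -/
lemma volume_cone_inter_le (g : E ≃ₗ[ℝ] E) (hg : ∀ x y, b (g x) (g y) = b x y) {ρ : ℝ}
    {S : Set E} (hS : ∀ Z ∈ S, b Z Z = -1 → |b (f (Fin.last n)) (g Z)| ≤ ρ) :
    volume (cone n ∩ coneProj ⁻¹' {y | hypPoint f y ∈ S}) ≤
      volume (Set.Icc (fun _ : Fin (n + 1) => -ρ) fun _ => ρ) := by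
  have hnd : ∀ x, (∀ y, b x y = 0) → x = 0 := fun x hx => hb.eq_zero_of_forall hf.apply_last_last hx
  rw [← (measurePreserving_coordMap fb hb.symm hnd g hg).measure_preimage_equiv
    (Set.Icc _ _)]
  refine measure_mono ?_
  rintro x ⟨hx, hxS⟩
  have hZ := hf.hypPoint_self (coneProj x)
  have h1 := hS _ hxS hZ
  set Z := hypPoint f (coneProj x)
  set z : Fin (n + 1) → ℝ := fun k => fb.repr (g Z) k with hz
  have hsum : ∑ k, z k • f k = g Z := by rw [← hfb]; exact fb.sum_repr _
  have h2 : coordMap fb g x = coneHeight x • z := by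
    have h3 := sum_coordMap fb hfb g x
    rw [sum_smul_eq_coneHeight_smul f hx, map_smul, ← hsum, Finset.smul_sum, ← hfb] at h3
    funext k
    have h4 := congrArg (fun v => fb.repr v k) h3
    simpa [smul_smul, Finsupp.single_apply] using h4
  have h5 : |z (Fin.last n)| ≤ ρ := by
    rw [hb.symm, ← hsum, hf.apply_sum_right, if_pos rfl, abs_neg] at h1
    exact h1
  have h6 : ∑ i : Fin n, z i.castSucc ^ 2 - z (Fin.last n) ^ 2 = -1 := by
    have h7 := hf.apply_sum_sum z z
    rw [hsum, hg, hZ] at h7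
    simp only [sq]
    exact h7.symm
  have h7 : ∀ k, |z k| ≤ ρ := by
    refine Fin.lastCases h5 fun i => ?_
    refine le_trans (sq_le_sq.mp ?_) h5
    have := Finset.single_le_sum (f := fun i : Fin n => z i.castSucc ^ 2)
      (fun _ _ => sq_nonneg _) (Finset.mem_univ i)
    linarith
  obtain ⟨h8, h9⟩ := coneHeight_mem hx
  have h10 : ∀ k, |coordMap fb g x k| ≤ ρ := fun k => by
    rw [h2, Pi.smul_apply, smul_eq_mul, abs_mul, abs_of_pos h8]
    nlinarith [h7 k, abs_nonneg (z k)]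
  exact ⟨fun k => (abs_le.mp (h10 k)).1, fun k => (abs_le.mp (h10 k)).2⟩

lemma lintegral_compact_region_lt_top {k : E → ℝ≥0∞}
    (hk : ∀ ν, ∃ C : ℝ, ∀ Z, b Z Z = -1 → |b (f (Fin.last n)) Z| ≤ ν → k Z ≤ ENNReal.ofReal C)
    {c : Fin (n + 1) → E} (hc : LinearIndependent ℝ c) (R : ℝ) :
    ∫⁻ x in cone n ∩ coneProj ⁻¹' {y | hypPoint f y ∈ {Z | ∀ i, |b (c i) Z| ≤ R}},
      k (hypPoint f (coneProj x)) < ∞ := by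
  have hfin : FiniteDimensional ℝ E := fb.finiteDimensional_of_finite
  obtain ⟨ρ, hρ⟩ := exists_abs_apply_le hc (by rw [Module.finrank_eq_card_basis fb])
    (f (Fin.last n)) R b
  obtain ⟨C, hC⟩ := hk ρ
  have hm : MeasurableSet {y | hypPoint f y ∈ {Z | ∀ i, |b (c i) Z| ≤ R}} := by
    have h1 : {y | hypPoint f y ∈ {Z | ∀ i, |b (c i) Z| ≤ R}} =
        ⋂ i, {y | |b (c i) (hypPoint f y)| ≤ R} := by ext y; simp
    rw [h1]
    exact MeasurableSet.iInter fun i =>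
      (isClosed_le (continuous_apply_hypPoint b f (c i)).abs continuous_const).measurableSet
  calc _ ≤ ∫⁻ x in cone n ∩ coneProj ⁻¹' {y | hypPoint f y ∈ {Z | ∀ i, |b (c i) Z| ≤ R}},
        ENNReal.ofReal C := by
        refine setLIntegral_mono' ((measurableSet_cone n).inter (measurable_coneProj n hm)) ?_
        rintro x ⟨_, hx⟩
        exact hC _ (hf.hypPoint_self _) (by simpa using hρ 1 _ (by simpa using hx))
    _ = ENNReal.ofReal C * volume (cone n ∩ coneProj ⁻¹'
        {y | hypPoint f y ∈ {Z | ∀ i, |b (c i) Z| ≤ R}}) := setLIntegral_const _ _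
    _ < ∞ := by
        refine ENNReal.mul_lt_top ENNReal.ofReal_lt_top ?_
        refine (volume_cone_inter_le hb hf fb hfb (LinearEquiv.refl ℝ E) (fun _ _ => rfl)
          (ρ := ρ) fun Z hZ _ => by simpa using hρ 1 Z (by simpa using hZ)).trans_lt ?_
        exact isCompact_Icc.measure_lt_top

/-- The region around a cusp. In the layer `2^{-(j+1)} < |(e,Z)| ≤ 2^{-j}`, which a boost moves
into a fixed bounded set, the integrand is `O(2^{-j})`. -/
lemma lintegral_cusp_region_lt_top {k : E → ℝ≥0∞} {e : E} (he : b e e = 0) (he0 : e ≠ 0)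
    (hk : ∀ R, 0 ≤ R → ∃ C > 0, ∀ Z, b Z Z = -1 → |b e Z| ≤ 1 →
      |b e Z * b (f (Fin.last n)) Z| ≤ R → k Z ≤ ENNReal.ofReal (C * |b e Z|))
    {c : Fin (n + 1) → E} (hc : LinearIndependent ℝ c) (R : ℝ) :
    ∫⁻ x in cone n ∩ coneProj ⁻¹' {y | hypPoint f y ∈
        {Z | |b e Z| ≤ 1 ∧ ∀ i, |b e Z * b (c i) Z| ≤ R}},
      k (hypPoint f (coneProj x)) < ∞ := by
  have hfin : FiniteDimensional ℝ E := fb.finiteDimensional_of_finite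
  obtain ⟨R', hR'⟩ := exists_abs_apply_le hc (by rw [Module.finrank_eq_card_basis fb])
    (f (Fin.last n)) R b
  set z := f (Fin.last n) with hz
  have hzz : b z z = -1 := hf.apply_last_last
  have hR'0 : ∀ Z, (∀ i, |b e Z * b (c i) Z| ≤ R) → |b e Z * b z Z| ≤ max R' 0 := fun Z h =>
    (hR' _ Z h).trans (le_max_left _ _)
  set R₁ := max R' 0
  have hR₁ : 0 ≤ R₁ := le_max_right _ _
  obtain ⟨C, hC0, hC⟩ := hk R₁ hR₁
  set α := b e z with hα
  have hα0 : α ≠ 0 := hb.apply_ne_zero_of_isotropic hzz he he0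
  have hze : b z e = α := hb.symm _ _
  -- the isotropic vector `e'` in the plane of `e` and `f_n` with `(e,e') = 1`
  set e' : E := α⁻¹ • z + (2 * α ^ 2)⁻¹ • e with he'
  have hee : b e e' = 1 := by
    simp only [he', map_add, map_smul, smul_eq_mul, he, ← hα]
    field_simp; ring
  have hee' : b e' e' = 0 := by
    simp only [he', map_add, map_smul, smul_eq_mul, he, ← hα, LinearMap.add_apply,
      LinearMap.smul_apply, hze, hzz]
    field_simp; ring
  have hze' : z = α • e' - (2 * α)⁻¹ • e := by
    rw [he', smul_add, smul_smul, smul_smul, mul_inv_cancel₀ hα0, one_smul,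
      show α * (2 * α ^ 2)⁻¹ = (2 * α)⁻¹ by field_simp]
    abel
  set R₂ := |α⁻¹| * R₁ + |(2 * α ^ 2)⁻¹| with hR₂
  have hbe' : ∀ Z, |b e Z| ≤ 1 → |b e Z * b z Z| ≤ R₁ → |b e Z| * |b e' Z| ≤ R₂ := fun Z h1 h2 => by
    rw [← abs_mul, show b e Z * b e' Z = α⁻¹ * (b e Z * b z Z) + (2 * α ^ 2)⁻¹ * (b e Z) ^ 2 by
      simp only [he', map_add, map_smul, smul_eq_mul, LinearMap.add_apply, LinearMap.smul_apply]
      ring]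
    refine (abs_add_le _ _).trans ?_
    rw [abs_mul, abs_mul (2 * α ^ 2)⁻¹, abs_pow]
    refine add_le_add (mul_le_mul_of_nonneg_left h2 (abs_nonneg _)) ?_
    exact mul_le_of_le_one_right (abs_nonneg _) (pow_le_one₀ (abs_nonneg _) h1)
  set ρ := |α| * (2 * R₂) + |(2 * α)⁻¹| with hρ
  set V := volume (Set.Icc (fun _ : Fin (n + 1) => -ρ) fun _ => ρ) with hV
  set D : ℕ → Set E := fun j => {Z | (1 / 2 : ℝ) ^ (j + 1) < |b e Z| ∧ |b e Z| ≤ (1 / 2 : ℝ) ^ j ∧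
    |b e Z * b z Z| ≤ R₁} with hD
  have hDm : ∀ j, MeasurableSet {y | hypPoint f y ∈ D j} := fun j => by
    have c1 := (continuous_apply_hypPoint b f e)
    have c2 := (continuous_apply_hypPoint b f z)
    exact (measurableSet_lt measurable_const c1.abs.measurable).inter
      ((measurableSet_le c1.abs.measurable measurable_const).inter
        (measurableSet_le (c1.mul c2).abs.measurable measurable_const))
  have hDV : ∀ j, volume (cone n ∩ coneProj ⁻¹' {y | hypPoint f y ∈ D j}) ≤ V := fun j => by
    have hl : ((1 / 2 : ℝ) ^ j) ≠ 0 := by positivity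
    have hl0 : 0 < (1 / 2 : ℝ) ^ j := by positivity
    obtain ⟨g, hg, hg'⟩ := exists_boost hb.symm he hee' hee hl
    refine volume_cone_inter_le hb hf fb hfb g hg ?_
    rintro Z ⟨h1, h2, h3⟩ hZ
    have h4 := hbe' Z (h2.trans (pow_le_one₀ (by norm_num) (by norm_num))) h3
    have h5 : b z (g Z) = α * ((1 / 2) ^ j * b e' Z) - (2 * α)⁻¹ * (((1 / 2) ^ j)⁻¹ * b e Z) := by
      conv_lhs => rw [hze']
      rw [map_sub, map_smul, map_smul, LinearMap.sub_apply, LinearMap.smul_apply,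
        LinearMap.smul_apply, (hg' Z).1, (hg' Z).2, smul_eq_mul, smul_eq_mul]
    rw [← hz, h5]
    refine (abs_sub _ _).trans ?_
    rw [abs_mul, abs_mul, abs_mul, abs_mul, abs_inv ((1 / 2 : ℝ) ^ j), abs_of_pos hl0]
    refine add_le_add (mul_le_mul_of_nonneg_left ?_ (abs_nonneg _)) ?_
    · rw [pow_succ] at h1
      nlinarith [abs_nonneg (b e' Z)]
    · refine mul_le_of_le_one_right (abs_nonneg _) ?_
      rw [inv_mul_le_iff₀ hl0, mul_one]
      exact h2
  have hsub : cone n ∩ coneProj ⁻¹' {y | hypPoint f y ∈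
        {Z | |b e Z| ≤ 1 ∧ ∀ i, |b e Z * b (c i) Z| ≤ R}} ⊆
      ⋃ j, cone n ∩ coneProj ⁻¹' {y | hypPoint f y ∈ D j} := by
    rintro x ⟨hx, h1, h2⟩
    have h3 : 0 < |b e (hypPoint f (coneProj x))| :=
      abs_pos.mpr (hb.apply_ne_zero_of_isotropic (hf.hypPoint_self _) he he0)
    obtain ⟨j, hj1, hj2⟩ := exists_nat_pow_near_of_lt_one h3 h1 (y := (1 / 2 : ℝ)) (by norm_num)
      (by norm_num)
    exact Set.mem_iUnion.mpr ⟨j, hx, hj1, hj2, hR'0 _ h2⟩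
  calc _ ≤ ∫⁻ x in ⋃ j, cone n ∩ coneProj ⁻¹' {y | hypPoint f y ∈ D j},
        k (hypPoint f (coneProj x)) := lintegral_mono_set hsub
    _ ≤ ∑' j, ∫⁻ x in cone n ∩ coneProj ⁻¹' {y | hypPoint f y ∈ D j},
        k (hypPoint f (coneProj x)) := lintegral_iUnion_le _ _
    _ ≤ ∑' j : ℕ, ENNReal.ofReal (C * (1 / 2) ^ j) * V := by
        refine ENNReal.tsum_le_tsum fun j => ?_
        calc _ ≤ ∫⁻ x in cone n ∩ coneProj ⁻¹' {y | hypPoint f y ∈ D j},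
              ENNReal.ofReal (C * (1 / 2) ^ j) := by
              refine setLIntegral_mono'
                ((measurableSet_cone n).inter (measurable_coneProj n (hDm j))) ?_
              rintro x ⟨_, h1, h2, h3⟩
              refine (hC _ (hf.hypPoint_self _)
                (h2.trans (pow_le_one₀ (by norm_num) (by norm_num))) h3).trans ?_
              exact ENNReal.ofReal_le_ofReal (mul_le_mul_of_nonneg_left h2 hC0.le)
          _ = ENNReal.ofReal (C * (1 / 2) ^ j) *
              volume (cone n ∩ coneProj ⁻¹' {y | hypPoint f y ∈ D j}) := setLIntegral_const _ _
          _ ≤ _ := mul_le_mul_right (hDV j) _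
    _ = (∑' j : ℕ, ENNReal.ofReal (C * (1 / 2) ^ j)) * V := ENNReal.tsum_mul_right
    _ < ∞ := by
        refine ENNReal.mul_lt_top ?_ isCompact_Icc.measure_lt_top
        rw [← ENNReal.ofReal_tsum_of_nonneg (fun j => by positivity)
          ((summable_geometric_of_lt_one (by norm_num) (by norm_num)).mul_left C)]
        exact ENNReal.ofReal_lt_top

end Region

/-! ### The theta form in the hyperboloid chart -/

section ChartCoefficient

variable {E : Type*} [AddCommGroup E] [Module ℝ E] {n : ℕ} {b : LinearMap.BilinForm ℝ E}
  {f : Fin (n + 1) → E}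

lemma hasFDerivAt_sqrt_one_add_sum_sq (y : Fin n → ℝ) :
    HasFDerivAt (fun y : Fin n → ℝ => √(1 + ∑ i, y i ^ 2))
      ((√(1 + ∑ i, y i ^ 2))⁻¹ •
        ∑ i, y i • (ContinuousLinearMap.proj i : (Fin n → ℝ) →L[ℝ] ℝ)) y := by
  have h0 : 0 ≤ ∑ i, y i ^ 2 := Finset.sum_nonneg fun _ _ => sq_nonneg _
  have h1 : HasFDerivAt (fun y : Fin n → ℝ => 1 + ∑ i, y i ^ 2)
      (∑ i, (2 * y i) • (ContinuousLinearMap.proj i : (Fin n → ℝ) →L[ℝ] ℝ)) y := by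
    refine (HasFDerivAt.fun_sum fun i _ => ?_).const_add 1
    have h2 : HasFDerivAt (fun y : Fin n → ℝ => y i)
        (ContinuousLinearMap.proj i : (Fin n → ℝ) →L[ℝ] ℝ) y :=
      (ContinuousLinearMap.proj i : (Fin n → ℝ) →L[ℝ] ℝ).hasFDerivAt
    simpa using h2.pow 2
  refine (h1.sqrt (by positivity)).congr_fderiv ?_
  rw [Finset.smul_sum, Finset.smul_sum]
  refine Finset.sum_congr rfl fun i _ => ?_
  rw [smul_smul, smul_smul]
  congr 1
  field_simp

lemma differentiableAt_chart (y : Fin n → ℝ) : DifferentiableAt ℝ (chart n) y := by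
  refine differentiableAt_pi.mpr fun k => ?_
  refine Fin.lastCases ?_ (fun i => ?_) k
  · simp only [chart_last]
    exact (hasFDerivAt_sqrt_one_add_sum_sq y).differentiableAt
  · simp only [chart_castSucc]
    fun_prop

lemma fderiv_chart_apply (y w : Fin n → ℝ) (k : Fin (n + 1)) :
    fderiv ℝ (chart n) y w k = fderiv ℝ (fun y => chart n y k) y w := by
  rw [fderiv_pi (φ := fun k y => chart n y k) fun k =>
    differentiableAt_pi.mp (differentiableAt_chart y) k]
  rfl

lemma fderiv_chart_castSucc (y : Fin n → ℝ) (j i : Fin n) :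
    fderiv ℝ (chart n) y (Pi.single j 1) i.castSucc = if i = j then 1 else 0 := by
  rw [fderiv_chart_apply]
  simp only [chart_castSucc]
  rw [(hasFDerivAt_apply (𝕜 := ℝ) i y).fderiv]
  simp [Pi.single_apply]

lemma fderiv_chart_last (y : Fin n → ℝ) (j : Fin n) :
    fderiv ℝ (chart n) y (Pi.single j 1) (Fin.last n) = y j / √(1 + ∑ i, y i ^ 2) := by
  rw [fderiv_chart_apply]
  simp only [chart_last]
  rw [(hasFDerivAt_sqrt_one_add_sum_sq y).fderiv]
  simp [Pi.single_apply, div_eq_inv_mul]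

lemma hypTangent_eq (f : Fin (n + 1) → E) (y : Fin n → ℝ) (j : Fin n) :
    hypTangent f y j = f j.castSucc + (y j / √(1 + ∑ i, y i ^ 2)) • f (Fin.last n) := by
  rw [hypTangent, Fin.sum_univ_castSucc, fderiv_chart_last]
  simp [fderiv_chart_castSucc]

/-- The value of the wedge of the covectors `(x_s, ·)` on the coordinate tangent vectors, in
terms of the volume of `(Z, X)`. -/
lemma frameDet_hypPoint (hf : IsLorentzFrame b f) (y : Fin n → ℝ) (X : Fin n → E) :
    frameDet b f (Fin.cons (hypPoint f y) X) = (-1) ^ (n + 1) * √(1 + ∑ i, y i ^ 2) *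
      (Matrix.of fun s j => b (X s) (hypTangent f y j)).det := by
  have hc : 0 < √(1 + ∑ i, y i ^ 2) := by
    have : 0 ≤ ∑ i, y i ^ 2 := Finset.sum_nonneg fun _ _ => sq_nonneg _
    positivity
  set c := √(1 + ∑ i, y i ^ 2) with hcdef
  set w : Fin (n + 1) → E := Fin.cons (hypPoint f y) X with hw
  set g : Fin (n + 1) → E := Fin.snoc (α := fun _ => E) (hypTangent f y) (f (Fin.last n)) with hg
  have h1 : frameDet b f w = (Matrix.of fun k r => b (w r) (g k)).det := by
    rw [frameDet, ← Matrix.det_transpose]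
    symm
    refine Matrix.det_eq_of_forall_row_eq_smul_add_const
      (Fin.snoc (α := fun _ => ℝ) (fun j => y j / c) 0) (Fin.last n) (by simp) fun k r => ?_
    refine Fin.lastCases ?_ (fun j => ?_) k
    · simp [hg]
    · simp [hg, hypTangent_eq, ← hcdef]
  have h0 : ∀ j, b (hypPoint f y) (hypTangent f y j) = 0 := fun j => by
    rw [hypTangent_eq, map_add, map_smul, hf.hypPoint_last, hypPoint, hf.apply_sum_right,
      if_neg (Fin.castSucc_ne_last j), chart_castSucc, ← hcdef, smul_eq_mul]
    field_simp
    ring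
  rw [h1, ← Matrix.det_transpose, Matrix.det_succ_row_zero, Fin.sum_univ_castSucc]
  have h2 : ∀ j : Fin n, (Matrix.of fun k r => b (w r) (g k)).transpose 0 j.castSucc = 0 :=
    fun j => by simp [hw, hg, h0]
  have h3 : (Matrix.of fun k r => b (w r) (g k)).transpose 0 (Fin.last n) = -c := by
    simp [hw, hg, hf.hypPoint_last, ← hcdef]
  have h4 : (Matrix.of fun k r => b (w r) (g k)).transpose.submatrix Fin.succ
      (Fin.last n).succAbove = Matrix.of fun s j => b (X s) (hypTangent f y j) := by
    ext s j
    simp [hw, hg]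
  simp only [h2, h3, h4, mul_zero, zero_mul, Finset.sum_const_zero, zero_add, Fin.val_last]
  ring

/-- Change of frame multiplies volumes by the determinant. -/
lemma frameDet_change (b : LinearMap.BilinForm ℝ E) (g : Module.Basis (Fin (n + 1)) ℝ E)
    (g' w : Fin (n + 1) → E) : frameDet b g' w = g.det g' * frameDet b g w := by
  have h1 : (Matrix.of fun r k => b (w r) (g' k)) =
      (Matrix.of fun r k => b (w r) (g k)) * g.toMatrix g' := by
    ext r k
    rw [Matrix.mul_apply, Matrix.of_apply]
    conv_lhs => rw [← g.sum_toMatrix_smul_self g' k, map_sum]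
    refine Finset.sum_congr rfl fun i _ => ?_
    rw [map_smul, smul_eq_mul, mul_comm]
    rfl
  rw [frameDet, h1, Matrix.det_mul, Module.Basis.det_apply, mul_comm]
  rfl

lemma kernelTerm_change (b : LinearMap.BilinForm ℝ E) (g : Module.Basis (Fin (n + 1)) ℝ E)
    (g' : Fin (n + 1) → E) (u v : Matrix (Fin n) (Fin n) ℝ) (Z : E) (X : Fin n → E) :
    kernelTerm b g' u v Z X = g.det g' * kernelTerm b g u v Z X := by
  rw [kernelTerm, frameDet_change b g g', kernelTerm]
  push_cast
  ring

lemma kernelTerm_isometry (g : Module.Basis (Fin (n + 1)) ℝ E) (ρ : E ≃ₗ[ℝ] E)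
    (hρ : ∀ x y, b (ρ x) (ρ y) = b x y) (u v : Matrix (Fin n) (Fin n) ℝ) (Z : E) (X : Fin n → E) :
    kernelTerm b g u v (ρ Z) (fun s => ρ (X s)) =
      g.det (fun k => ρ.symm (g k)) * kernelTerm b g u v Z X := by
  rw [← kernelTerm_change, kernelTerm, kernelTerm]
  have h1 : frameDet b g (Fin.cons (ρ Z) fun s => ρ (X s)) =
      frameDet b (fun k => ρ.symm (g k)) (Fin.cons Z X) := by
    rw [frameDet, frameDet]
    congr 1
    ext r k
    rw [Matrix.of_apply, Matrix.of_apply]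
    refine Fin.cases ?_ (fun s => ?_) r
    · rw [Fin.cons_zero, Fin.cons_zero, ← hρ Z, LinearEquiv.apply_symm_apply]
    · rw [Fin.cons_succ, Fin.cons_succ, ← hρ (X s), LinearEquiv.apply_symm_apply]
  have h2 : majorantTrace b v (ρ Z) (fun s => ρ (X s)) = majorantTrace b v Z X := by
    simp only [majorantTrace, majorant, hρ]
  rw [h1, h2]
  simp only [hρ]

lemma continuous_hypPoint_kernelTerm (b : LinearMap.BilinForm ℝ E) (f g : Fin (n + 1) → E)
    (hs : ∀ x y, b x y = b y x) (u v : Matrix (Fin n) (Fin n) ℝ) (X : Fin n → E) :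
    Continuous fun y => kernelTerm b g u v (hypPoint f y) X := by
  have h0 := continuous_apply_hypPoint b f
  have h1 : Continuous fun y => frameDet b g (Fin.cons (hypPoint f y) X) := by
    refine Continuous.matrix_det (continuous_matrix fun r k => ?_)
    refine Fin.cases ?_ (fun s => ?_) r
    · simp only [Matrix.of_apply, Fin.cons_zero, hs _ (g k)]
      exact h0 _
    · simp only [Matrix.of_apply, Fin.cons_succ]
      exact continuous_const
  have h2 : Continuous fun y => majorantTrace b v (hypPoint f y) X := by
    simp only [majorantTrace, majorant]
    exact continuous_finsetSum _ fun i _ => continuous_finsetSum _ fun j _ =>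
      continuous_const.mul (continuous_const.add ((continuous_const.mul (h0 _)).mul (h0 _)))
  simp only [kernelTerm]
  exact continuous_const.mul (Complex.continuous_ofReal.comp
    (h1.mul (Real.continuous_exp.comp (continuous_const.mul h2))))

lemma phiTau_hypPoint (hf : IsLorentzFrame b f) (hs : ∀ x y, b x y = b y x)
    {τ : Matrix (Fin n) (Fin n) ℂ} (hτ : τ ∈ SiegelUpperHalf n) (X : Fin n → E) (y : Fin n → ℝ) :
    phiTau b τ X (hypPoint f y) (hypTangent f y) =
      (((2 : ℝ) ^ ((n : ℝ) / 2) * (CFC.sqrt (τ.map Complex.im)).det * (-1) ^ (n + 1) : ℝ) : ℂ) *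
        ((1 / √(1 + ∑ i, y i ^ 2) : ℝ) : ℂ) *
        kernelTerm b f (τ.map Complex.re) (τ.map Complex.im) (hypPoint f y) X := by
  have hc : 0 < √(1 + ∑ i, y i ^ 2) := by
    have : 0 ≤ ∑ i, y i ^ 2 := Finset.sum_nonneg fun _ _ => sq_nonneg _
    positivity
  rw [phiTau_eq b hτ, kernelTerm, amplitude, frameDet_hypPoint hf]
  have h1 : ((τ.map Complex.re) * gram b X).trace =
      ∑ i, ∑ j, (τ.map Complex.re) i j * b (X i) (X j) := by
    simp only [Matrix.trace, Matrix.diag_apply, Matrix.mul_apply, gram, Matrix.of_apply]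
    refine Finset.sum_congr rfl fun i _ => Finset.sum_congr rfl fun j _ => ?_
    rw [hs]
  have h2 : Real.pi * Complex.I * (((τ.map Complex.re) * gram b X).trace : ℝ) =
      ((Real.pi * ∑ i, ∑ j, (τ.map Complex.re) i j * b (X i) (X j) : ℝ) : ℂ) * Complex.I := by
    rw [h1]
    push_cast
    ring
  have h3 : ((-1 : ℝ) ^ (n + 1)) * (-1) ^ (n + 1) = 1 := by
    rw [← mul_pow]; norm_num
  have h4 : ∀ (P D e : ℝ), P * D * e = P * (-1) ^ (n + 1) * (1 / √(1 + ∑ i, y i ^ 2)) *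
      ((-1) ^ (n + 1) * √(1 + ∑ i, y i ^ 2) * D * e) := fun P D e => by
    field_simp
    linear_combination (-(P * D * e)) * h3
  rw [h2, h4]
  rw [majorantTrace]
  push_cast
  ring

end ChartCoefficient

/-! ### The theta kernel of a lattice -/

section LatticeKernel

variable {W : Type*} [AddCommGroup W] [Module ℚ W] {n : ℕ}
  {Bw : LinearMap.BilinForm ℚ W} {M : Submodule ℤ W}

/-- The theta kernel `∑_{X ∈ M^n + h}` of the summands `kernelTerm`. -/
noncomputable def thetaKernel (Bw : LinearMap.BilinForm ℚ W) (M : Submodule ℤ W) (h : Fin n → W)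
    (g : Fin (n + 1) → ℝ ⊗[ℚ] W) (u v : Matrix (Fin n) (Fin n) ℝ) (Z : ℝ ⊗[ℚ] W) : ℂ :=
  ∑' X : coset M h, kernelTerm (realForm Bw) g u v Z (toReal X.1)

lemma coefficient_thetaForm {f : Fin (n + 1) → ℝ ⊗[ℚ] W} (hf : IsLorentzFrame (realForm Bw) f)
    (hs : ∀ x y, realForm Bw x y = realForm Bw y x) (h : Fin n → W)
    {τ : Matrix (Fin n) (Fin n) ℂ} (hτ : τ ∈ SiegelUpperHalf n) (y : Fin n → ℝ) :
    coefficient f (thetaForm Bw M h τ) y =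
      (((2 : ℝ) ^ ((n : ℝ) / 2) * (CFC.sqrt (τ.map Complex.im)).det * (-1) ^ (n + 1) : ℝ) : ℂ) *
        ((1 / √(1 + ∑ i, y i ^ 2) : ℝ) : ℂ) *
        thetaKernel Bw M h f (τ.map Complex.re) (τ.map Complex.im) (hypPoint f y) := by
  rw [coefficient, thetaForm, thetaKernel, ← tsum_mul_left]
  exact tsum_congr fun X => phiTau_hypPoint hf hs hτ _ y

lemma thetaKernel_change (h : Fin n → W) (g : Module.Basis (Fin (n + 1)) ℝ (ℝ ⊗[ℚ] W))
    (g' : Fin (n + 1) → ℝ ⊗[ℚ] W) (u v : Matrix (Fin n) (Fin n) ℝ) (Z : ℝ ⊗[ℚ] W) :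
    thetaKernel Bw M h g' u v Z = g.det g' * thetaKernel Bw M h g u v Z := by
  rw [thetaKernel, thetaKernel, ← tsum_mul_left]
  exact tsum_congr fun X => kernelTerm_change _ g g' u v Z _

lemma tsum_kernelTerm_latticeTuple (bM : Module.Basis (Fin (n + 1)) ℤ M)
    (β : Module.Basis (Fin (n + 1)) ℚ W) (hβ : ∀ i, β i = bM i) (h : Fin n → W)
    (g : Fin (n + 1) → ℝ ⊗[ℚ] W) (u v : Matrix (Fin n) (Fin n) ℝ) (Z : ℝ ⊗[ℚ] W) :
    ∑' k, kernelTerm (realForm Bw) g u v Z (latticeTuple (β.baseChange ℝ)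
      (fun j => ((β.repr (h j.1) j.2 : ℚ) : ℝ)) k) = thetaKernel Bw M h g u v Z := by
  rw [thetaKernel, ← (cosetEquiv bM h).tsum_eq]
  exact tsum_congr fun k => by rw [toReal_cosetEquiv bM β hβ]

/-- The theta kernel is invariant up to sign under the isometries of the lattice that fix the class
of `h`. -/
lemma norm_thetaKernel_isometry (hs : ∀ x y, realForm Bw x y = realForm Bw y x)
    (hnd : ∀ x, (∀ y, realForm Bw x y = 0) → x = 0)
    (f : Module.Basis (Fin (n + 1)) ℝ (ℝ ⊗[ℚ] W)) {h : Fin n → W}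
    (σ : W ≃ₗ[ℚ] W) (hσ : ∀ x y, Bw (σ x) (σ y) = Bw x y) (hσM : ∀ x, σ x ∈ M ↔ x ∈ M)
    (hσh : ∀ s, σ (h s) - h s ∈ M) (u v : Matrix (Fin n) (Fin n) ℝ) (Z : ℝ ⊗[ℚ] W) :
    ‖thetaKernel Bw M h f u v (σ.baseChange ℚ ℝ W W Z)‖ = ‖thetaKernel Bw M h f u v Z‖ := by
  set ρ := σ.baseChange ℚ ℝ W W with hρdef
  have hρ : ∀ x y, realForm Bw (ρ x) (ρ y) = realForm Bw x y := realForm_actReal hσ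
  have hσ' : ∀ X ∈ coset M h, (fun s => σ (X s)) ∈ coset M h := fun X hX s => by
    have h1 : σ (X s) - h s = σ (X s - h s) + (σ (h s) - h s) := by rw [map_sub]; abel
    change σ (X s) - h s ∈ M
    rw [h1]
    exact M.add_mem ((hσM _).mpr (hX s)) (hσh s)
  have hσs : ∀ X ∈ coset M h, (fun s => σ.symm (X s)) ∈ coset M h := fun X hX s => by
    have h1 : σ (σ.symm (X s) - h s) = (X s - h s) - (σ (h s) - h s) := by
      rw [map_sub, LinearEquiv.apply_symm_apply]; abel
    change σ.symm (X s) - h s ∈ M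
    rw [← hσM, h1]
    exact M.sub_mem (hX s) (hσh s)
  let c : coset M h ≃ coset M h :=
    { toFun := fun X => ⟨_, hσ' X.1 X.2⟩
      invFun := fun X => ⟨_, hσs X.1 X.2⟩
      left_inv := fun X => by ext s; simp
      right_inv := fun X => by ext s; simp }
  have hfin : FiniteDimensional ℝ (ℝ ⊗[ℚ] W) := f.finiteDimensional_of_finite
  set d := f.det (fun k => ρ.symm (f k)) with hd
  have hc : ∀ X : coset M h, toReal (c X).1 = fun s => ρ (toReal X.1 s) := fun X => by
    funext s
    change 1 ⊗ₜ[ℚ] σ (X.1 s) = σ.baseChange ℚ ℝ W W (1 ⊗ₜ[ℚ] X.1 s)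
    exact (LinearMap.baseChange_tmul (A := ℝ) (f := (σ : W →ₗ[ℚ] W)) 1 (X.1 s)).symm
  clear_value c ρ
  have h1 : thetaKernel Bw M h f u v (ρ Z) = d * thetaKernel Bw M h f u v Z := by
    rw [thetaKernel, thetaKernel, ← c.tsum_eq, ← tsum_mul_left]
    refine tsum_congr fun X => ?_
    rw [hc X, kernelTerm_isometry f ρ hρ u v Z]
  have h2 : d = LinearMap.det (ρ.symm : (ℝ ⊗[ℚ] W) →ₗ[ℝ] (ℝ ⊗[ℚ] W)) := by
    have := f.det_comp (ρ.symm : (ℝ ⊗[ℚ] W) →ₗ[ℝ] (ℝ ⊗[ℚ] W)) f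
    rw [f.det_self, mul_one] at this
    exact this
  have h3 : d ^ 2 = 1 := by
    rw [h2]
    refine det_sq_of_isometry hnd hs _ fun x y => ?_
    rw [← hρ]
    simp
  have h4 : ‖(d : ℂ)‖ = 1 := by
    rw [Complex.norm_real, Real.norm_eq_abs]
    exact (pow_left_inj₀ (abs_nonneg _) zero_le_one two_ne_zero).mp (by rw [sq_abs, h3, one_pow])
  rw [h1, norm_mul, h4, one_mul]

/-- A nonzero vector of a lattice is a multiple of a vector of some basis. -/
lemma exists_basis_eq_smul [FiniteDimensional ℚ W] (hM : IsFullLattice M) {m : ℕ}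
    (hm : Module.finrank ℚ W = m) {e : W} (he : e ∈ M) (he0 : e ≠ 0) :
    ∃ (bM : Module.Basis (Fin m) ℤ M) (β : Module.Basis (Fin m) ℚ W) (i₀ : Fin m) (z : ℤ),
      (∀ i, β i = bM i) ∧ z ≠ 0 ∧ e = z • β i₀ := by
  subst hm
  obtain ⟨bM₀, -⟩ := hM.exists_basis
  set N : Submodule ℤ M := Submodule.span ℤ {⟨e, he⟩} with hN
  obtain ⟨r, S⟩ := Submodule.smithNormalForm bM₀ N
  obtain ⟨β, hβ⟩ := hM.exists_rat_basis S.bM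
  have heN : (⟨e, he⟩ : M) ∈ N := Submodule.mem_span_singleton_self _
  have h1 : ∀ i j : Fin r, i = j := fun i j => by
    by_contra hij
    -- two basis vectors of a cyclic group satisfy a linear relation
    obtain ⟨a, ha⟩ := Submodule.mem_span_singleton.mp (S.bN i).2
    obtain ⟨c, hc⟩ := Submodule.mem_span_singleton.mp (S.bN j).2
    have h2 : c • S.bN i = a • S.bN j := by
      ext
      simp only [Submodule.coe_smul, ← ha, ← hc, smul_smul, mul_comm]
    have h3 := congrArg (fun x => S.bN.repr x i) h2
    simp only [map_smul, Finsupp.smul_apply, Module.Basis.repr_self, Finsupp.single_apply,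
      if_pos, if_neg (Ne.symm hij), smul_eq_mul, mul_one, mul_zero] at h3
    have h4 : (S.bN j : M) = 0 := by rw [← hc, h3, zero_smul]
    exact S.bN.ne_zero j (by ext1; exact h4)
  have h2 := congrArg (fun x : N => ((x : M) : W)) (S.bN.sum_repr ⟨_, heN⟩)
  simp only [Submodule.coe_sum, Submodule.coe_smul, S.snf] at h2
  rcases isEmpty_or_nonempty (Fin r) with hr | ⟨⟨i⟩⟩
  · rw [Finset.univ_eq_empty, Finset.sum_empty] at h2
    exact absurd h2.symm he0
  · have hu : (Finset.univ : Finset (Fin r)) = {i} := by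
      ext j; simp [h1 j i]
    rw [hu, Finset.sum_singleton, ← hβ, smul_smul] at h2
    refine ⟨S.bM, β, S.f i, _, hβ, fun hz => he0 ?_, h2.symm⟩
    rw [← h2, hz, zero_smul]

/-- The products of the vectors of a coset with a lattice vector lie in a discrete group. -/
lemma exists_gap (hM : IsFullLattice M) (hint : ∀ x ∈ M, ∀ y ∈ M, ∃ z : ℤ, Bw x y = z)
    (h : Fin n → W) : ∃ δ : ℝ, 0 < δ ∧ ∀ e ∈ M, ∀ X ∈ coset M h, ∀ s,
      realForm Bw (toReal X s) (1 ⊗ₜ[ℚ] e) ≠ 0 → δ ≤ |realForm Bw (toReal X s) (1 ⊗ₜ[ℚ] e)| := by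
  obtain ⟨N, hN, hNh⟩ := hM.exists_common_smul_mem h
  have hN0 : (0 : ℝ) < N := by exact_mod_cast Nat.pos_of_ne_zero hN
  refine ⟨(N : ℝ)⁻¹, inv_pos.mpr hN0, fun e he X hX s h0 => ?_⟩
  have h1 : N • X s ∈ M := by
    have : N • X s = N • (X s - h s) + N • h s := by rw [← smul_add, sub_add_cancel]
    rw [this]
    exact M.add_mem (nsmul_mem (hX s) N) (hNh s)
  obtain ⟨z, hz⟩ := hint _ h1 e he
  rw [map_nsmul, LinearMap.smul_apply, nsmul_eq_mul] at hz
  have h2 : realForm Bw (toReal X s) (1 ⊗ₜ[ℚ] e) = (Bw (X s) e : ℝ) := by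
    rw [toReal, realForm_tmul]; simp
  rw [h2] at h0 ⊢
  have h3 : (N : ℝ) * (Bw (X s) e : ℝ) = z := by exact_mod_cast hz
  have hz0 : z ≠ 0 := fun h => by
    rw [h, Int.cast_zero] at h3
    exact h0 ((mul_eq_zero.mp h3).resolve_left hN0.ne')
  have h4 : (1 : ℝ) ≤ |(z : ℝ)| := by exact_mod_cast Int.one_le_abs hz0
  rw [← h3, abs_mul, abs_of_pos hN0] at h4
  rwa [inv_le_iff_one_le_mul₀' hN0]

section Bounds

variable [FiniteDimensional ℚ W] (hb : IsHyperbolic (realForm Bw)) (hM : IsFullLattice M)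
  (hm : Module.finrank ℚ W = n + 1) {Z₁ : ℝ ⊗[ℚ] W} (hZ₁ : realForm Bw Z₁ Z₁ = -1)
  (f : Module.Basis (Fin (n + 1)) ℝ (ℝ ⊗[ℚ] W)) (u : Matrix (Fin n) (Fin n) ℝ)
  {v : Matrix (Fin n) (Fin n) ℝ} (hv : v.PosDef) (h : Fin n → W)
include hb hM hm hZ₁ hv

lemma exists_norm_thetaKernel_le (ν : ℝ) : ∃ C : ℝ, ∀ Z, realForm Bw Z Z = -1 →
    |realForm Bw Z₁ Z| ≤ ν →
    (Summable fun X : coset M h => kernelTerm (realForm Bw) f u v Z (toReal X.1)) ∧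
      ‖thetaKernel Bw M h f u v Z‖ ≤ C := by
  obtain ⟨bM, β, hβ⟩ := hM.exists_basis
  set ε := finCongr hm
  replace hβ : ∀ i, β.reindex ε i = bM.reindex ε i := fun i => by simp [hβ]
  set β := β.reindex ε
  set bM := bM.reindex ε
  set βr := β.baseChange ℝ with hβr
  obtain ⟨C, hC, K, H⟩ := exists_norm_kernel_le hb hZ₁ hv u βr
    (fun j => ((β.repr (h j.1) j.2 : ℚ) : ℝ))
  refine ⟨|βr.det f| * (C * max 1 ν ^ K), fun Z hZ hν => ?_⟩
  obtain ⟨h1, h2⟩ := H Z (max 1 ν) hZ (le_max_left _ _) (hν.trans (le_max_right _ _))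
  rw [tsum_kernelTerm_latticeTuple bM β hβ] at h2
  refine ⟨?_, ?_⟩
  · have h3 : Summable fun X : coset M h => kernelTerm (realForm Bw) βr u v Z (toReal X.1) := by
      rw [← (cosetEquiv bM h).summable_iff]
      refine h1.congr fun k => ?_
      rw [Function.comp_apply, toReal_cosetEquiv bM β hβ]
    refine (h3.mul_left ((βr.det f : ℝ) : ℂ)).congr fun X => ?_
    rw [kernelTerm_change _ βr f]
  · rw [thetaKernel_change h βr f, norm_mul, Complex.norm_real, Real.norm_eq_abs]
    exact mul_le_mul_of_nonneg_left h2 (abs_nonneg _)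

lemma exists_norm_thetaKernel_cusp_le (hint : ∀ x ∈ M, ∀ y ∈ M, ∃ z : ℤ, Bw x y = z) {e : W}
    (he : e ∈ M) (he0 : e ≠ 0) (hee : Bw e e = 0) {R : ℝ} (hR : 0 ≤ R) :
    ∃ C > 0, ∀ Z, realForm Bw Z Z = -1 → |realForm Bw (1 ⊗ₜ[ℚ] e) Z| ≤ 1 →
      |realForm Bw (1 ⊗ₜ[ℚ] e) Z * realForm Bw Z₁ Z| ≤ R →
      ‖thetaKernel Bw M h f u v Z‖ ≤ C * |realForm Bw (1 ⊗ₜ[ℚ] e) Z| := by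
  obtain ⟨bM, β, i₀, z, hβ, hz, hez⟩ := exists_basis_eq_smul hM hm he he0
  set βr := β.baseChange ℝ with hβr
  obtain ⟨δ, hδ, hgap⟩ := exists_gap hM hint h
  have hβM : β i₀ ∈ M := by rw [hβ]; exact (bM i₀).2
  have hβi : βr i₀ = 1 ⊗ₜ[ℚ] β i₀ := Module.Basis.baseChange_apply _ _ _
  have hz1 : (1 : ℝ) ≤ |(z : ℝ)| := by exact_mod_cast Int.one_le_abs hz
  have heβ : ∀ Z, realForm Bw (1 ⊗ₜ[ℚ] e) Z = z * realForm Bw (βr i₀) Z := fun Z => by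
    have h1 : (1 : ℝ) ⊗ₜ[ℚ] e = (z : ℝ) • βr i₀ := by
      rw [hβi, hez, TensorProduct.smul_tmul', ← Int.cast_smul_eq_zsmul ℚ, TensorProduct.tmul_smul,
        TensorProduct.smul_tmul']
      congr 1
    rw [h1, map_smul, LinearMap.smul_apply, smul_eq_mul]
  have hle : ∀ Z, |realForm Bw (βr i₀) Z| ≤ |realForm Bw (1 ⊗ₜ[ℚ] e) Z| := fun Z => by
    rw [heβ, abs_mul]
    exact le_mul_of_one_le_left (abs_nonneg _) hz1
  have hiso : realForm Bw (βr i₀) (βr i₀) = 0 := by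
    have h1 : Bw (β i₀) (β i₀) = 0 := by
      rw [hez] at hee
      simp only [map_zsmul, LinearMap.smul_apply, zsmul_eq_mul] at hee
      have hz' : (z : ℚ) ≠ 0 := by exact_mod_cast hz
      simpa [hz'] using hee
    rw [hβi, realForm_tmul, h1]; simp
  obtain ⟨C, hC, H⟩ := exists_norm_kernel_cusp_le hb hZ₁ hv u βr hiso
    (fun j => ((β.repr (h j.1) j.2 : ℚ) : ℝ)) hδ (fun k s => by
      rw [← toReal_cosetEquiv bM β hβ h k, hβi]
      exact hgap _ hβM _ (cosetEquiv bM h k).2 s) hR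
  refine ⟨(|βr.det f| + 1) * C, by positivity, fun Z hZ h1 h2 => ?_⟩
  have h4 : |realForm Bw (βr i₀) Z * realForm Bw Z₁ Z| ≤ R := by
    refine le_trans ?_ h2
    rw [abs_mul, abs_mul]
    exact mul_le_mul_of_nonneg_right (hle Z) (abs_nonneg _)
  have h3 := H Z hZ ((hle Z).trans h1) h4
  rw [tsum_kernelTerm_latticeTuple bM β hβ] at h3
  rw [thetaKernel_change h βr f, norm_mul, Complex.norm_real, Real.norm_eq_abs, mul_assoc]
  refine mul_le_mul (by linarith) (h3.trans ?_) (norm_nonneg _) (by positivity)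
  exact mul_le_mul_of_nonneg_left (hle Z) hC.le

end Bounds

end LatticeKernel

/-! ### Integrability of the theta form -/

section Integrability

open MeasureTheory
open scoped ENNReal

variable {W : Type*} [AddCommGroup W] [Module ℚ W] {n : ℕ}
  {Bw : LinearMap.BilinForm ℚ W} {M : Submodule ℤ W}

lemma realForm_one_tmul (x y : W) :
    realForm Bw (1 ⊗ₜ[ℚ] x) (1 ⊗ₜ[ℚ] y) = (Bw x y : ℝ) := by
  rw [realForm_tmul]; simp

lemma latticePoint_baseChange {m : ℕ} (β : Module.Basis (Fin m) ℚ W) (k : Fin m → ℤ) :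
    latticePoint (β.baseChange ℝ) k = 1 ⊗ₜ[ℚ] ∑ i, k i • β i := by
  rw [latticePoint, TensorProduct.tmul_sum]
  refine Finset.sum_congr rfl fun i _ => ?_
  rw [Module.Basis.baseChange_apply, TensorProduct.smul_tmul', ← Int.cast_smul_eq_zsmul ℚ,
    TensorProduct.tmul_smul, TensorProduct.smul_tmul']
  congr 1

lemma linearIndependent_of_one_tmul {ι : Type*} {c : ι → W}
    (hc : LinearIndependent ℝ fun i => (1 : ℝ) ⊗ₜ[ℚ] c i) : LinearIndependent ℚ c := by
  have h1 : LinearIndependent ℚ fun i => (1 : ℝ) ⊗ₜ[ℚ] c i :=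
    hc.restrict_scalars (fun x y hxy => by simpa [Algebra.smul_def] using hxy)
  exact LinearIndependent.of_comp (TensorProduct.mk ℚ ℝ W 1) h1

lemma linearIndependent_one_tmul [FiniteDimensional ℚ W] {m : ℕ}
    (hm : Module.finrank ℚ W = m) {c : Fin m → W} (hc : LinearIndependent ℚ c) :
    LinearIndependent ℝ fun i => (1 : ℝ) ⊗ₜ[ℚ] c i := by
  rcases Nat.eq_zero_or_pos m with rfl | hpos
  · exact linearIndependent_empty_type
  have : Nonempty (Fin m) := ⟨⟨0, hpos⟩⟩
  set cb := basisOfLinearIndependentOfCardEqFinrank hc (by rw [hm, Fintype.card_fin])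
  have h1 : (fun i => (1 : ℝ) ⊗ₜ[ℚ] c i) = cb.baseChange ℝ := by
    funext i
    rw [Module.Basis.baseChange_apply, coe_basisOfLinearIndependentOfCardEqFinrank]
  rw [h1]
  exact (cb.baseChange ℝ).linearIndependent

variable [FiniteDimensional ℚ W] (hb : IsHyperbolic (realForm Bw)) (hM : IsFullLattice M)
  (hint : ∀ x ∈ M, ∀ y ∈ M, ∃ z : ℤ, Bw x y = z) (hm : Module.finrank ℚ W = n + 1)
  {f : Fin (n + 1) → ℝ ⊗[ℚ] W} (hf : IsLorentzFrame (realForm Bw) f)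
include hb hM hm hf

lemma measurable_thetaKernel_hypPoint (u : Matrix (Fin n) (Fin n) ℝ)
    {v : Matrix (Fin n) (Fin n) ℝ} (hv : v.PosDef) (h : Fin n → W)
    (fb : Module.Basis (Fin (n + 1)) ℝ (ℝ ⊗[ℚ] W)) (hfb : ⇑fb = f) :
    Measurable fun y => thetaKernel Bw M h f u v (hypPoint f y) := by
  obtain ⟨bM, -⟩ := hM.exists_basis
  have : Countable (coset M h) := (cosetEquiv bM h).symm.injective.countable
  refine measurable_of_tendsto_metrizable'
    (f := fun (s : Finset (coset M h)) y => ∑ X ∈ s,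
      kernelTerm (realForm Bw) f u v (hypPoint f y) (toReal X.1)) Filter.atTop (fun s => ?_) ?_
  · exact (continuous_finsetSum _ fun X _ =>
      continuous_hypPoint_kernelTerm _ f f hb.symm u v _).measurable
  · refine tendsto_pi_nhds.mpr fun y => ?_
    obtain ⟨C, hC⟩ := exists_norm_thetaKernel_le hb hM hm hf.apply_last_last fb u hv h
      |realForm Bw (f (Fin.last n)) (hypPoint f y)|
    have := (hC _ (hf.hypPoint_self y) le_rfl).1
    rw [hfb] at this
    exact this.hasSum

include hint in
/-- The theta form of a lattice in a hyperbolic space is integrable over a set with disjoint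
translates under a group of isometries of the lattice that acts on the bases of bounded size with
finitely many orbits. -/
lemma integrableForm_thetaForm (h : Fin n → W) {τ : Matrix (Fin n) (Fin n) ℂ}
    (hτ : τ ∈ SiegelUpperHalf n) {G : Type*} [Countable G] (σ : G → W ≃ₗ[ℚ] W)
    (hσ : ∀ g x y, Bw (σ g x) (σ g y) = Bw x y) (hσM : ∀ g x, σ g x ∈ M ↔ x ∈ M)
    (hσh : ∀ g s, σ g (h s) - h s ∈ M)
    (hσf : ∀ g Z, realForm Bw Z Z = -1 → (realForm Bw (actReal (σ g) Z) (f (Fin.last n)) < 0 ↔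
      realForm Bw Z (f (Fin.last n)) < 0))
    (horb : ∀ R : ℕ, ∃ T : Set ((Fin (n + 1) → W) × W), T.Finite ∧
      (∀ t ∈ T, t.2 ∈ M ∧ LinearIndependent ℚ t.1) ∧
      ∀ x : (Fin (n + 1) → W) × W, (∀ i, x.1 i ∈ M) → x.2 ∈ M → LinearIndependent ℚ x.1 →
        (∀ i j, |Bw (x.1 i) (x.1 j)| ≤ R) → (∀ i, |Bw (x.1 i) x.2| ≤ R) →
        ∃ t ∈ T, ∃ g, (∀ i, σ g (t.1 i) = x.1 i) ∧ σ g t.2 = x.2)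
    {F : Set (Fin n → ℝ)} (hF : MeasurableSet F)
    (hdisj : ∀ g g', g ≠ g' → volume {y | y ∈ F ∧ ∃ y' ∈ F, ∃ Z,
      actReal (σ g) Z = hypPoint f y ∧ actReal (σ g') Z = hypPoint f y'} = 0) :
    IntegrableForm f F (thetaForm Bw M h τ) := by
  classical
  have hv := hτ.2
  set u := τ.map Complex.re
  set v := τ.map Complex.im
  have hlast := hf.apply_last_last
  have hnd : ∀ x, (∀ y, realForm Bw x y = 0) → x = 0 := fun x hx => hb.eq_zero_of_forall hlast hx
  have hmR : Module.finrank ℝ (ℝ ⊗[ℚ] W) = n + 1 := by rw [Module.finrank_baseChange, hm]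
  obtain ⟨fb, hfb⟩ : ∃ fb : Module.Basis (Fin (n + 1)) ℝ (ℝ ⊗[ℚ] W), ⇑fb = f :=
    ⟨basisOfLinearIndependentOfCardEqFinrank hf.linearIndependent
      (by rw [hmR, Fintype.card_fin]), coe_basisOfLinearIndependentOfCardEqFinrank _ _⟩
  have hmeas := measurable_thetaKernel_hypPoint hb hM hm hf u hv h fb hfb
  set k : ℝ ⊗[ℚ] W → ℝ≥0∞ := fun Z => ‖thetaKernel Bw M h f u v Z‖ₑ with hk
  have hkle : ∀ Z C, ‖thetaKernel Bw M h f u v Z‖ ≤ C → k Z ≤ ENNReal.ofReal C := fun Z C hC => by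
    change ‖thetaKernel Bw M h f u v Z‖ₑ ≤ _
    rw [← ofReal_norm]
    exact ENNReal.ofReal_le_ofReal hC
  set ρ := fun g => (σ g).baseChange ℚ ℝ W W with hρdef
  have hρa : ∀ g Z, ρ g Z = actReal (σ g) Z := fun g Z => rfl
  have hρ : ∀ g x y, realForm Bw (ρ g x) (ρ g y) = realForm Bw x y := fun g =>
    realForm_actReal (hσ g)
  have hρt : ∀ g x, ρ g (1 ⊗ₜ[ℚ] x) = 1 ⊗ₜ[ℚ] σ g x := fun g x =>
    LinearEquiv.baseChange_tmul (R := ℚ) (A := ℝ) W W (e := σ g) 1 x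
  have hkρ : ∀ g Z, k (ρ g Z) = k Z := fun g Z => by
    have h1 := norm_thetaKernel_isometry hb.symm hnd fb (h := h) (σ g) (hσ g) (hσM g) (hσh g) u v Z
    rw [hfb] at h1
    change ‖thetaKernel Bw M h f u v ((σ g).baseChange ℚ ℝ W W Z)‖ₑ = ‖thetaKernel Bw M h f u v Z‖ₑ
    rw [← ofReal_norm, h1, ofReal_norm]
  clear_value ρ
  -- a lattice basis and the constant of reduction theory
  obtain ⟨bM, β, hβ⟩ := hM.exists_basis
  set ε := finCongr hm
  replace hβ : ∀ i, β.reindex ε i = bM.reindex ε i := fun i => by simp [hβ]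
  set β := β.reindex ε
  set bM := bM.reindex ε
  have hβM : ∀ i, β i ∈ M := fun i => by rw [hβ]; exact (bM i).2
  obtain ⟨R₀, hR₀, hred⟩ := exists_reduced hb (β.baseChange ℝ) fun i j => by
    obtain ⟨z, hz⟩ := hint _ (hβM i) _ (hβM j)
    exact ⟨z, by rw [Module.Basis.baseChange_apply, Module.Basis.baseChange_apply,
      realForm_one_tmul, hz]; simp⟩
  set R := ⌈R₀⌉₊ with hR
  have hRR : R₀ ≤ R := Nat.le_ceil _
  obtain ⟨T, hTfin, hT, hTorb⟩ := horb R
  set T' := {t ∈ T | Bw t.2 t.2 = 0} with hT'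
  have hT'fin : T'.Finite := hTfin.subset fun t ht => ht.1
  set S : (Fin (n + 1) → W) × W → Set (ℝ ⊗[ℚ] W) := fun t =>
    if t.2 = 0 then {Z | ∀ i, |realForm Bw (1 ⊗ₜ[ℚ] t.1 i) Z| ≤ R} else
      {Z | |realForm Bw (1 ⊗ₜ[ℚ] t.2) Z| ≤ 1 ∧
        ∀ i, |realForm Bw (1 ⊗ₜ[ℚ] t.2) Z * realForm Bw (1 ⊗ₜ[ℚ] t.1 i) Z| ≤ R} with hS
  have hS0 : ∀ t, t.2 = 0 → S t = {Z | ∀ i, |realForm Bw (1 ⊗ₜ[ℚ] t.1 i) Z| ≤ R} :=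
    fun t ht => if_pos ht
  have hS1 : ∀ t, t.2 ≠ 0 → S t = {Z | |realForm Bw (1 ⊗ₜ[ℚ] t.2) Z| ≤ 1 ∧
      ∀ i, |realForm Bw (1 ⊗ₜ[ℚ] t.2) Z * realForm Bw (1 ⊗ₜ[ℚ] t.1 i) Z| ≤ R} :=
    fun t ht => if_neg ht
  clear_value S
  have hSm : ∀ t ∈ hT'fin.toFinset, MeasurableSet {y | hypPoint f y ∈ S t} := fun t _ => by
    have hc := continuous_apply_hypPoint (realForm Bw) f
    by_cases ht : t.2 = 0
    · have h1 : {y | hypPoint f y ∈ S t} =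
          ⋂ i, {y | |realForm Bw (1 ⊗ₜ[ℚ] t.1 i) (hypPoint f y)| ≤ R} := by
        ext y; simp [hS0 t ht]
      rw [h1]
      exact MeasurableSet.iInter fun i => (isClosed_le (hc _).abs continuous_const).measurableSet
    · have h1 : {y | hypPoint f y ∈ S t} =
          {y | |realForm Bw (1 ⊗ₜ[ℚ] t.2) (hypPoint f y)| ≤ 1} ∩
            ⋂ i, {y | |realForm Bw (1 ⊗ₜ[ℚ] t.2) (hypPoint f y) *
              realForm Bw (1 ⊗ₜ[ℚ] t.1 i) (hypPoint f y)| ≤ R} := by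
        ext y; simp [hS1 t ht]
      rw [h1]
      exact (isClosed_le (hc _).abs continuous_const).measurableSet.inter
        (MeasurableSet.iInter fun i =>
          (isClosed_le ((hc _).mul (hc _)).abs continuous_const).measurableSet)
  have hcover : ∀ Z, realForm Bw Z Z = -1 → realForm Bw Z (f (Fin.last n)) < 0 →
      ∃ t ∈ hT'fin.toFinset, ∃ g, ∃ Z' ∈ S t, ρ g Z' = Z := fun Z hZ _ => by
    obtain ⟨c, e, hc, hee, hcc, hce, hcase⟩ := hred Z hZ
    simp only [latticePoint_baseChange] at hc hee hcc hce hcase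
    set x : (Fin (n + 1) → W) × W := (fun i => ∑ j, c i j • β j, ∑ j, e j • β j) with hx
    have hMsum : ∀ a : Fin (n + 1) → ℤ, ∑ j, a j • β j ∈ M := fun a =>
      M.sum_mem fun j _ => M.smul_mem (a j) (hβM j)
    obtain ⟨t, htT, g, hg1, hg2⟩ := hTorb x (fun i => hMsum (c i)) (hMsum e)
      (linearIndependent_of_one_tmul hc)
      (fun i j => by
        have := (hcc i j).trans hRR
        rw [realForm_one_tmul] at this
        exact_mod_cast this)
      (fun i => by
        have := (hce i).trans hRR
        rw [realForm_one_tmul] at this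
        exact_mod_cast this)
    have hiso : Bw t.2 t.2 = 0 := by
      rw [← hσ g, hg2]
      rw [realForm_one_tmul] at hee
      exact_mod_cast hee
    refine ⟨t, hT'fin.mem_toFinset.mpr ⟨htT, hiso⟩, g, (ρ g).symm Z, ?_,
      (ρ g).apply_symm_apply Z⟩
    have hmove : ∀ w, realForm Bw (1 ⊗ₜ[ℚ] w) ((ρ g).symm Z) =
        realForm Bw (1 ⊗ₜ[ℚ] σ g w) Z := fun w => by
      rw [← hρ g (1 ⊗ₜ[ℚ] w), LinearEquiv.apply_symm_apply, hρt]
    rcases hcase with ⟨he, hcZ⟩ | ⟨he, heZ, hcZ⟩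
    · have ht : t.2 = 0 := by
        have h1 : σ g t.2 = 0 := by rw [hg2, hx, he]; simp
        exact (map_eq_zero_iff (σ g) (σ g).injective).mp h1
      rw [hS0 t ht]
      intro i
      rw [hmove, hg1]
      exact (hcZ i).trans hRR
    · have ht : t.2 ≠ 0 := fun h0 => by
        rw [h0, map_zero] at hg2
        have h1 : ∑ j, (e j : ℚ) • β j = 0 := by
          simp only [Int.cast_smul_eq_zsmul]
          exact hg2.symm
        refine he (funext fun j => ?_)
        have := Fintype.linearIndependent_iff.mp β.linearIndependent _ h1 j
        exact_mod_cast this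
      rw [hS1 t ht]
      refine ⟨by rw [hmove, hg2]; exact heZ, fun i => ?_⟩
      rw [hmove, hmove, hg1, hg2]
      exact (hcZ i).trans hRR
  have hfin : ∀ t ∈ hT'fin.toFinset,
      ∫⁻ x in cone n ∩ coneProj ⁻¹' {y | hypPoint f y ∈ S t}, k (hypPoint f (coneProj x)) < ∞ := by
    intro t ht
    obtain ⟨htT, hiso⟩ := hT'fin.mem_toFinset.mp ht
    obtain ⟨htM, htc⟩ := hT t htT
    have htc' := linearIndependent_one_tmul hm htc
    by_cases ht0 : t.2 = 0
    · rw [hS0 t ht0]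
      refine lintegral_compact_region_lt_top hb hf fb hfb (fun ν => ?_) htc' R
      obtain ⟨C, hC⟩ := exists_norm_thetaKernel_le hb hM hm hlast fb u hv h ν
      rw [hfb] at hC
      exact ⟨C, fun Z hZ hν => hkle Z C (hC Z hZ hν).2⟩
    · rw [hS1 t ht0]
      refine lintegral_cusp_region_lt_top hb hf fb hfb (by rw [realForm_one_tmul, hiso]; simp)
        (fun h0 => ht0 ?_) (fun R' hR' => ?_) htc' R
      · have h1 : (1 : ℝ) ⊗ₜ[ℚ] t.2 = ∑ i, (β.repr t.2 i : ℝ) • β.baseChange ℝ i := by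
          conv_lhs => rw [← β.sum_repr t.2, TensorProduct.tmul_sum]
          refine Finset.sum_congr rfl fun i _ => ?_
          rw [Module.Basis.baseChange_apply, TensorProduct.smul_tmul', TensorProduct.tmul_smul,
            TensorProduct.smul_tmul']
          congr 1
        rw [h0] at h1
        have h2 := Fintype.linearIndependent_iff.mp (β.baseChange ℝ).linearIndependent _ h1.symm
        rw [← β.sum_repr t.2]
        exact Finset.sum_eq_zero fun i _ => by
          rw [show β.repr t.2 i = 0 by exact_mod_cast h2 i, zero_smul]
      · obtain ⟨C, hC, H⟩ := exists_norm_thetaKernel_cusp_le hb hM hm hlast fb u hv h hint htM ht0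
          hiso hR'
        rw [hfb] at H
        exact ⟨C, hC, fun Z hZ h1 h2 => hkle Z _ (H Z hZ h1 h2)⟩
  have hmain := lintegral_chart_lt_top hb hf fb hfb ρ hρ
    (fun g Z hZ => by rw [hρa]; exact hσf g Z hZ) hF
    (fun g g' hgg => by simp only [hρa]; exact hdisj g g' hgg) (k := k) hmeas.enorm
    (fun g Z _ _ => hkρ g Z) hT'fin.toFinset hSm hcover hfin
  have hcoef := coefficient_thetaForm (M := M) hf hb.symm h hτ
  set c₀ : ℂ := (((2 : ℝ) ^ ((n : ℝ) / 2) * (CFC.sqrt (τ.map Complex.im)).det *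
    (-1) ^ (n + 1) : ℝ) : ℂ)
  have hsq : Measurable fun y : Fin n → ℝ => (1 / √(1 + ∑ i, y i ^ 2) : ℝ) := by fun_prop
  refine ⟨?_, ?_⟩
  · rw [funext hcoef]
    exact (((Complex.measurable_ofReal.comp hsq).const_mul c₀).mul hmeas).aestronglyMeasurable
  · change ∫⁻ y in F, ‖coefficient f (thetaForm Bw M h τ) y‖ₑ < ∞
    have h1 : ∀ y, ‖coefficient f (thetaForm Bw M h τ) y‖ₑ =
        ‖c₀‖ₑ * (ENNReal.ofReal (1 / √(1 + ∑ i, y i ^ 2)) * k (hypPoint f y)) := fun y => by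
      have h2 : ‖((1 / √(1 + ∑ i, y i ^ 2) : ℝ) : ℂ)‖ₑ =
          ENNReal.ofReal (1 / √(1 + ∑ i, y i ^ 2)) := by
        rw [← ofReal_norm, Complex.norm_real, Real.norm_of_nonneg (by positivity)]
      rw [hcoef, enorm_mul, enorm_mul, mul_assoc, h2]
    simp only [h1]
    rw [lintegral_const_mul' _ _ enorm_ne_top]
    exact ENNReal.mul_lt_top enorm_lt_top hmain

end Integrability

/-! ### Fundamental domains on special cycles -/

section SpecialCycle

open MeasureTheory

variable {V : Type*} [AddCommGroup V] [Module ℚ V] {B : LinearMap.BilinForm ℚ V}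
  {L : Submodule ℤ V} {U : Submodule ℚ V}

/-- The action on `U^⊥` of an isometry that fixes `U`. -/
def restrictPerp {n : ℕ} {h : Fin n → V} {g : V ≃ₗ[ℚ] V} (hg : g ∈ fixingGroup B L U h) :
    perp B U ≃ₗ[ℚ] perp B U :=
  { (g : V →ₗ[ℚ] V).restrict (fun _ hw => map_mem_perp hg hw) with
    invFun := fun w => ⟨g⁻¹ w, map_mem_perp ((fixingGroup B L U h).inv_mem hg) w.2⟩
    left_inv := fun w => Subtype.ext (g.symm_apply_apply w)
    right_inv := fun w => Subtype.ext (g.apply_symm_apply w) }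

lemma inclReal_actReal_restrictPerp {n : ℕ} {h : Fin n → V} {g : V ≃ₗ[ℚ] V}
    (hg : g ∈ fixingGroup B L U h) (Z : ℝ ⊗[ℚ] (perp B U)) :
    inclReal (perp B U) (actReal (restrictPerp hg) Z) = actReal g (inclReal (perp B U) Z) := by
  have h1 : inclReal (perp B U) ∘ₗ actReal (restrictPerp hg) =
      actReal g ∘ₗ inclReal (perp B U) := by
    ext w
    simp [actReal, inclReal]
    rfl
  exact LinearMap.congr_fun h1 Z

lemma countable_linearEquiv [FiniteDimensional ℚ V] : Countable (V ≃ₗ[ℚ] V) := by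
  set β := Module.finBasis ℚ V
  have : Countable V := β.equivFun.injective.countable
  have hinj : Function.Injective fun (g : V ≃ₗ[ℚ] V) i => g (β i) := fun g k hgk =>
    LinearEquiv.toLinearMap_injective (β.ext fun i => congrFun hgk i)
  exact hinj.countable

/-- A top degree theta form on a special cycle is integrable over a fundamental domain. -/
lemma integrableForm_thetaForm_perp [FiniteDimensional ℚ V] {p n : ℕ} (hB : IsLorentzian B p)
    (hL : IsIntegralLattice B L) {Z₀ : ℝ ⊗[ℚ] V} (hZ₀ : realForm B Z₀ Z₀ = -1)
    {Γ : Subgroup (V ≃ₗ[ℚ] V)} (hΓ : IsLevelGroup B L Z₀ Γ)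
    (hU : ∀ x ∈ U, x ≠ 0 → 0 < B x x) (hdim : Module.finrank ℚ U + n = p) (h : Fin n → perp B U)
    {τ : Matrix (Fin n) (Fin n) ℂ} (hτ : τ ∈ SiegelUpperHalf n)
    {f : Fin (n + 1) → ℝ ⊗[ℚ] (perp B U)} (hf : IsChartFrame B Z₀ U f) {F : Set (Fin n → ℝ)}
    (hF : IsFundDomain B Γ U f F) :
    IntegrableForm f F (thetaForm (B.restrict (perp B U)) (latticeIn L (perp B U)) h τ) := by
  have hV := hB.isHyperbolic
  have hm : Module.finrank ℚ (perp B U) = n + 1 := by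
    have := Submodule.finrank_add_eq_of_isCompl (isCompl_perp hB.symm hU)
    rw [hB.dim] at this
    omega
  have hint : ∀ x ∈ L, ∀ y ∈ L, ∃ z : ℤ, B x y = z := fun x hx y hy => by
    obtain ⟨z, hz⟩ := Submodule.mem_one.mp (hL.integral hx y hy)
    exact ⟨z, by simpa using hz.symm⟩
  set G := ↥(Γ ⊓ fixingGroup B L U (fun s => (h s : V)))
  have : Countable (V ≃ₗ[ℚ] V) := countable_linearEquiv
  have hsheet : ∀ X : ℝ ⊗[ℚ] (perp B U), realForm (B.restrict (perp B U)) X X = -1 →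
      (inclReal (perp B U) X ∈ sheet (realForm B) Z₀ ↔
        realForm (B.restrict (perp B U)) X (f (Fin.last n)) < 0) := fun X hX => by
    obtain ⟨h1, h2⟩ := hf.2
    rw [← realForm_inclReal] at hX ⊢
    refine ⟨fun h => hV.neg_of_neg_of_neg hZ₀ hX h1 h.2 h2, fun h => ⟨hX, ?_⟩⟩
    exact hV.neg_of_neg_of_neg h1 hX hZ₀ h (by rwa [hV.symm])
  refine integrableForm_thetaForm (hV.restrict _) (hL.isFullLattice.latticeIn _)
    (fun x hx y hy => hint x hx y hy) hm hf.1 h hτ (fun g : G => restrictPerp g.2.2)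
    (fun g x y => g.2.2.1 x y) (fun g x => g.2.2.2.2.1 x) (fun g s => g.2.2.2.2.2 s)
    (fun g Z hZ => ?_) (fun R => ?_) hF.measurable (fun g g' hgg => ?_)
  · have h1 := (hΓ.le g.2.1).preservesSheet (inclReal (perp B U) Z)
    rw [← inclReal_actReal_restrictPerp g.2.2, hsheet Z hZ, hsheet _ (by
      rw [realForm_actReal (B := B.restrict (perp B U)) (fun x y => g.2.2.1 x y), hZ])] at h1
    exact h1
  · obtain ⟨T, hTS, hTfin, hT⟩ :=
      exists_finite_orbits hB.symm hV hZ₀ hL hΓ.finiteIndex hU h (n + 1) R hm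
    refine ⟨T, hTfin, fun t ht => ⟨(hTS ht).2.1, (hTS ht).2.2.1⟩, fun x h1 h2 h3 h4 h5 => ?_⟩
    obtain ⟨t, ht, γ, hγ, hγ1, hγ2⟩ := hT x ⟨h1, h2, h3, h4, h5⟩
    exact ⟨t, ht, ⟨γ, hγ⟩, fun i => Subtype.ext (hγ1 i), Subtype.ext hγ2⟩
  · have h1 : (g : V ≃ₗ[ℚ] V) * (g' : V ≃ₗ[ℚ] V)⁻¹ ∈ stabilizer Γ U :=
      (stabilizer Γ U).mul_mem ⟨g.2.1, g.2.2.2.1⟩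
        ((stabilizer Γ U).inv_mem ⟨g'.2.1, g'.2.2.2.1⟩)
    refine measure_mono_null ?_ (hF.disjoint _ h1 fun h => hgg (Subtype.ext (mul_inv_eq_one.mp h)))
    rintro y ⟨hy, y', hy', Z, hZ, hZ'⟩
    refine ⟨hy, y', hy', ?_⟩
    rw [← hZ, ← hZ', inclReal_actReal_restrictPerp, inclReal_actReal_restrictPerp, ← actReal_mul,
      inv_mul_cancel_right]

end SpecialCycle

end SpecialCycleTheta

theorem mainTheorem10 {V : Type*} [AddCommGroup V] [Module ℚ V] [FiniteDimensional ℚ V]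
    (p n : ℕ) (B : LinearMap.BilinForm ℚ V) (hB : IsLorentzian B p)
    (L : Submodule ℤ V) (hL : IsIntegralLattice B L)
    (Z₀ : ℝ ⊗[ℚ] V) (hZ₀ : realForm B Z₀ Z₀ = -1)
    (Γ : Subgroup (V ≃ₗ[ℚ] V)) (hΓ : IsLevelGroup B L Z₀ Γ)
    (h : Fin n → V) (hh : ∀ s, h s ∈ LinearMap.BilinForm.dualSubmodule B L)
    (U : Submodule ℚ V) (hU : ∀ x ∈ U, x ≠ 0 → 0 < B x x) (hdim : Module.finrank ℚ U + n = p) :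
    -- the pullback identity for the Schwartz forms, on `B_U`
    (∀ (X₁ : Fin n → ℝ ⊗[ℚ] U) (X₂ W : Fin n → ℝ ⊗[ℚ] (perp B U)) (Z : ℝ ⊗[ℚ] (perp B U)),
      inclReal (perp B U) Z ∈ sheet (realForm B) Z₀ →
      (∀ j, realForm (B.restrict (perp B U)) (W j) Z = 0) →
      phi (realForm B) (fun s => inclReal U (X₁ s) + inclReal (perp B U) (X₂ s))
          (inclReal (perp B U) Z) (fun j => inclReal (perp B U) (W j)) =
        gaussianPos (realForm (B.restrict U)) X₁ *
          phi (realForm (B.restrict (perp B U))) X₂ Z W) ∧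
    -- the decomposition of the coset exists
    (∃ (r : ℕ) (h₁ : Fin r → Fin n → U) (h₂ : Fin r → Fin n → perp B U),
      IsDecomposition B L U h h₁ h₂) ∧
    -- for every such decomposition all series and integrals converge and the formula holds
    (∀ (r : ℕ) (h₁ : Fin r → Fin n → U) (h₂ : Fin r → Fin n → perp B U),
      IsDecomposition B L U h h₁ h₂ →
      ∀ τ ∈ SiegelUpperHalf n,
        (∀ Z ∈ sheet (realForm B) Z₀, ∀ W : Fin n → ℝ ⊗[ℚ] V,
          Summable fun X : coset L h => phiTau (realForm B) τ (toReal X.1) Z W) ∧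
        (∀ i, Summable fun X : coset (latticeIn L U) (h₁ i) =>
          thetaTerm (B.restrict U) τ X.1) ∧
        (∀ i, ∀ Z : ℝ ⊗[ℚ] (perp B U), inclReal (perp B U) Z ∈ sheet (realForm B) Z₀ →
          ∀ W : Fin n → ℝ ⊗[ℚ] (perp B U),
          Summable fun X : coset (latticeIn L (perp B U)) (h₂ i) =>
            phiTau (realForm (B.restrict (perp B U))) τ (toReal X.1) Z W) ∧
        ∀ f : Fin (n + 1) → ℝ ⊗[ℚ] (perp B U), IsChartFrame B Z₀ U f →
        ∀ F : Set (Fin n → ℝ), IsFundDomain B Γ U f F →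
          IntegrableForm f F (pullback (inclReal (perp B U)) (thetaForm B L h τ)) ∧
          (∀ i, IntegrableForm f F
            (thetaForm (B.restrict (perp B U)) (latticeIn L (perp B U)) (h₂ i) τ)) ∧
          liftOfCycle B L h U f F τ =
            ∑ i, thetaSeries (B.restrict U) (latticeIn L U) (h₁ i) τ *
              topThetaIntegral B L U (h₂ i) f F τ) := by
  have hV := hB.isHyperbolic
  have hLf := hL.isFullLattice
  have hW := hV.restrict (perp B U)
  refine ⟨fun X₁ X₂ W Z _ _ => phi_add_inclReal hB.symm U X₁ X₂ W Z,
    exists_isDecomposition hB.symm hU hL h hh, fun r h₁ h₂ hd τ hτ => ⟨fun Z hZ W =>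
      summable_phiTau hV hLf h hτ hZ.1 W, fun i => ?_, fun i Z hZ W => ?_, fun f hf F hF => ?_⟩⟩
  · refine summable_thetaTerm (B := B.restrict U) (fun x y => hB.symm x y)
      (fun x hx => hU x x.2 ?_)
      (hLf.latticeIn U) _ hτ
    simpa using hx
  · exact summable_phiTau hW (hLf.latticeIn _) _ hτ (by rw [← realForm_inclReal]; exact hZ.1) W
  · have hi : ∀ i, IntegrableForm f F
        (thetaForm (B.restrict (perp B U)) (latticeIn L (perp B U)) (h₂ i) τ) := fun i =>
      integrableForm_thetaForm_perp hB hL hZ₀ hΓ hU hdim (h₂ i) hτ hf hF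
    have hsplit : coefficient f (pullback (inclReal (perp B U)) (thetaForm B L h τ)) = fun y =>
        ∑ i, thetaSeries (B.restrict U) (latticeIn L U) (h₁ i) τ * coefficient f
          (thetaForm (B.restrict (perp B U)) (latticeIn L (perp B U)) (h₂ i) τ) y := by
      funext y
      exact thetaForm_inclReal hB.symm hU hV hLf hd hτ (hf.1.hypPoint_self y) _
    refine ⟨?_, hi, ?_⟩
    · rw [IntegrableForm, hsplit]
      exact MeasureTheory.integrable_finsetSum _ fun i _ => (hi i).const_mul _
    · rw [liftOfCycle, integralForm, hsplit,
        MeasureTheory.integral_finsetSum _ fun i _ => (hi i).const_mul _]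
      exact Finset.sum_congr rfl fun i _ => MeasureTheory.integral_const_mul _ _
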